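/- \textbf{Definitions.} A \emph{plane tree} is a finite tree together with a counter-clockwise cyclic order of the neighbours of each node; it is \emph{partially directed} if some of its edges are given one of their two directions. A node is \emph{terminal} if it has degree one. An \emph{outer path} of a plane tree is a sequence $(x_1,\dots,x_n)$ of pairwise distinct nodes visited consecutively in a counter-clockwise walk along the outer face of the tree; that is, consecutive nodes are adjacent and, for $1<i<n$, $x_{i+1}$ is the neighbour of $x_i$ that follows $x_{i-1}$ in the counter-clockwise order around $x_i$. Polygons are simple polygons in the plane. Two vertices of a polygon are \emph{visible} if the closed segment joining them lies in the closed polygon. The \emph{visibility graph} of a polygon has the vertices of the polygon as its vertices and, as its edges, the open segments joining visible pairs of vertices. A polygon is \emph{deflated} if no two edges of its visibility graph intersect; the edges of the visibility graph are then those of the unique triangulation of the polygon. (A triangulation of a polygon is a partition of it into triangles whose vertices are vertices of the polygon.) The \emph{directed dual} of a triangulation $T$ of a polygon is the partially directed plane tree with one node for each triangle of $T$ and one (terminal) node for each edge of the polygon, in which two nodes are adjacent if the corresponding triangles or polygon edges share an edge; the cyclic order at the node of a triangle is the counter-clockwise order of the edges of that triangle; and the edge joining the nodes of two adjacent triangles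 $a,b$ is directed $a\to b$ exactly when the quadrilateral $a\cup b$ has a reflex vertex that lies to the right of a segment going from $a$ to $b$ inside the open quadrilateral. The directed dual of a deflated polygon is that of its unique triangulation. \textbf{Theorem.} Let $D$ be a partially directed plane tree with at least one non-terminal node, in which every non-terminal node has degree three and in which an edge is directed if and only if it joins two non-terminal nodes. Then $D$ is (isomorphic to) the directed dual of a deflated polygon if and only if $D$ contains no outer path $(x_1,x_2,\dots,x_n)$ with $n\ge 4$ such that the edges $x_1x_2$ and $x_{n-1}x_n$ are both directed forward, i.e. $x_1\to x_2$ and $x_{n-1}\to x_n$. -/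

import Mathlib

/-! ## Partially directed plane trees -/

/-- A plane tree, given by its rotation system: `rot v w` is the neighbour of `v` that follows the
neighbour `w` in the counter-clockwise cyclic order around `v`. Only the values of `rot v` on the
neighbours of `v` carry information. -/
structure PlaneTree (V : Type*) where
  graph : SimpleGraph V
  isTree : graph.IsTree
  rot : V → Equiv.Perm V
  rot_isCycleOn : ∀ v, (rot v).IsCycleOn (graph.neighborSet v)

/-- A partially directed plane tree: some of its edges carry a direction (`Dir x y` means `x → y`),
and each edge carries at most one. -/
structure PartiallyDirectedPlaneTree (V : Type*) extends PlaneTree V where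
  Dir : V → V → Prop
  dir_adj : ∀ x y, Dir x y → graph.Adj x y
  dir_asymm : ∀ x y, Dir x y → ¬ Dir y x

namespace PlaneTree

variable {V : Type*}

/-- The number of neighbours of a node. -/
noncomputable def deg (D : PlaneTree V) (v : V) : ℕ := (D.graph.neighborSet v).ncard

/-- Terminal nodes are the nodes of degree one. -/
def IsTerminal (D : PlaneTree V) (v : V) : Prop := D.deg v = 1

/-- `(x 1, …, x n)` is an outer path: a stretch of the counter-clockwise walk along the outer face
in which no node is visited twice. That walk, having come to a node from its neighbour `w`, goes on
to the neighbour that follows `w` counter-clockwise, keeping the outer face on its right.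
Values of `x` outside `1, …, n` are irrelevant. -/
structure IsOuterPath (D : PlaneTree V) (n : ℕ) (x : ℕ → V) : Prop where
  injOn : Set.InjOn x (Set.Icc 1 n)
  adj : ∀ i, 1 ≤ i → i + 1 ≤ n → D.graph.Adj (x i) (x (i + 1))
  turn : ∀ i, 1 ≤ i → i + 2 ≤ n → D.rot (x (i + 1)) (x i) = x (i + 2)

end PlaneTree

/-- `(x 1, …, x n)` is an illegal path. -/
def PartiallyDirectedPlaneTree.IsIllegalPath {V : Type*} (D : PartiallyDirectedPlaneTree V)
    (n : ℕ) (x : ℕ → V) : Prop :=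
  4 ≤ n ∧ D.IsOuterPath n x ∧ D.Dir (x 1) (x 2) ∧ D.Dir (x (n - 1)) (x n)

/-! ## Polygons -/

/-- Twice the signed area of the triangle `abc`: positive iff `(a, b, c)` is a left turn,
negative iff it is a right turn, zero iff the points are collinear. -/
def orient (a b c : ℝ × ℝ) : ℝ :=
  (b.1 - a.1) * (c.2 - a.2) - (b.2 - a.2) * (c.1 - a.1)

/-- A simple polygon in the plane with `m + 3` vertices, listed in one of the two directions along
the boundary. Indices are cyclic: `Fin.last + 1 = 0`. Edges meet only where
consecutive edges share their common endpoint. -/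
structure SimplePolygon (m : ℕ) where
  vert : Fin (m + 3) → ℝ × ℝ
  vert_injective : Function.Injective vert
  simple : ∀ i j, i ≠ j →
    ∀ z ∈ segment ℝ (vert i) (vert (i + 1)) ∩ segment ℝ (vert j) (vert (j + 1)),
      (j = i + 1 ∧ z = vert j) ∨ (i = j + 1 ∧ z = vert i)

namespace SimplePolygon

variable {m : ℕ} (P : SimplePolygon m)

/-- The boundary curve. -/
def boundary : Set (ℝ × ℝ) := ⋃ i, segment ℝ (P.vert i) (P.vert (i + 1))

/-- The open polygon: the points off the boundary that lie in a bounded component of its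
complement. -/
def openRegion : Set (ℝ × ℝ) :=
  {z | z ∉ P.boundary ∧ Bornology.IsBounded (connectedComponentIn P.boundaryᶜ z)}

/-- The closed polygon. -/
def closedRegion : Set (ℝ × ℝ) := P.boundary ∪ P.openRegion

/-- Two vertices see each other if the segment joining them lies in the closed polygon. -/
def Visible (i j : Fin (m + 3)) : Prop :=
  segment ℝ (P.vert i) (P.vert j) ⊆ P.closedRegion

/-- A polygon is deflated if no two different edges (open segments joining visible pairs of
vertices) of its visibility graph intersect. -/
def IsDeflated : Prop :=
  ∀ i j k l, i ≠ j → k ≠ l → P.Visible i j → P.Visible k l → s(i, j) ≠ s(k, l) →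
    Disjoint (openSegment ℝ (P.vert i) (P.vert j)) (openSegment ℝ (P.vert k) (P.vert l))

/-- The closed convex hull of a set of vertices. -/
def hull (t : Finset (Fin (m + 3))) : Set (ℝ × ℝ) := convexHull ℝ (P.vert '' t)

/-- `a, b, c` are the vertices of the nondegenerate triangle `t` in counter-clockwise order. -/
def IsCCWListing (t : Finset (Fin (m + 3))) (a b c : Fin (m + 3)) : Prop :=
  t = {a, b, c} ∧ 0 < orient (P.vert a) (P.vert b) (P.vert c)

/-- `T` is a triangulation of `P`: a partition of the closed polygon into nondegenerate triangles
(given by their sets of vertices) whose vertices are vertices of `P`. -/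
structure IsTriangulation (T : Finset (Finset (Fin (m + 3)))) : Prop where
  triangle : ∀ t ∈ T, ∃ a b c, P.IsCCWListing t a b c
  cover : ⋃ t ∈ T, P.hull t = P.closedRegion
  disjoint : ∀ t ∈ T, ∀ t' ∈ T, t ≠ t' → Disjoint (interior (P.hull t)) (interior (P.hull t'))

/-- The pair of triangles `(t, t')` sharing the edge `vw` is right-reflex. Here `u` and `u'` are the
vertices of `t` and `t'` opposite to `vw`, so that the union of `t` and `t'` is the quadrilateral
with counter-clockwise vertices `u, v, u', w`; walking from `t` to `t'` across `vw` one has `v` on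
the right and `w` on the left; and `v` is reflex as `(u, v, u')` is a right turn. -/
def IsRightReflex (t t' : Finset (Fin (m + 3))) : Prop :=
  ∃ u v w u', P.IsCCWListing t u v w ∧ P.IsCCWListing t' v u' w ∧
    orient (P.vert u) (P.vert v) (P.vert u') < 0

end SimplePolygon

/-- The nodes of the dual tree: the triangles of `T` and the polygon edges, the edge with index `i`
joining the vertices `i` and `i + 1`. -/
abbrev DualNode {m : ℕ} (T : Finset (Finset (Fin (m + 3)))) : Type :=
  {t : Finset (Fin (m + 3)) // t ∈ T} ⊕ Fin (m + 3)

/-- The set of vertices of the triangle or polygon edge of a node. -/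
def DualNode.verts {m : ℕ} {T : Finset (Finset (Fin (m + 3)))} :
    DualNode T → Finset (Fin (m + 3))
  | .inl t => t.1
  | .inr i => {i, i + 1}

/-- The triangle or polygon edge of each of the two nodes has `ab` as an edge. -/
def DualNode.ShareEdge {m : ℕ} {T : Finset (Finset (Fin (m + 3)))} (x y : DualNode T)
    (a b : Fin (m + 3)) : Prop :=
  a ≠ b ∧ a ∈ x.verts ∧ b ∈ x.verts ∧ a ∈ y.verts ∧ b ∈ y.verts

/-- `D` is, under the bijection `φ` from its nodes to the triangles and polygon edges of `T`, the
directed dual of the triangulation `T` of `P`. -/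
structure IsDirectedDualVia {V : Type*} (D : PartiallyDirectedPlaneTree V) {m : ℕ}
    (P : SimplePolygon m) (T : Finset (Finset (Fin (m + 3)))) (φ : V ≃ DualNode T) : Prop where
  /-- Different nodes are adjacent iff their correspondents share an edge. -/
  adj_iff : ∀ x y, D.graph.Adj x y ↔ x ≠ y ∧ ∃ a b, (φ x).ShareEdge (φ y) a b
  /-- If `ab, bc, ca` are the edges of a triangle in counter-clockwise order, then the
  corresponding edges of its node follow each other in counter-clockwise order. -/
  rot_eq : ∀ (x y z : V) (t : {t // t ∈ T}) (a b c : Fin (m + 3)), φ x = Sum.inl t →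
    P.IsCCWListing t.1 a b c → D.graph.Adj x y → (φ x).ShareEdge (φ y) a b →
    D.graph.Adj x z → (φ x).ShareEdge (φ z) b c → D.rot x y = z
  /-- An edge is directed `x → y` iff it joins the nodes of a right-reflex pair of triangles. -/
  dir_iff : ∀ x y, D.Dir x y ↔
    ∃ t t' : {t // t ∈ T}, φ x = Sum.inl t ∧ φ y = Sum.inl t' ∧ P.IsRightReflex t.1 t'.1

/-- `D` is the directed dual of (the triangulation of) a deflated polygon. -/
def IsDirectedDualOfDeflatedPolygon {V : Type*} (D : PartiallyDirectedPlaneTree V) : Prop :=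
  ∃ (m : ℕ) (P : SimplePolygon m) (T : Finset (Finset (Fin (m + 3)))) (φ : V ≃ DualNode T),
    P.IsDeflated ∧ P.IsTriangulation T ∧ IsDirectedDualVia D P T φ

open Filter Topology Relation

/-! ## Orientation and triangles -/

/-! Necessity. An outer path turns around a vertex. A walk that enters a triangle across an edge at
`v`, with `v` on its right, and then takes the next edge counter-clockwise leaves across the other
edge at `v`. A directed step is reflex at the vertex on its right. Hence all triangles of an illegal
path contain the vertex `v` at which the first pair is reflex, and the last pair is reflex at the
same `v`. For `n ≥ 4` the two pairs have no triangle in common, so triangles with disjoint interiors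
would have angles at `v` of total size more than 2π. This is `false_of_two_reflex`, where angles are
replaced by signs of orientations and the Plücker relation.

Sufficiency. The polygon is grown from one triangle by attaching a triangle `abc` for one tree node
at a time, on the polygon edge `ab` of an old triangle `abd`. If the pair has to be reflex at `a`,
the apex `c` is put very close to `a`, almost opposite to `d`. Suppose that every other triangle at
`a` lies in the open half-plane beyond the line `ad`, apart from points on the ray `ad` itself. Then
there is room for `c`, and `c` sees no old vertices but `a` and `b`. So the only new visibility
edges are `ac` and `bc`, and the polygon stays deflated (`exists_insert_triangle`).

The half-plane condition is where legality enters. The triangles at a polygon vertex form one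
stretch of the outer walk, a fan. If the walk around `a` ends with the directed step from `p` to the
new node `x`, then no step of it before the one into `p` is directed forward, since that would give
an illegal path. A fan without forward steps has an angle less than π, which is the invariant
`convex` of `Realization`. Thus `orient_of_mem_start` holds, and `orient_of_mem_end` is its mirror
image. The invariant survives the extension: at the far end of the edge the fan changes only by a
small perturbation of one leg.

The region enclosed by the polygon is identified without the Jordan curve theorem. Two further
invariants are carried along: the union of the triangles has connected complement, and off the
polygon edges it is open. They force the union to be the closed polygon (`closedRegion_eq_region`).
-/

theorem orient_rotate (a b c : ℝ × ℝ) : orient b c a = orient a b c := by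
  unfold orient; ring

theorem orient_swap (a b c : ℝ × ℝ) : orient a c b = -orient a b c := by
  unfold orient; ring

theorem orient_swap_left (a b c : ℝ × ℝ) : orient b a c = -orient a b c := by
  unfold orient; ring

theorem orient_self_left (a b : ℝ × ℝ) : orient a a b = 0 := by
  unfold orient; ring

theorem orient_self_right (a b : ℝ × ℝ) : orient a b b = 0 := by
  unfold orient; ring

theorem orient_self_outer (a b : ℝ × ℝ) : orient a b a = 0 := by
  unfold orient; ring

@[fun_prop]
theorem Continuous.orient {X : Type*} [TopologicalSpace X] {f g h : X → ℝ × ℝ}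
    (hf : Continuous f) (hg : Continuous g) (hh : Continuous h) :
    Continuous fun x => orient (f x) (g x) (h x) := by
  unfold _root_.orient; fun_prop

/-- The orientation is affine in its last argument. -/
theorem orient_combo (p q a b c : ℝ × ℝ) {l m n : ℝ} (h : l + m + n = 1) :
    orient p q (l • a + m • b + n • c) = l * orient p q a + m * orient p q b + n * orient p q c := by
  obtain rfl : l = 1 - m - n := by linarith
  simp only [orient, Prod.fst_add, Prod.snd_add, Prod.smul_fst, Prod.smul_snd, smul_eq_mul]
  ring

theorem orient_combo₂ (p q a b : ℝ × ℝ) {l m : ℝ} (h : l + m = 1) :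
    orient p q (l • a + m • b) = l * orient p q a + m * orient p q b := by
  obtain rfl : l = 1 - m := by linarith
  simp only [orient, Prod.fst_add, Prod.snd_add, Prod.smul_fst, Prod.smul_snd, smul_eq_mul]
  ring

theorem mem_convexHull_triple {a b c z : ℝ × ℝ} :
    z ∈ convexHull ℝ {a, b, c} ↔
      ∃ l m n : ℝ, 0 ≤ l ∧ 0 ≤ m ∧ 0 ≤ n ∧ l + m + n = 1 ∧ l • a + m • b + n • c = z := by
  rw [convexHull_insert (by simp), convexHull_pair]
  simp only [mem_convexJoin, Set.mem_singleton_iff, exists_eq_left]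
  constructor
  · rintro ⟨y, ⟨p, q, hp, hq, hpq, rfl⟩, ⟨r, s, hr, hs, hrs, rfl⟩⟩
    exact ⟨r, s * p, s * q, hr, by positivity, by positivity, by
      rw [add_assoc, ← mul_add, hpq]; linarith, by simp only [smul_add, smul_smul, add_assoc]⟩
  · rintro ⟨l, m, n, hl, hm, hn, h, rfl⟩
    rcases eq_or_lt_of_le (add_nonneg hm hn) with h0 | h0
    · obtain rfl : m = 0 := by linarith
      obtain rfl : n = 0 := by linarith
      exact ⟨b, left_mem_segment _ _ _, 1, 0, by simp, by simp, by simp, by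
        simp [show l = 1 by linarith]⟩
    · refine ⟨(m / (m + n)) • b + (n / (m + n)) • c,
        ⟨_, _, by positivity, by positivity, by field_simp, rfl⟩, l, m + n, hl, h0.le,
        by linarith, ?_⟩
      simp only [smul_add, smul_smul, add_assoc]
      congr 3 <;> field_simp

/-- Barycentric coordinates with respect to a triangle. -/
theorem barycentric (a b c z : ℝ × ℝ) (h : orient a b c ≠ 0) :
    (orient b c z / orient a b c) • a + (orient c a z / orient a b c) • b +
      (orient a b z / orient a b c) • c = z := by
  ext
  · simp only [Prod.fst_add, Prod.smul_fst, smul_eq_mul]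
    field_simp; unfold orient; ring
  · simp only [Prod.snd_add, Prod.smul_snd, smul_eq_mul]
    field_simp; unfold orient; ring

theorem orient_sum (a b c z : ℝ × ℝ) :
    orient b c z + orient c a z + orient a b z = orient a b c := by
  unfold orient; ring

/-- The three orientations, divided by `orient a b c`, are the barycentric coordinates of `z`. -/
theorem mem_triangle_iff {a b c z : ℝ × ℝ} (h : 0 < orient a b c) :
    z ∈ convexHull ℝ {a, b, c} ↔ 0 ≤ orient a b z ∧ 0 ≤ orient b c z ∧ 0 ≤ orient c a z := by
  rw [mem_convexHull_triple]
  constructor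
  · rintro ⟨l, m, n, hl, hm, hn, hs, rfl⟩
    simp only [orient_combo _ _ _ _ _ hs, orient_self_right, orient_self_outer,
      ← orient_rotate a b c, ← orient_rotate b c a]
    simp only [orient_rotate]
    refine ⟨?_, ?_, ?_⟩ <;> simp only [mul_zero, zero_add, add_zero] <;> positivity
  · rintro ⟨h1, h2, h3⟩
    refine ⟨_, _, _, by positivity, by positivity, by positivity, ?_, barycentric a b c z h.ne'⟩
    rw [← add_div, ← add_div, orient_sum, div_self h.ne']

theorem triangle_rotate (a b c : ℝ × ℝ) : ({b, c, a} : Set (ℝ × ℝ)) = {a, b, c} := by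
  ext; simp; tauto

theorem triangle_swap (a b c : ℝ × ℝ) : ({b, a, c} : Set (ℝ × ℝ)) = {a, b, c} := by
  ext; simp; tauto

theorem isOpen_openTriangle (a b c : ℝ × ℝ) :
    IsOpen {z | 0 < orient a b z ∧ 0 < orient b c z ∧ 0 < orient c a z} := by
  have h (p q : ℝ × ℝ) : IsOpen {z | 0 < orient p q z} :=
    isOpen_lt continuous_const (by fun_prop)
  exact (h a b).inter ((h b c).inter (h c a))

theorem openTriangle_subset_interior {a b c : ℝ × ℝ} (h : 0 < orient a b c) :
    {z | 0 < orient a b z ∧ 0 < orient b c z ∧ 0 < orient c a z} ⊆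
      interior (convexHull ℝ {a, b, c}) :=
  interior_maximal (fun _ hz => (mem_triangle_iff h).2 ⟨hz.1.le, hz.2.1.le, hz.2.2.le⟩)
    (isOpen_openTriangle a b c)

theorem orient_eq_zero_of_mem_segment {a b z : ℝ × ℝ} (h : z ∈ segment ℝ a b) :
    orient a b z = 0 := by
  obtain ⟨l, m, -, -, h, rfl⟩ := h
  rw [orient_combo₂ _ _ _ _ h, orient_self_right, orient_self_outer]; ring

theorem mem_segment_of_mem_triangle {a b c z : ℝ × ℝ} (h : orient a b c ≠ 0)
    (hz : z ∈ convexHull ℝ {a, b, c}) (h0 : orient a b z = 0) : z ∈ segment ℝ a b := by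
  obtain ⟨l, m, n, hl, hm, hn, hs, rfl⟩ := mem_convexHull_triple.1 hz
  rw [orient_combo _ _ _ _ _ hs, orient_self_right, orient_self_outer] at h0
  obtain rfl : n = 0 := by simpa [h] using h0
  exact ⟨l, m, hl, hm, by linarith, by simp⟩

/-- Used for faces of a single triangle: hulls of subsets of an affinely independent set meet in the
hull of the common points. -/
theorem affineIndependent_triple {a b c : ℝ × ℝ} (h : orient a b c ≠ 0) :
    AffineIndependent ℝ ((↑) : ((({a, b, c} : Finset (ℝ × ℝ)) : Set (ℝ × ℝ))) → ℝ × ℝ) := by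
  have : AffineIndependent ℝ ![a, b, c] := by
    rw [affineIndependent_iff_linearIndependent_vsub ℝ _ (0 : Fin 3)]
    have := LinearIndependent.pair_iff (R := ℝ) (x := b - a) (y := c - a)
    have h2 : LinearIndependent ℝ ![b - a, c - a] := by
      rw [this]
      intro s t hst
      have e1 : s * (b.1 - a.1) + t * (c.1 - a.1) = 0 := by simpa using congrArg Prod.fst hst
      have e2 : s * (b.2 - a.2) + t * (c.2 - a.2) = 0 := by simpa using congrArg Prod.snd hst
      constructor
      · have : s * orient a b c = 0 := by unfold orient; linear_combination e1 * (c.2 - a.2) - e2 * (c.1 - a.1)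
        simpa [h] using this
      · have : t * orient a b c = 0 := by unfold orient; linear_combination e2 * (b.1 - a.1) - e1 * (b.2 - a.2)
        simpa [h] using this
    let e : Fin 2 ≃ {x : Fin 3 // x ≠ 0} := finSuccAboveEquiv 0
    rw [← linearIndependent_equiv e]
    have hf : (fun i : {x : Fin 3 // x ≠ 0} => (![a, b, c] i -ᵥ ![a, b, c] 0 : ℝ × ℝ)) ∘ e =
        ![b - a, c - a] := by
      ext i <;> fin_cases i <;> simp [e, finSuccAboveEquiv]
    rw [hf]
    exact h2
  have hr : Set.range ![a, b, c] = (({a, b, c} : Finset (ℝ × ℝ)) : Set (ℝ × ℝ)) := by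
    ext z; simp [eq_comm]; tauto
  exact hr ▸ this.range

/-! ## Deflated complexes of triangles -/

/-- The union of a set of triangles, given by their sets of vertices. -/
def region (𝒯 : Finset (Finset (ℝ × ℝ))) : Set (ℝ × ℝ) := ⋃ t ∈ 𝒯, convexHull ℝ (t : Set (ℝ × ℝ))

/-- A set of triangles that meet along common faces, together with a set `B` containing the boundary
of their union, such that the union does not separate the plane and such that vertices that see each
other in the union lie in a common triangle. -/
structure IsDeflatedComplex (𝒯 : Finset (Finset (ℝ × ℝ))) (B : Set (ℝ × ℝ)) : Prop where
  nondeg : ∀ t ∈ 𝒯, ∃ a b c, t = {a, b, c} ∧ 0 < orient a b c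
  inter : ∀ t ∈ 𝒯, ∀ t' ∈ 𝒯,
    convexHull ℝ (t : Set (ℝ × ℝ)) ∩ convexHull ℝ (t' : Set (ℝ × ℝ)) ⊆
      convexHull ℝ ((t : Set (ℝ × ℝ)) ∩ t')
  -- This field and the next one identify the closed polygon with the region: the first keeps
  -- bounded components of the complement of the boundary inside the region, the second keeps
  -- components that meet the region from leaving it.
  compl : IsPreconnected (region 𝒯)ᶜ
  sdiff_subset_interior : region 𝒯 \ B ⊆ interior (region 𝒯)
  defl : ∀ t ∈ 𝒯, ∀ t' ∈ 𝒯, ∀ v ∈ t, ∀ w ∈ t', segment ℝ v w ⊆ region 𝒯 → ∃ s ∈ 𝒯, v ∈ s ∧ w ∈ s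

theorem mem_region {𝒯 : Finset (Finset (ℝ × ℝ))} {z : ℝ × ℝ} :
    z ∈ region 𝒯 ↔ ∃ t ∈ 𝒯, z ∈ convexHull ℝ (t : Set (ℝ × ℝ)) := by
  simp [region]

theorem isCompact_region (𝒯 : Finset (Finset (ℝ × ℝ))) : IsCompact (region 𝒯) :=
  𝒯.isCompact_biUnion fun t _ => t.finite_toSet.isCompact_convexHull ℝ

theorem region_insert (𝒯 : Finset (Finset (ℝ × ℝ))) (t : Finset (ℝ × ℝ)) :
    region (insert t 𝒯) = region 𝒯 ∪ convexHull ℝ (t : Set (ℝ × ℝ)) := by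
  ext z; simp [region, or_comm]

theorem coe_triple (a b c : ℝ × ℝ) :
    (({a, b, c} : Finset (ℝ × ℝ)) : Set (ℝ × ℝ)) = {a, b, c} := by simp

namespace IsDeflatedComplex

variable {𝒯 : Finset (Finset (ℝ × ℝ))} {B : Set (ℝ × ℝ)}

/-- A common point lies in the hull of `t ∩ t'`. Affine independence of `t` then confines it to the
hull of `F ∩ (t ∩ t')`, and affine independence of `t'` to that of the further intersection with
`G`. -/
theorem inter_faces (h : IsDeflatedComplex 𝒯 B) {t t' F G : Finset (ℝ × ℝ)} (ht : t ∈ 𝒯)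
    (ht' : t' ∈ 𝒯) (hF : F ⊆ t) (hG : G ⊆ t') :
    convexHull ℝ (F : Set (ℝ × ℝ)) ∩ convexHull ℝ (G : Set (ℝ × ℝ)) ⊆
      convexHull ℝ ((F : Set (ℝ × ℝ)) ∩ G) := by
  obtain ⟨a, b, c, rfl, hc⟩ := h.nondeg t ht
  obtain ⟨a', b', c', rfl, hc'⟩ := h.nondeg t' ht'
  set t : Finset (ℝ × ℝ) := {a, b, c}
  set t' : Finset (ℝ × ℝ) := {a', b', c'}
  rintro z ⟨hzF, hzG⟩
  have h1 := h.inter _ ht _ ht' ⟨convexHull_mono (by simpa using hF) hzF,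
    convexHull_mono (by simpa using hG) hzG⟩
  rw [← Finset.coe_inter] at h1
  have h2 := (affineIndependent_triple hc.ne').convexHull_inter (t₁ := F) (t₂ := t ∩ t') hF
    Finset.inter_subset_left
  have h3 := h2.ge ⟨hzF, h1⟩
  rw [← Finset.coe_inter] at h3
  have h4 := (affineIndependent_triple hc'.ne').convexHull_inter (t₁ := F ∩ (t ∩ t')) (t₂ := G)
    (Finset.inter_subset_right.trans Finset.inter_subset_right) hG
  have h5 := h4.ge ⟨h3, hzG⟩
  refine convexHull_mono ?_ h5
  intro y hy
  simp only [Finset.coe_inter, Set.mem_inter_iff] at hy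
  exact ⟨hy.1.1, hy.2⟩

theorem segment_subset (_h : IsDeflatedComplex 𝒯 B) {t : Finset (ℝ × ℝ)} (ht : t ∈ 𝒯) {a b : ℝ × ℝ}
    (ha : a ∈ t) (hb : b ∈ t) : segment ℝ a b ⊆ region 𝒯 := fun _ hz =>
  mem_region.2 ⟨t, ht, (convex_convexHull ℝ _).segment_subset (subset_convexHull ℝ _ ha)
    (subset_convexHull ℝ _ hb) hz⟩

end IsDeflatedComplex

/-! ### Thin triangles with an apex near a vertex. -/

theorem eq_vertex_of_functional {a b c z p q : ℝ × ℝ} (hz : z ∈ convexHull ℝ {a, b, c})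
    (ha : orient p q a = 0) (hb : orient p q b < 0) (hc : orient p q c < 0)
    (h0 : 0 ≤ orient p q z) : z = a := by
  obtain ⟨l, m, n, hl, hm, hn, hs, rfl⟩ := mem_convexHull_triple.1 hz
  rw [orient_combo _ _ _ _ _ hs, ha] at h0
  have h1 : m = 0 := by nlinarith
  have h2 : n = 0 := by nlinarith
  subst h1 h2
  obtain rfl : l = 1 := by linarith
  simp

/-- If a triangle with vertex `b` meets the segment `ba` only in `b`, then so does every triangle
`bac` with `c` close to `a`. -/
theorem eventually_triangle_inter_of_vertex {b q r a : ℝ × ℝ} (hqr : 0 < orient b q r)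
    (hab : a ≠ b) (h : ∀ z ∈ segment ℝ a b, z ∈ convexHull ℝ {b, q, r} → z = b) :
    ∀ᶠ c in 𝓝 a, ∀ z ∈ convexHull ℝ {a, b, c}, z ∈ convexHull ℝ {b, q, r} → z = b := by
  -- Otherwise `a` lies in the closed angle of the triangle at `b`, and points of `ba` close to `b`
  -- belong to the triangle. So one of the two sides at `b` has `a` strictly outside, hence also
  -- every `c` close to `a`.
  have key : orient b q a < 0 ∨ orient r b a < 0 := by
    by_contra! hcon
    have hf : Continuous fun e : ℝ => orient q r ((1 - e) • b + e • a) := by fun_prop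
    have h1 : ∀ᶠ e in 𝓝[>] (0 : ℝ), 0 < orient q r ((1 - e) • b + e • a) := by
      refine (hf.tendsto 0).mono_left nhdsWithin_le_nhds |>.eventually (lt_mem_nhds ?_)
      simpa [orient_rotate] using hqr
    obtain ⟨e, ⟨he, he0⟩, he1⟩ := ((h1.and self_mem_nhdsWithin).and
      (nhdsWithin_le_nhds (gt_mem_nhds zero_lt_one))).exists
    have hz := h ((1 - e) • b + e • a)
      ⟨e, 1 - e, le_of_lt he0, by linarith, by ring, by rw [add_comm]⟩
      ((mem_triangle_iff hqr).2 ⟨?_, he.le, ?_⟩)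
    · have : e • (a - b) = 0 := by
        rw [smul_sub, sub_eq_zero]
        have h2 : (1 - e) • b + e • a - b = 0 := sub_eq_zero.2 hz
        rw [sub_smul, one_smul] at h2
        rw [← sub_eq_zero]; rw [← h2]; abel
      rcases smul_eq_zero.1 this with h3 | h3
      · exact (ne_of_gt he0) h3
      · exact hab (sub_eq_zero.1 h3)
    · rw [orient_combo₂ _ _ _ _ (by ring), orient_self_outer]
      have : 0 ≤ e := le_of_lt he0
      have := mul_nonneg this hcon.1; linarith
    · rw [orient_combo₂ _ _ _ _ (by ring), orient_self_right]
      have : 0 ≤ e := le_of_lt he0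
      have := mul_nonneg this hcon.2; linarith
  have hperm (c : ℝ × ℝ) : ({a, b, c} : Set (ℝ × ℝ)) = {b, a, c} := by ext; simp; tauto
  rcases key with h1 | h1
  · have hc : ∀ᶠ c in 𝓝 a, orient b q c < 0 :=
      (show Continuous fun c => orient b q c by fun_prop).continuousAt.eventually (gt_mem_nhds h1)
    filter_upwards [hc] with c hc z hz hz'
    rw [hperm] at hz
    exact eq_vertex_of_functional hz (orient_self_outer b q) h1 hc ((mem_triangle_iff hqr).1 hz').1
  · have hc : ∀ᶠ c in 𝓝 a, orient r b c < 0 :=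
      (show Continuous fun c => orient r b c by fun_prop).continuousAt.eventually (gt_mem_nhds h1)
    filter_upwards [hc] with c hc z hz hz'
    rw [hperm] at hz
    exact eq_vertex_of_functional hz (orient_self_right r b) h1 hc
      ((mem_triangle_iff hqr).1 hz').2.2

/-- A point off the segment `ab` stays off the triangle `abc` if both it and `c` move little, where
`c` starts at `a`. -/
theorem eventually_notMem_triangle {a b z : ℝ × ℝ} {K : Set (ℝ × ℝ)} (hK : IsClosed K)
    (hKc : Convex ℝ K) (hd : Disjoint (segment ℝ a b) K) (hz : z ∈ K) :
    ∃ U ∈ 𝓝 a, ∃ W ∈ 𝓝 z, K ⊆ W ∧ ∀ c ∈ U, Disjoint (convexHull ℝ {a, b, c}) W := by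
  -- The open half-plane `f < u` contains `a` and `b`, so it contains the whole triangle as soon as
  -- it contains `c`.
  obtain ⟨f, u, v, h1, h2, h3⟩ := geometric_hahn_banach_compact_closed (convex_segment a b)
    (by rw [← convexHull_pair]; exact (Set.toFinite _).isCompact_convexHull ℝ) hKc hK hd
  refine ⟨{c | f c < u}, (isOpen_lt f.continuous continuous_const).mem_nhds
    (h1 a (left_mem_segment _ _ _)), {w | u < f w}, (isOpen_lt continuous_const
    f.continuous).mem_nhds (h2.trans (h3 z hz)), fun w hw => h2.trans (h3 w hw), ?_⟩
  intro c hc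
  rw [Set.disjoint_left]
  intro w hw hw'
  have : convexHull ℝ {a, b, c} ⊆ {w | f w < u} := by
    refine convexHull_min ?_ (convex_halfSpace_lt f.isLinear u)
    rintro y (rfl | rfl | rfl)
    · exact h1 _ (left_mem_segment _ _ _)
    · exact h1 _ (right_mem_segment _ _ _)
    · exact hc
  exact lt_asymm (show f w < u from this hw) hw'

theorem orient_apex (p q a u v : ℝ × ℝ) (d s : ℝ) :
    orient p q (a - d • ((u - a) + s • (v - a))) =
      orient p q a - d * ((orient p q u - orient p q a) + s * (orient p q v - orient p q a)) := by
  simp only [orient, Prod.fst_add, Prod.snd_add, Prod.fst_sub, Prod.snd_sub, Prod.smul_fst,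
    Prod.smul_snd, smul_eq_mul]
  ring

namespace IsDeflatedComplex

variable {𝒯 : Finset (Finset (ℝ × ℝ))} {B : Set (ℝ × ℝ)}

/-- The triangle on the segment `ab` with apex near `a` meets a triangle without the vertex `a`
only in the segment. -/
theorem eventually_inter_subset (h : IsDeflatedComplex 𝒯 B) {a b d : ℝ × ℝ}
    (ht₀ : {a, b, d} ∈ 𝒯) (hab : a ≠ b) {t : Finset (ℝ × ℝ)} (ht : t ∈ 𝒯) (hat : a ∉ t) :
    ∀ᶠ c in 𝓝 a, convexHull ℝ {a, b, c} ∩ convexHull ℝ (t : Set (ℝ × ℝ)) ⊆ segment ℝ a b := by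
  have hface : segment ℝ a b ∩ convexHull ℝ (t : Set (ℝ × ℝ)) ⊆
      convexHull ℝ ({a, b} ∩ (t : Set (ℝ × ℝ))) := by
    have := h.inter_faces (F := {a, b}) (G := t) ht₀ ht (by intro; simp; tauto) subset_rfl
    rw [← convexHull_pair]
    simpa using this
  by_cases hbt : b ∈ t
  · obtain ⟨q, r, rfl, hqr⟩ : ∃ q r, t = {b, q, r} ∧ 0 < orient b q r := by
      obtain ⟨x, y, z, rfl, hxyz⟩ := h.nondeg t ht
      have hb : b = x ∨ b = y ∨ b = z := by simpa using hbt
      rcases hb with rfl | rfl | rfl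
      · exact ⟨y, z, rfl, hxyz⟩
      · exact ⟨z, x, by ext; simp; tauto, by rwa [orient_rotate]⟩
      · exact ⟨x, y, by ext; simp; tauto, by rwa [← orient_rotate]⟩
    have h1 : ∀ z ∈ segment ℝ a b, z ∈ convexHull ℝ {b, q, r} → z = b := by
      intro z hz hz'
      have h2 := hface ⟨hz, by simpa using hz'⟩
      have h3 : ({a, b} ∩ (({b, q, r} : Finset (ℝ × ℝ)) : Set (ℝ × ℝ))) ⊆ {b} := by
        rintro y ⟨rfl | rfl, hy⟩
        · exact absurd (Finset.mem_coe.1 hy) hat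
        · rfl
      simpa using convexHull_mono h3 h2
    filter_upwards [eventually_triangle_inter_of_vertex hqr hab h1] with c hc z hz
    rw [coe_triple] at hz
    rw [hc z hz.1 hz.2]
    exact right_mem_segment _ _ _
  · have hd : Disjoint (segment ℝ a b) (convexHull ℝ (t : Set (ℝ × ℝ))) := by
      rw [Set.disjoint_iff]
      intro z hz
      have h3 : ({a, b} ∩ (t : Set (ℝ × ℝ))) = ∅ := by
        rw [Set.eq_empty_iff_forall_notMem]
        rintro y ⟨rfl | rfl, hy⟩
        · exact hat hy
        · exact hbt hy
      simpa [h3] using hface hz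
    obtain ⟨z, hz⟩ : (convexHull ℝ (t : Set (ℝ × ℝ))).Nonempty := by
      obtain ⟨x, y, z, rfl, -⟩ := h.nondeg t ht
      exact ⟨x, subset_convexHull ℝ _ (by simp)⟩
    obtain ⟨U, hU, W, -, hW, hUW⟩ := eventually_notMem_triangle
      (t.finite_toSet.isCompact_convexHull ℝ).isClosed (convex_convexHull ℝ _) hd hz
    filter_upwards [hU] with c hc w hw
    exact absurd (hW hw.2) (Set.disjoint_left.1 (hUW c hc) hw.1)

/-- An apex near `a` sees no vertex that `a` does not see. -/
theorem eventually_not_visible {a b q : ℝ × ℝ} (hab : segment ℝ a b ⊆ region 𝒯)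
    (hq : ¬ segment ℝ a q ⊆ region 𝒯) :
    ∀ᶠ c in 𝓝 a, ¬ segment ℝ c q ⊆ region 𝒯 ∪ convexHull ℝ {a, b, c} := by
  -- A point of `aq` outside the region blocks the view. The point of `cq` with the same weights
  -- stays outside the closed region and off the thin triangle when `c` is close to `a`.
  obtain ⟨_, ⟨l, m, hl, hm, hlm, rfl⟩, hz⟩ := Set.not_subset.1 hq
  obtain ⟨U, hU, W, hW, -, hUW⟩ := eventually_notMem_triangle (a := a) (b := b) isClosed_singleton
    (convex_singleton (l • a + m • q)) (by
      rw [Set.disjoint_singleton_right]; exact fun h => hz (hab h)) rfl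
  have hcont : Continuous fun c : ℝ × ℝ => l • c + m • q := by fun_prop
  filter_upwards [hU, hcont.continuousAt.preimage_mem_nhds hW,
    hcont.continuousAt.preimage_mem_nhds ((isCompact_region 𝒯).isClosed.isOpen_compl.mem_nhds hz)]
    with c h1 h2 h3 hsub
  rcases hsub ⟨l, m, hl, hm, hlm, rfl⟩ with h4 | h4
  · exact h3 h4
  · exact Set.disjoint_left.1 (hUW c h1) h4 h2

/-- A new triangle on the edge `ab` of the triangle `abd`, reflex at `a`. -/
theorem exists_apex (h : IsDeflatedComplex 𝒯 B) {a b d : ℝ × ℝ} (ht₀ : {a, b, d} ∈ 𝒯)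
    (hσ : orient a b d ≠ 0)
    (H : ∀ t ∈ 𝒯, t ≠ {a, b, d} → a ∈ t → ∀ q ∈ t, q ≠ a →
      q = d ∨ 0 < orient a b d * orient a d q) :
    ∃ c c' : ℝ × ℝ, orient a b d * orient a b c < 0 ∧ orient a b d * orient a c d < 0 ∧
      (∃ l m : ℝ, 0 < l ∧ 0 < m ∧ l • a + m • b + (1 / 2 : ℝ) • c' = c ∧ l + m + 1 / 2 = 1) ∧
      (∀ t ∈ 𝒯, convexHull ℝ {a, b, c'} ∩ convexHull ℝ (t : Set (ℝ × ℝ)) ⊆ segment ℝ a b) ∧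
      (∀ t ∈ 𝒯, ∀ q ∈ t, (0 < orient b a q → 0 < orient b c q) ∧
        (orient b a q < 0 → orient b c q < 0)) ∧
      (∀ t ∈ 𝒯, ∀ q ∈ t, q ≠ a → q ≠ b →
        ¬ segment ℝ c q ⊆ region 𝒯 ∪ convexHull ℝ {a, b, c}) := by
  -- The apex is `c = a - δ((d - a) + s(b - a))`: opposite to `d`, tilted by a small `s` so that the
  -- angle at `a` exceeds π, and close to `a` for small `δ`. The second apex `c'`, with `2δ` and
  -- `2s`, is chosen so that `c` is a convex combination of `a`, `b`, `c'`; the triangle `abc'` is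
  -- free space around `abc`. First `s` is fixed by the triangles at `a`, then `δ` by all other
  -- conditions. The products with `orient a b d` make the argument valid for both orientations of
  -- `abd`.
  have hab : a ≠ b := by rintro rfl; exact hσ (orient_self_left _ _)
  have hσ2 : 0 < orient a b d * orient a b d := mul_self_pos.2 hσ
  -- the slope of the two directions
  have hs : ∀ᶠ s in 𝓝[>] (0 : ℝ), ∀ t ∈ 𝒯, ∀ q ∈ t, (q = d ∨ 0 < orient a b d * orient a d q) →
      0 < orient a b d * (orient a d q + s * orient a b q) ∧
      0 < orient a b d * (orient a d q + 3 * s * orient a b q) := by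
    rw [Filter.eventually_all_finset]
    intro t ht
    rw [Filter.eventually_all_finset]
    intro q hq
    by_cases hqd : q = d
    · subst hqd
      filter_upwards [self_mem_nhdsWithin] with s (hs : 0 < s) _
      rw [orient_self_right]
      constructor <;> nlinarith [mul_pos hs hσ2]
    · by_cases hq0 : 0 < orient a b d * orient a d q
      · have hcont : Continuous fun s : ℝ => orient a b d * (orient a d q + s * orient a b q) := by
          fun_prop
        have hcont' : Continuous fun s : ℝ =>
          orient a b d * (orient a d q + 3 * s * orient a b q) := by fun_prop
        filter_upwards [nhdsWithin_le_nhds (hcont.continuousAt.eventually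
          (lt_mem_nhds (a := 0) (by simpa using hq0))),
          nhdsWithin_le_nhds (hcont'.continuousAt.eventually
          (lt_mem_nhds (a := 0) (by simpa using hq0)))] with s h1 h2 _
        exact ⟨h1, h2⟩
      · exact Eventually.of_forall fun s hs => absurd hs (by tauto)
  obtain ⟨s, hs, hs0⟩ := (hs.and self_mem_nhdsWithin).exists
  replace hs0 : 0 < s := hs0
  -- the two apices
  have hA : Tendsto (fun δ : ℝ => a - δ • ((d - a) + s • (b - a))) (𝓝[>] 0) (𝓝 a) := by
    have : Continuous fun δ : ℝ => a - δ • ((d - a) + s • (b - a)) := by fun_prop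
    simpa using (this.tendsto 0).mono_left (nhdsWithin_le_nhds (s := Set.Ioi 0))
  have hA' : Tendsto (fun δ : ℝ => a - (2 * δ) • ((d - a) + (2 * s) • (b - a))) (𝓝[>] 0) (𝓝 a) := by
    have : Continuous fun δ : ℝ => a - (2 * δ) • ((d - a) + (2 * s) • (b - a)) := by fun_prop
    simpa using (this.tendsto 0).mono_left (nhdsWithin_le_nhds (s := Set.Ioi 0))
  -- These conditions hold for all apices near `a`. Triangles containing `a` are excluded here: for
  -- them nearness does not help, and the tilt `s` does the work.
  have e1 : ∀ᶠ c' in 𝓝 a, ∀ t ∈ 𝒯, a ∉ t →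
      convexHull ℝ {a, b, c'} ∩ convexHull ℝ (t : Set (ℝ × ℝ)) ⊆ segment ℝ a b := by
    rw [Filter.eventually_all_finset]
    intro t ht
    by_cases hat : a ∈ t
    · exact Eventually.of_forall fun _ h => absurd hat h
    · filter_upwards [h.eventually_inter_subset ht₀ hab ht hat] with c hc _ using hc
  have e2 : ∀ᶠ c in 𝓝 a, ∀ t ∈ 𝒯, ∀ q ∈ t, (0 < orient b a q → 0 < orient b c q) ∧
        (orient b a q < 0 → orient b c q < 0) := by
    rw [Filter.eventually_all_finset]
    intro t ht
    rw [Filter.eventually_all_finset]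
    intro q hq
    have hcont : Continuous fun c => orient b c q := by fun_prop
    refine Filter.Eventually.and ?_ ?_
    · by_cases h0 : 0 < orient b a q
      · filter_upwards [hcont.continuousAt.eventually (lt_mem_nhds h0)] with c hc _ using hc
      · exact Eventually.of_forall fun _ h => absurd h h0
    · by_cases h0 : orient b a q < 0
      · filter_upwards [hcont.continuousAt.eventually (gt_mem_nhds h0)] with c hc _ using hc
      · exact Eventually.of_forall fun _ h => absurd h h0
  have e3 : ∀ᶠ c in 𝓝 a, ∀ t ∈ 𝒯, ∀ q ∈ t, ¬ segment ℝ a q ⊆ region 𝒯 →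
        ¬ segment ℝ c q ⊆ region 𝒯 ∪ convexHull ℝ {a, b, c} := by
    rw [Filter.eventually_all_finset]
    intro t ht
    rw [Filter.eventually_all_finset]
    intro q hq
    by_cases hv : segment ℝ a q ⊆ region 𝒯
    · exact Eventually.of_forall fun _ h => absurd hv h
    · filter_upwards [eventually_not_visible (h.segment_subset (a := a) (b := b) ht₀
          (by simp) (by simp)) hv]
        with c hc _ using hc
  -- Makes the weight `1 / 2 - δ * s` of `a` in `c` positive.
  have e4 : ∀ᶠ δ : ℝ in 𝓝[>] 0, δ * s < 1 / 2 := by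
    have : Continuous fun δ : ℝ => δ * s := by fun_prop
    exact nhdsWithin_le_nhds (this.continuousAt.eventually (gt_mem_nhds (by norm_num)))
  obtain ⟨δ, ⟨⟨⟨⟨h1, h2⟩, h3⟩, h4⟩, hδ⟩⟩ := (((((hA'.eventually e1).and (hA.eventually e2)).and
    (hA.eventually e3)).and e4).and self_mem_nhdsWithin).exists
  replace hδ : 0 < δ := hδ
  set c := a - δ • ((d - a) + s • (b - a)) with hc
  set c' := a - (2 * δ) • ((d - a) + (2 * s) • (b - a)) with hc'
  have habc : orient a b c = - (δ * orient a b d) := by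
    rw [hc, orient_apex, orient_self_outer, orient_self_right]; ring
  have habc' : orient a b c' = - (2 * δ * orient a b d) := by
    rw [hc', orient_apex, orient_self_outer, orient_self_right]; ring
  have hcomb : (1 / 2 - δ * s) • a + (δ * s) • b + (1 / 2 : ℝ) • c' = c := by
    rw [hc, hc']
    ext <;> simp only [Prod.fst_add, Prod.snd_add, Prod.fst_sub, Prod.snd_sub, Prod.smul_fst,
      Prod.smul_snd, smul_eq_mul] <;> ring
  have hinter : ∀ t ∈ 𝒯,
      convexHull ℝ {a, b, c'} ∩ convexHull ℝ (t : Set (ℝ × ℝ)) ⊆ segment ℝ a b := by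
    intro t ht
    by_cases hat : a ∈ t
    · rintro z ⟨hz, hz'⟩
      by_cases ht' : t = {a, b, d}
      · subst ht'
        rw [coe_triple] at hz'
        refine mem_segment_of_mem_triangle hσ hz' ?_
        obtain ⟨l, m, n, hl, hm, hn, hs, h5⟩ := mem_convexHull_triple.1 hz
        obtain ⟨l', m', n', hl', hm', hn', hs', h5'⟩ := mem_convexHull_triple.1 hz'
        have h6 : orient a b z = n * orient a b c' := by
          rw [← h5, orient_combo _ _ _ _ _ hs, orient_self_outer, orient_self_right]; ring
        have h6' : orient a b z = n' * orient a b d := by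
          rw [← h5', orient_combo _ _ _ _ _ hs', orient_self_outer, orient_self_right]; ring
        rw [habc'] at h6
        have h7 : orient a b d * (n' + n * (2 * δ)) = 0 := by linear_combination h6 - h6'
        have h8 : n' + n * (2 * δ) = 0 := by simpa [hσ] using h7
        have h9 : n' = 0 := by nlinarith [mul_nonneg hn hδ.le]
        rw [h6', h9, zero_mul]
      · obtain ⟨q, r, htqr, hqr⟩ : ∃ q r, t = {a, q, r} ∧ 0 < orient a q r := by
          obtain ⟨x, y, z, rfl, hxyz⟩ := h.nondeg t ht
          have ha : a = x ∨ a = y ∨ a = z := by simpa using hat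
          rcases ha with rfl | rfl | rfl
          · exact ⟨y, z, rfl, hxyz⟩
          · exact ⟨z, x, by ext; simp; tauto, by rwa [orient_rotate]⟩
          · exact ⟨x, y, by ext; simp; tauto, by rwa [← orient_rotate]⟩
        have hqa : q ≠ a := by rintro rfl; simp [orient_self_left] at hqr
        have hra : r ≠ a := by rintro rfl; simp [orient_self_outer] at hqr
        have hq := (hs t ht q (by simp [htqr]) (H t ht ht' hat q (by simp [htqr]) hqa)).2
        have hr := (hs t ht r (by simp [htqr]) (H t ht ht' hat r (by simp [htqr]) hra)).2
        rw [htqr, coe_triple] at hz'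
        obtain ⟨l, m, n, hl, hm, hn, hsum, h5⟩ := mem_convexHull_triple.1 hz
        obtain ⟨l', m', n', hl', hm', hn', hsum', h5'⟩ := mem_convexHull_triple.1 hz'
        have h6 (p : ℝ × ℝ) : orient a p z = m * orient a p b + n * orient a p c' := by
          rw [← h5, orient_combo _ _ _ _ _ hsum, orient_self_outer]; ring
        have h6' (p : ℝ × ℝ) : orient a p z = m' * orient a p q + n' * orient a p r := by
          rw [← h5', orient_combo _ _ _ _ _ hsum', orient_self_outer]; ring
        have hdc' : orient a d c' = 4 * δ * s * orient a b d := by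
          rw [hc', orient_apex, orient_self_outer, orient_self_right, orient_swap a b d]; ring
        -- The line through `a` in direction `(d - a) + 3s(b - a)` separates the two triangles. The
        -- corresponding functional vanishes at `a`, is positive at `q` and `r`, and is negative at
        -- `b` and `c'`. So a common point has no weight on `q` and `r`.
        have h7 : m' * (orient a b d * (orient a d q + 3 * s * orient a b q)) +
            n' * (orient a b d * (orient a d r + 3 * s * orient a b r)) +
            (m + n * (2 * δ * s)) * (orient a b d * orient a b d) = 0 := by
          have k1 := h6 d
          have k2 := h6 b
          rw [h6', hdc', orient_swap a b d] at k1
          rw [h6', habc', orient_self_right] at k2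
          linear_combination orient a b d * k1 + 3 * s * orient a b d * k2
        have k3 := mul_nonneg hm' hq.le
        have k4 := mul_nonneg hn' hr.le
        have k5 : 0 ≤ (m + n * (2 * δ * s)) * (orient a b d * orient a b d) := by positivity
        have k6 : m' = 0 := by
          rcases mul_eq_zero.1 (le_antisymm (by linarith) k3) with k | k
          · exact k
          · exact absurd k hq.ne'
        have k7 : n' = 0 := by
          rcases mul_eq_zero.1 (le_antisymm (by linarith) k4) with k | k
          · exact k
          · exact absurd k hr.ne'
        obtain rfl : l' = 1 := by linarith
        rw [← h5', k6, k7]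
        simpa using left_mem_segment ℝ a b
    · exact h1 t ht hat
  have hcc' : convexHull ℝ {a, b, c} ⊆ convexHull ℝ {a, b, c'} := by
    refine convexHull_min ?_ (convex_convexHull ℝ _)
    rintro y (rfl | rfl | rfl)
    · exact subset_convexHull ℝ _ (by simp)
    · exact subset_convexHull ℝ _ (by simp)
    · exact mem_convexHull_triple.2 ⟨_, _, _, by linarith, by positivity, by norm_num, by ring,
        hcomb⟩
  refine ⟨c, c', ?_, ?_, ⟨1 / 2 - δ * s, δ * s, by linarith, by positivity, hcomb, by ring⟩, hinter,
    h2, ?_⟩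
  · rw [habc]; nlinarith [mul_pos hδ hσ2]
  · have : orient a c d = - (δ * s * orient a b d) := by
      rw [orient_swap, hc, orient_apex, orient_self_outer, orient_self_right, orient_swap a b d]
      ring
    rw [this]; nlinarith [mul_pos (mul_pos hδ hs0) hσ2]
  · intro t ht q hq hqa hqb
    -- If `a` sees `q`, they lie in a common triangle, so `q` is strictly beyond the line `ac`, seen
    -- from `b`. The start of the segment `cq` is then outside the new triangle, and outside the
    -- region because `c` is.
    by_cases hv : segment ℝ a q ⊆ region 𝒯
    · obtain ⟨t', ht', hat', hqt'⟩ := h.defl _ ht₀ t ht a (by simp) q hq hv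
      have hqd : q = d ∨ 0 < orient a b d * orient a d q := by
        by_cases htt : t' = {a, b, d}
        · subst htt
          left; simpa [hqa, hqb] using hqt'
        · exact H t' ht' htt hat' q hqt' hqa
      have hpos := (hs t' ht' q hqt' hqd).1
      have hcU : c ∉ region 𝒯 := by
        intro hcU
        obtain ⟨u, hu, hcu⟩ := mem_region.1 hcU
        have := hinter u hu ⟨hcc' (subset_convexHull ℝ _ (by simp)), hcu⟩
        have := orient_eq_zero_of_mem_segment this
        rw [habc] at this
        have h7 : δ * orient a b d = 0 := by linarith
        rcases mul_eq_zero.1 h7 with h7 | h7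
        · exact hδ.ne' h7
        · exact hσ h7
      have hcont : Continuous fun τ : ℝ => (1 - τ) • c + τ • q := by fun_prop
      have h5 : ∀ᶠ τ in 𝓝[>] (0 : ℝ), (1 - τ) • c + τ • q ∈ (region 𝒯)ᶜ :=
        nhdsWithin_le_nhds (hcont.continuousAt.preimage_mem_nhds
          ((isCompact_region 𝒯).isClosed.isOpen_compl.mem_nhds (by simpa using hcU)))
      obtain ⟨τ, ⟨h6, hτ⟩, hτ1⟩ := ((h5.and self_mem_nhdsWithin).and
        (nhdsWithin_le_nhds (gt_mem_nhds zero_lt_one))).exists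
      replace hτ : 0 < τ := hτ
      intro hsub
      rcases hsub ⟨1 - τ, τ, by linarith, hτ.le, by ring, rfl⟩ with h7 | h7
      · exact h6 h7
      · obtain ⟨l, m, n, hl, hm, hn, hsum, h8⟩ := mem_convexHull_triple.1 h7
        have hdc : orient a d c = δ * s * orient a b d := by
          rw [hc, orient_apex, orient_self_outer, orient_self_right, orient_swap a b d]; ring
        have k1 := congrArg (orient a d) h8
        have k2 := congrArg (orient a b) h8
        rw [orient_combo _ _ _ _ _ hsum, orient_combo₂ _ _ _ _ (by ring), orient_self_outer, hdc,
          orient_swap a b d] at k1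
        rw [orient_combo _ _ _ _ _ hsum, orient_combo₂ _ _ _ _ (by ring), orient_self_outer, habc,
          orient_self_right] at k2
        -- The functional in parentheses, now with slope `s`, vanishes at `a` and `c`, is negative
        -- at `b` and positive at `q`.
        have k3 : τ * (orient a b d * (orient a d q + s * orient a b q)) +
            m * (orient a b d * orient a b d) = 0 := by
          linear_combination -orient a b d * k1 - s * orient a b d * k2
        have k4 := mul_pos hτ hpos
        have k5 := mul_nonneg hm hσ2.le
        linarith
    · exact h3 t ht q hq hv

end IsDeflatedComplex

/-! ### Attaching a triangle along an edge. -/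

theorem convex_orient_pos (p q : ℝ × ℝ) : Convex ℝ {z | 0 < orient p q z} := by
  intro x hx y hy l m hl hm hlm
  simp only [Set.mem_ofPred_eq] at *
  rw [orient_combo₂ _ _ _ _ hlm]
  rcases eq_or_lt_of_le hl with rfl | hl
  · obtain rfl : m = 1 := by linarith
    simpa using hy
  · have := mul_pos hl hx
    have := mul_nonneg hm hy.le
    linarith

theorem convex_orient_neg (p q : ℝ × ℝ) : Convex ℝ {z | orient p q z < 0} := by
  have : {z | orient p q z < 0} = {z | 0 < orient q p z} := by
    ext z; simp [orient_swap_left p q z]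
  rw [this]
  exact convex_orient_pos q p

theorem isOpen_orient_pos (p q : ℝ × ℝ) : IsOpen {z | 0 < orient p q z} :=
  isOpen_lt continuous_const (by fun_prop)

/-- Removing from a connected set a closed part that has a neighbourhood in the set with connected
remainder leaves a connected set. -/
theorem IsPreconnected.diff_of_nhds {X : Type*} [TopologicalSpace X] {s K N : Set X}
    (hs : IsPreconnected s) (hK : IsClosed K) (hN : IsOpen N) (hsK : s ∩ K ⊆ N)
    (hNs : N ⊆ s) (hNK : IsPreconnected (N \ K)) : IsPreconnected (s \ K) := by
  -- If `N \ K` misses `v`, then `N` can be added to `u`: this covers all of `s`, and the overlap of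
  -- the two open sets, which exists by connectedness of `s`, cannot lie in `N`.
  have main : ∀ u v : Set X, IsOpen u → IsOpen v → s \ K ⊆ u ∪ v → ((s \ K) ∩ u).Nonempty →
      ((s \ K) ∩ v).Nonempty → ¬ ((N \ K) ∩ v).Nonempty → ((s \ K) ∩ (u ∩ v)).Nonempty := by
    rintro u v hu hv huv ⟨x, hx, hxu⟩ ⟨y, hy, hyv⟩ hNv
    obtain ⟨p, hp, hpu, hpv, hpK⟩ := hs ((u \ K) ∪ N) (v \ K)
      ((hu.sdiff hK).union hN) (hv.sdiff hK) (by
        intro z hz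
        by_cases hzK : z ∈ K
        · exact Or.inl (Or.inr (hsK ⟨hz, hzK⟩))
        · exact (huv ⟨hz, hzK⟩).imp (fun h => Or.inl ⟨h, hzK⟩) fun h => ⟨h, hzK⟩)
      ⟨x, hx.1, Or.inl ⟨hxu, hx.2⟩⟩ ⟨y, hy.1, hyv, hy.2⟩
    rcases hpu with hpu | hpN
    · exact ⟨p, ⟨hp, hpK⟩, hpu.1, hpv⟩
    · exact absurd ⟨p, ⟨hpN, hpK⟩, hpv⟩ hNv
  intro u v hu hv huv hsu hsv
  by_cases h1 : ((N \ K) ∩ v).Nonempty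
  · by_cases h2 : ((N \ K) ∩ u).Nonempty
    · exact (hNK u v hu hv ((Set.sdiff_subset_sdiff_left hNs).trans huv) h2 h1).mono
        (Set.inter_subset_inter_left _ (Set.sdiff_subset_sdiff_left hNs))
    · rw [Set.inter_comm u v]
      exact main v u hv hu (by rwa [Set.union_comm]) hsv hsu h2
  · exact main u v hu hv huv hsu hsv h1

/-- Attaching a triangle to a set along an edge leaves the complement connected, provided that there
is room around the triangle. -/
theorem isPreconnected_compl_union_triangle_of_pos {U : Set (ℝ × ℝ)} (hU : IsPreconnected Uᶜ)
    {a b c c' : ℝ × ℝ} (habU : segment ℝ a b ⊆ U) {l m : ℝ} (hl : 0 < l) (hm : 0 < m)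
    (hc : l • a + m • b + (1 / 2 : ℝ) • c' = c) (hlm : l + m + 1 / 2 = 1)
    (hroom : convexHull ℝ {a, b, c'} ∩ U ⊆ segment ℝ a b) (hpos : 0 < orient a b c) :
    IsPreconnected (U ∪ convexHull ℝ {a, b, c})ᶜ := by
  have hcc' (p q : ℝ × ℝ) : orient p q c = l * orient p q a + m * orient p q b +
      1 / 2 * orient p q c' := by rw [← hc, orient_combo _ _ _ _ _ hlm]
  have hpos' : 0 < orient a b c' := by
    have := hcc' a b
    rw [orient_self_outer, orient_self_right] at this; linarith
  -- The open triangle `abc'` misses `U` and contains `abc` except for the edge `ab`. What remains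
  -- of it beyond `abc` consists of two convex pieces, beyond `bc` and beyond `ca`, and both contain
  -- the midpoint of `cc'`.
  set N : Set (ℝ × ℝ) := {z | 0 < orient a b z ∧ 0 < orient b c' z ∧ 0 < orient c' a z} with hN
  rw [Set.compl_union, ← Set.sdiff_eq]
  refine hU.diff_of_nhds (N := N) ((Set.toFinite _).isCompact_convexHull ℝ).isClosed
    (isOpen_openTriangle a b c') ?_ ?_ ?_
  · rintro z ⟨hzU, hz⟩
    obtain ⟨l', m', n, hl', hm', hn, hs, rfl⟩ := mem_convexHull_triple.1 hz
    have hn0 : 0 < n := by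
      refine lt_of_le_of_ne hn fun h => hzU (habU ?_)
      subst h
      exact ⟨l', m', hl', hm', by linarith, by simp⟩
    have e1 : orient b c' a = orient a b c' := orient_rotate _ _ _
    have e2 : orient c' a b = orient a b c' := (orient_rotate _ _ _).symm
    simp only [hN, Set.mem_ofPred_eq, orient_combo _ _ _ _ _ hs, hcc', orient_self_outer,
      orient_self_right, e1, e2]
    refine ⟨?_, ?_, ?_⟩
    · have := mul_pos hn0 hpos'; linarith
    · have := mul_pos (mul_pos hn0 hl) hpos'
      have := mul_nonneg hl' hpos'.le
      nlinarith
    · have := mul_pos (mul_pos hn0 hm) hpos'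
      have := mul_nonneg hm' hpos'.le
      nlinarith
  · rintro z hz hzU
    have h1 := hroom ⟨(mem_triangle_iff hpos').2 ⟨hz.1.le, hz.2.1.le, hz.2.2.le⟩, hzU⟩
    exact hz.1.ne' (orient_eq_zero_of_mem_segment h1)
  · have hNc : Convex ℝ N := (convex_orient_pos a b).inter
      ((convex_orient_pos b c').inter (convex_orient_pos c' a))
    have heq : N \ convexHull ℝ {a, b, c} =
        (N ∩ {z | orient b c z < 0}) ∪ (N ∩ {z | orient c a z < 0}) := by
      ext z
      simp only [Set.mem_sdiff, mem_triangle_iff hpos, Set.mem_union, Set.mem_inter_iff,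
        Set.mem_ofPred_eq]
      constructor
      · rintro ⟨h1, h2⟩
        by_cases h3 : orient b c z < 0
        · exact Or.inl ⟨h1, h3⟩
        · refine Or.inr ⟨h1, ?_⟩
          by_contra h4
          exact h2 ⟨h1.1.le, not_lt.1 h3, not_lt.1 h4⟩
      · rintro (⟨h1, h2⟩ | ⟨h1, h2⟩)
        · exact ⟨h1, fun h => absurd h.2.1 (not_le.2 h2)⟩
        · exact ⟨h1, fun h => absurd h.2.2 (not_le.2 h2)⟩
    rw [heq]
    have hbc : orient b c c' = - (l * orient a b c') := by
      rw [orient_swap b c' c, hcc' b c', orient_self_right, orient_self_outer, orient_rotate a b c']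
      ring
    have hca : orient c a c' = - (m * orient a b c') := by
      rw [← orient_rotate c a c', hcc' a c', orient_self_outer, orient_self_right,
        orient_swap a b c']
      ring
    have e1 : orient b c' a = orient a b c' := orient_rotate _ _ _
    have e2 : orient c' a b = orient a b c' := (orient_rotate _ _ _).symm
    refine IsPreconnected.union ((1 / 2 : ℝ) • c + (1 / 2 : ℝ) • c') ?_ ?_
      (hNc.inter (convex_orient_neg b c)).isPreconnected
      (hNc.inter (convex_orient_neg c a)).isPreconnected
    all_goals
      simp only [hN, Set.mem_inter_iff, Set.mem_ofPred_eq,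
        orient_combo₂ _ _ _ _ (show (1 / 2 : ℝ) + 1 / 2 = 1 by norm_num), orient_self_right,
        orient_self_outer, hbc, hca]
      simp only [hcc', orient_self_outer, orient_self_right, e1, e2]
      have := mul_pos hl hpos'
      have := mul_pos hm hpos'
      refine ⟨⟨?_, ?_, ?_⟩, ?_⟩ <;> linarith

theorem isPreconnected_compl_union_triangle {U : Set (ℝ × ℝ)} (hU : IsPreconnected Uᶜ)
    {a b c c' : ℝ × ℝ} (habU : segment ℝ a b ⊆ U) {l m : ℝ} (hl : 0 < l) (hm : 0 < m)
    (hc : l • a + m • b + (1 / 2 : ℝ) • c' = c) (hlm : l + m + 1 / 2 = 1)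
    (hroom : convexHull ℝ {a, b, c'} ∩ U ⊆ segment ℝ a b) (h0 : orient a b c ≠ 0) :
    IsPreconnected (U ∪ convexHull ℝ {a, b, c})ᶜ := by
  rcases h0.lt_or_gt with h | h
  · rw [← triangle_swap]
    refine isPreconnected_compl_union_triangle_of_pos hU (by rwa [segment_symm]) hm hl
      (by rw [← hc]; abel) (by linarith) (by rwa [triangle_swap, segment_symm]) ?_
    rw [orient_swap_left]; linarith
  · exact isPreconnected_compl_union_triangle_of_pos hU habU hl hm hc hlm hroom h

/-- Two triangles on different sides of a common edge cover a neighbourhood of its interior. -/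
theorem mem_interior_union_triangles {a b c d z : ℝ × ℝ} (h : orient a b d * orient a b c < 0)
    (hz : z ∈ segment ℝ a b) (hza : z ≠ a) (hzb : z ≠ b) :
    z ∈ interior (convexHull ℝ {a, b, d} ∪ convexHull ℝ {a, b, c}) := by
  wlog hd : 0 < orient a b d generalizing a b
  · rw [← triangle_swap a b d, ← triangle_swap a b c]
    have hd' : orient a b d < 0 := lt_of_le_of_ne (not_lt.1 hd) (by rintro h0; simp [h0] at h)
    refine this ?_ (by rwa [segment_symm]) hzb hza ?_
    · rw [orient_swap_left, orient_swap_left b a c] at h; linarith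
    · rw [orient_swap_left]; linarith
  have hc : 0 < orient b a c := by
    rw [orient_swap_left]; nlinarith
  obtain ⟨l, m, hl, hm, hlm, rfl⟩ := hz
  have hl0 : 0 < l := by
    refine lt_of_le_of_ne hl fun h => hzb ?_
    subst h
    obtain rfl : m = 1 := by linarith
    simp
  have hm0 : 0 < m := by
    refine lt_of_le_of_ne hm fun h => hza ?_
    subst h
    obtain rfl : l = 1 := by linarith
    simp
  -- The intersection of the half-planes of the four outer sides; the line `ab` splits it into a
  -- part in each triangle.
  set O : Set (ℝ × ℝ) := ({z | 0 < orient b d z} ∩ {z | 0 < orient d a z}) ∩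
    ({z | 0 < orient a c z} ∩ {z | 0 < orient c b z}) with hO
  have hOo : IsOpen O := ((isOpen_orient_pos _ _).inter (isOpen_orient_pos _ _)).inter
    ((isOpen_orient_pos _ _).inter (isOpen_orient_pos _ _))
  refine interior_maximal ?_ hOo ?_
  · rintro w ⟨⟨h1, h2⟩, h3, h4⟩
    by_cases hw : 0 ≤ orient a b w
    · exact Or.inl ((mem_triangle_iff hd).2 ⟨hw, h1.le, h2.le⟩)
    · refine Or.inr ?_
      rw [← triangle_swap a b c]
      refine (mem_triangle_iff hc).2 ⟨?_, h3.le, h4.le⟩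
      rw [orient_swap_left]; linarith
  · simp only [hO, Set.mem_inter_iff, Set.mem_ofPred_eq, orient_combo₂ _ _ _ _ hlm,
      orient_self_outer, orient_self_right]
    rw [orient_rotate a b d, ← orient_rotate d a b, orient_rotate b a c, ← orient_rotate c b a]
    refine ⟨⟨?_, ?_⟩, ?_, ?_⟩ <;> simp only [mul_zero, add_zero, zero_add] <;> positivity

/-- A segment between two points of `U` cannot make use of a triangle attached to `U` along an
edge. -/
theorem segment_subset_of_union_triangle {U : Set (ℝ × ℝ)} (hU : IsClosed U) {a b c v w : ℝ × ℝ}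
    (h0 : orient a b c ≠ 0) (habU : segment ℝ a b ⊆ U)
    (hi : convexHull ℝ {a, b, c} ∩ U ⊆ segment ℝ a b) (hv : v ∈ U) (hw : w ∈ U)
    (h : segment ℝ v w ⊆ U ∪ convexHull ℝ {a, b, c}) : segment ℝ v w ⊆ U := by
  -- By connectedness a segment passing from the triangle into `U` has a point in both closed sets,
  -- hence on `ab`. This is impossible if both ends are strictly on the side of `c`.
  have key : ∀ z w : ℝ × ℝ, z ∉ U → w ∈ U → segment ℝ z w ⊆ U ∪ convexHull ℝ {a, b, c} →
      0 < orient a b c * orient a b z → 0 < orient a b c * orient a b w → False := by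
    intro z w hz hw hsub h1 h2
    obtain ⟨y, ⟨l, m, hl, hm, hlm, rfl⟩, hyU, hyT⟩ := isPreconnected_closed_iff.1
      (convex_segment z w).isPreconnected U (convexHull ℝ {a, b, c}) hU
      ((Set.toFinite _).isCompact_convexHull ℝ).isClosed hsub ⟨w, right_mem_segment _ _ _, hw⟩
      ⟨z, left_mem_segment _ _ _, (hsub (left_mem_segment _ _ _)).resolve_left hz⟩
    have h3 := orient_eq_zero_of_mem_segment (hi ⟨hyT, hyU⟩)
    rw [orient_combo₂ _ _ _ _ hlm] at h3
    have h4 : l * (orient a b c * orient a b z) + m * (orient a b c * orient a b w) = 0 := by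
      linear_combination orient a b c * h3
    rcases eq_or_lt_of_le hl with rfl | hl
    · obtain rfl : m = 1 := by linarith
      linarith
    · have := mul_pos hl h1
      have := mul_nonneg hm h2.le
      linarith
  intro z hz
  by_contra hzU
  have hzT := (h hz).resolve_left hzU
  have hpos : 0 < orient a b c * orient a b z := by
    obtain ⟨l, m, n, hl, hm, hn, hs, h1⟩ := mem_convexHull_triple.1 hzT
    have h2 : orient a b z = n * orient a b c := by
      rw [← h1, orient_combo _ _ _ _ _ hs, orient_self_outer, orient_self_right]; ring
    refine lt_of_le_of_ne ?_ fun h3 => hzU (habU (mem_segment_of_mem_triangle h0 hzT ?_))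
    · rw [h2]; nlinarith [mul_nonneg hn (mul_self_nonneg (orient a b c))]
    · simpa [h0] using h3.symm
  have hsub {y : ℝ × ℝ} := (convex_segment (𝕜 := ℝ) v w).segment_subset (y := y) hz
  -- The signed distance from the line `ab` is affine on `vw` and positive at `z`, so it is positive
  -- at one of the ends.
  by_cases hw' : orient a b c * orient a b z ≤ orient a b c * orient a b w
  · exact key z w hzU hw ((hsub (right_mem_segment _ _ _)).trans h) hpos (hpos.trans_le hw')
  · refine key z v hzU hv ((hsub (left_mem_segment _ _ _)).trans h) hpos ?_
    obtain ⟨l, m, hl, hm, hlm, rfl⟩ := hz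
    rw [orient_combo₂ _ _ _ _ hlm] at hw' hpos
    by_contra hneg
    have k1 := mul_nonneg hl (neg_nonneg.2 (not_lt.1 hneg))
    have k2 : 0 < m * (orient a b c * orient a b w) := by linarith
    have k3 := mul_nonneg hl (pos_of_mul_pos_right k2 hm).le
    obtain rfl : l = 1 - m := by linarith
    linarith

namespace IsDeflatedComplex

variable {𝒯 : Finset (Finset (ℝ × ℝ))} {B : Set (ℝ × ℝ)}

/-- Everything follows from the fact that the new triangle meets the old region only in `ab`, a face
of `abd`. Common points with old triangles are then governed by `inter_faces`, and old sight lines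
cannot use the new triangle. By `hvis` the apex sees no old vertices but `a` and `b`, so every new
visible pair lies in the new triangle. -/
theorem insert_triangle (h : IsDeflatedComplex 𝒯 B) {a b c c' d : ℝ × ℝ} (ht₀ : {a, b, d} ∈ 𝒯)
    (hside : orient a b d * orient a b c < 0) {l m : ℝ} (hl : 0 < l) (hm : 0 < m)
    (hc : l • a + m • b + (1 / 2 : ℝ) • c' = c) (hlm : l + m + 1 / 2 = 1)
    (hi : ∀ t ∈ 𝒯, convexHull ℝ {a, b, c'} ∩ convexHull ℝ (t : Set (ℝ × ℝ)) ⊆ segment ℝ a b)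
    (hvis : ∀ t ∈ 𝒯, ∀ q ∈ t, q ≠ a → q ≠ b →
        ¬ segment ℝ c q ⊆ region 𝒯 ∪ convexHull ℝ {a, b, c})
    {B' : Set (ℝ × ℝ)} (hac : segment ℝ a c ⊆ B') (hbc : segment ℝ b c ⊆ B')
    (hB : B ⊆ B' ∪ segment ℝ a b) : IsDeflatedComplex (insert {a, b, c} 𝒯) B' := by
  have h0 : orient a b c ≠ 0 := by rintro h0; simp [h0] at hside
  have hab : segment ℝ a b ⊆ region 𝒯 := h.segment_subset (a := a) (b := b) ht₀ (by simp) (by simp)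
  have hroom : convexHull ℝ {a, b, c'} ∩ region 𝒯 ⊆ segment ℝ a b := by
    rintro z ⟨hz, hz'⟩
    obtain ⟨t, ht, hzt⟩ := mem_region.1 hz'
    exact hi t ht ⟨hz, hzt⟩
  have hcc' : convexHull ℝ {a, b, c} ⊆ convexHull ℝ {a, b, c'} := by
    refine convexHull_min ?_ (convex_convexHull ℝ _)
    rintro y (rfl | rfl | rfl)
    · exact subset_convexHull ℝ _ (by simp)
    · exact subset_convexHull ℝ _ (by simp)
    · exact mem_convexHull_triple.2 ⟨_, _, _, hl.le, hm.le, by norm_num, hlm, hc⟩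
  have hroom' : convexHull ℝ {a, b, c} ∩ region 𝒯 ⊆ segment ℝ a b :=
    (Set.inter_subset_inter_left _ hcc').trans hroom
  have hnew : ∀ t ∈ 𝒯, convexHull ℝ (t : Set (ℝ × ℝ)) ∩ convexHull ℝ {a, b, c} ⊆
      convexHull ℝ ((t : Set (ℝ × ℝ)) ∩ {a, b, c}) := by
    rintro t ht z ⟨hzt, hz⟩
    have h1 : z ∈ convexHull ℝ (({a, b} : Finset (ℝ × ℝ)) : Set (ℝ × ℝ)) := by
      simpa [convexHull_pair] using hi t ht ⟨hcc' hz, hzt⟩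
    have h2 := h.inter_faces ht ht₀ subset_rfl (by intro; simp; tauto) ⟨hzt, h1⟩
    refine convexHull_mono (Set.inter_subset_inter_right _ ?_) h2
    intro; simp; tauto
  constructor
  · intro t ht
    rcases Finset.mem_insert.1 ht with rfl | ht
    · rcases h0.lt_or_gt with h1 | h1
      · exact ⟨b, a, c, by ext; simp; tauto, by rw [orient_swap_left]; linarith⟩
      · exact ⟨a, b, c, rfl, h1⟩
    · exact h.nondeg t ht
  · intro t ht t' ht'
    rcases Finset.mem_insert.1 ht with rfl | ht
    · rcases Finset.mem_insert.1 ht' with rfl | ht'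
      · simp
      · rw [Set.inter_comm, Set.inter_comm (_ : Set (ℝ × ℝ)) (t' : Set (ℝ × ℝ)), coe_triple]
        exact hnew t' ht'
    · rcases Finset.mem_insert.1 ht' with rfl | ht'
      · rw [coe_triple]; exact hnew t ht
      · exact h.inter t ht t' ht'
  · rw [region_insert, coe_triple]
    exact isPreconnected_compl_union_triangle h.compl hab hl hm hc hlm hroom h0
  · rw [region_insert, coe_triple]
    -- The edge `ab` may leave the boundary because it now has a triangle on each side; its ends
    -- stay on `ac` and `bc`.
    have hedge : ∀ z ∈ segment ℝ a b, z ∉ B' → z ∈ interior (region 𝒯 ∪ convexHull ℝ {a, b, c}) := by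
      intro z hz hzB
      have h1 := mem_interior_union_triangles hside hz
        (by rintro rfl; exact hzB (hac (left_mem_segment _ _ _)))
        (by rintro rfl; exact hzB (hbc (left_mem_segment _ _ _)))
      refine interior_mono (Set.union_subset_union_left _ ?_) h1
      intro w hw
      exact mem_region.2 ⟨_, ht₀, by rwa [coe_triple]⟩
    rintro z ⟨hz | hz, hzB⟩
    · by_cases hzB₀ : z ∈ B
      · exact hedge z ((hB hzB₀).resolve_left hzB) hzB
      · exact interior_mono Set.subset_union_left (h.sdiff_subset_interior ⟨hz, hzB₀⟩)
    · by_cases hz0 : orient a b z = 0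
      · exact hedge z (mem_segment_of_mem_triangle h0 hz hz0) hzB
      · have hbc0 : orient b c z ≠ 0 := fun h1 => hzB (hbc (mem_segment_of_mem_triangle
          (by rwa [orient_rotate]) (by rwa [triangle_rotate]) h1))
        have hac0 : orient c a z ≠ 0 := fun h1 => hzB (hac (by
          rw [segment_symm]
          exact mem_segment_of_mem_triangle (c := b) (by rwa [← orient_rotate])
            (by rwa [← triangle_rotate c a b]) h1))
        refine interior_mono Set.subset_union_right ?_
        rcases h0.lt_or_gt with h1 | h1
        · rw [← triangle_swap] at hz ⊢
          have h1' : 0 < orient b a c := by rw [orient_swap_left]; linarith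
          have h2 := (mem_triangle_iff h1').1 hz
          refine openTriangle_subset_interior h1' ⟨h2.1.lt_of_ne' ?_, h2.2.1.lt_of_ne' ?_,
            h2.2.2.lt_of_ne' ?_⟩
          · rw [orient_swap_left]; simpa using hz0
          · rw [orient_swap_left]; simpa using hac0
          · rw [orient_swap_left]; simpa using hbc0
        · have h2 := (mem_triangle_iff h1).1 hz
          exact openTriangle_subset_interior h1 ⟨h2.1.lt_of_ne' hz0, h2.2.1.lt_of_ne' hbc0,
            h2.2.2.lt_of_ne' hac0⟩
  · rw [region_insert, coe_triple]
    have hold : ∀ t ∈ insert {a, b, c} 𝒯, ∀ v ∈ t, v = c ∨ ∃ s ∈ 𝒯, v ∈ s := by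
      intro t ht v hv
      rcases Finset.mem_insert.1 ht with rfl | ht
      · have hv' : v = a ∨ v = b ∨ v = c := by simpa using hv
        rcases hv' with rfl | rfl | rfl
        · exact Or.inr ⟨_, ht₀, by simp⟩
        · exact Or.inr ⟨_, ht₀, by simp⟩
        · exact Or.inl rfl
      · exact Or.inr ⟨t, ht, hv⟩
    have hcw : ∀ t ∈ 𝒯, ∀ w ∈ t, segment ℝ c w ⊆ region 𝒯 ∪ convexHull ℝ {a, b, c} →
        w ∈ ({a, b, c} : Finset (ℝ × ℝ)) := by
      intro t ht w hw hs
      by_contra hw'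
      simp only [Finset.mem_insert, Finset.mem_singleton, not_or] at hw'
      exact hvis t ht w hw hw'.1 hw'.2.1 hs
    intro t ht t' ht' v hv w hw hs
    rcases hold t ht v hv with rfl | ⟨s, hs₁, hv⟩
    · rcases hold t' ht' w hw with rfl | ⟨s', hs', hw⟩
      · exact ⟨_, Finset.mem_insert_self _ _, by simp, by simp⟩
      · exact ⟨_, Finset.mem_insert_self _ _, by simp, hcw s' hs' w hw hs⟩
    · rcases hold t' ht' w hw with rfl | ⟨s', hs', hw⟩
      · exact ⟨_, Finset.mem_insert_self _ _, hcw s hs₁ v hv (by rwa [segment_symm]), by simp⟩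
      · have hvU : v ∈ region 𝒯 := mem_region.2 ⟨s, hs₁, subset_convexHull ℝ _ hv⟩
        have hwU : w ∈ region 𝒯 := mem_region.2 ⟨s', hs', subset_convexHull ℝ _ hw⟩
        obtain ⟨r, hr, h1⟩ := h.defl s hs₁ s' hs' v hv w hw (segment_subset_of_union_triangle
          (isCompact_region 𝒯).isClosed h0 hab hroom' hvU hwU hs)
        exact ⟨r, Finset.mem_insert_of_mem hr, h1⟩

/-- A deflated complex can be extended by a triangle on the edge `ab` of its triangle `abd`, such
that the union of the two triangles is reflex at `a`, if the other triangles at `a` leave enough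
room. -/
theorem exists_insert_triangle (h : IsDeflatedComplex 𝒯 B) {a b d : ℝ × ℝ} (ht₀ : {a, b, d} ∈ 𝒯)
    (hσ : orient a b d ≠ 0)
    (H : ∀ t ∈ 𝒯, t ≠ {a, b, d} → a ∈ t → ∀ q ∈ t, q ≠ a →
      q = d ∨ 0 < orient a b d * orient a d q) :
    ∃ c : ℝ × ℝ, orient a b d * orient a b c < 0 ∧ orient a b d * orient a c d < 0 ∧
      (∀ t ∈ 𝒯, c ∉ t) ∧
      (∀ t ∈ 𝒯, ∀ q ∈ t, (0 < orient b a q → 0 < orient b c q) ∧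
        (orient b a q < 0 → orient b c q < 0)) ∧
      ∀ B' : Set (ℝ × ℝ), segment ℝ a c ⊆ B' → segment ℝ b c ⊆ B' → B ⊆ B' ∪ segment ℝ a b →
        IsDeflatedComplex (insert {a, b, c} 𝒯) B' := by
  obtain ⟨c, c', h1, h2, ⟨l, m, hl, hm, hc, hlm⟩, hi, hs, hvis⟩ := h.exists_apex ht₀ hσ H
  refine ⟨c, h1, h2, ?_, hs, fun B' hac hbc hB =>
    h.insert_triangle ht₀ h1 hl hm hc hlm hi hvis hac hbc hB⟩
  intro t ht hct
  have h3 := hi t ht ⟨mem_convexHull_triple.2 ⟨l, m, _, hl.le, hm.le, by norm_num, hlm, hc⟩,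
    subset_convexHull ℝ _ hct⟩
  simp [orient_eq_zero_of_mem_segment h3] at h1

end IsDeflatedComplex

/-! ### The closed polygon as the union of the triangles. -/

namespace SimplePolygon

variable {m : ℕ} {P : SimplePolygon m} {𝒯 : Finset (Finset (ℝ × ℝ))}

/-- A deflated complex whose boundary is a polygon is the closed polygon. -/
theorem closedRegion_eq_region (h : IsDeflatedComplex 𝒯 P.boundary)
    (hsub : P.boundary ⊆ region 𝒯) : P.closedRegion = region 𝒯 := by
  have hU := isCompact_region 𝒯
  apply Set.Subset.antisymm
  · rintro z (hz | ⟨hz, hb⟩)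
    · exact hsub hz
    · by_contra hzU
      -- The connected complement of the region avoids the boundary, so it lies in the component of
      -- `z`. If that were bounded, the plane would be the union of two bounded sets.
      have h1 : (region 𝒯)ᶜ ⊆ connectedComponentIn P.boundaryᶜ z :=
        h.compl.subset_connectedComponentIn hzU (Set.compl_subset_compl.2 hsub)
      have h2 : Bornology.IsBounded (Set.univ : Set (ℝ × ℝ)) := by
        rw [← Set.union_compl_self (region 𝒯)]
        exact hU.isBounded.union (hb.subset h1)
      have h3 : Bornology.IsBounded (Set.univ : Set ℝ) := by
        have := (LipschitzWith.prod_fst (α := ℝ) (β := ℝ)).isBounded_image h2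
        simpa [Set.image_univ, Set.range_eq_univ.2 Prod.fst_surjective] using this
      exact NoncompactSpace.noncompact_univ (X := ℝ)
        (Metric.isCompact_of_isClosed_isBounded isClosed_univ h3)
  · intro z hz
    by_cases hzB : z ∈ P.boundary
    · exact Or.inl hzB
    · refine Or.inr ⟨hzB, ?_⟩
      have hopen : region 𝒯 \ P.boundary = interior (region 𝒯) ∩ P.boundaryᶜ := by
        ext w
        exact ⟨fun hw => ⟨h.sdiff_subset_interior hw, hw.2⟩, fun hw => ⟨interior_subset hw.1, hw.2⟩⟩
      refine hU.isBounded.subset ?_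
      have hc : IsPreconnected (connectedComponentIn P.boundaryᶜ z) :=
        isPreconnected_connectedComponentIn
      intro w hw
      by_contra hwU
      -- Off the boundary, the interior of the region and its complement are disjoint open sets
      -- covering everything, so the component of `z` cannot leave the region.
      obtain ⟨y, hy, hy1, hy2⟩ := hc (interior (region 𝒯)) (region 𝒯)ᶜ isOpen_interior
        hU.isClosed.isOpen_compl (by
          intro y hy
          by_cases hyU : y ∈ region 𝒯
          · exact Or.inl (h.sdiff_subset_interior
              ⟨hyU, connectedComponentIn_subset _ _ hy⟩)
          · exact Or.inr hyU)
        ⟨z, mem_connectedComponentIn hzB, h.sdiff_subset_interior ⟨hz, hzB⟩⟩ ⟨w, hw, hwU⟩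
      exact hy2 (interior_subset hy1)

end SimplePolygon

/-- A single triangle is a deflated complex. -/
theorem isDeflatedComplex_singleton {B : Set (ℝ × ℝ)}
    (h₁ : segment ℝ ((0 : ℝ), (0 : ℝ)) (1, 0) ⊆ B) (h₂ : segment ℝ ((1 : ℝ), (0 : ℝ)) (0, 1) ⊆ B)
    (h₃ : segment ℝ ((0 : ℝ), (1 : ℝ)) (0, 0) ⊆ B) :
    IsDeflatedComplex {{((0 : ℝ), (0 : ℝ)), (1, 0), (0, 1)}} B := by
  have hpos : 0 < orient (0, 0) (1, 0) (0, 1) := by norm_num [orient]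
  have hreg : region {{((0 : ℝ), (0 : ℝ)), (1, 0), (0, 1)}} =
      convexHull ℝ {((0 : ℝ), (0 : ℝ)), (1, 0), (0, 1)} := by
    simp [region]
  constructor
  · intro t ht
    obtain rfl := Finset.mem_singleton.1 ht
    exact ⟨_, _, _, rfl, hpos⟩
  · intro t ht t' ht'
    obtain rfl := Finset.mem_singleton.1 ht
    obtain rfl := Finset.mem_singleton.1 ht'
    simp
  · rw [hreg]
    -- The complement is a union of three half-planes. The point `(4, -2)` lies in the first two and
    -- `(-2, 4)` in the last two.
    have heq : (convexHull ℝ {((0 : ℝ), (0 : ℝ)), (1, 0), (0, 1)})ᶜ =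
        {z | orient (0, 0) (1, 0) z < 0} ∪ ({z | orient (1, 0) (0, 1) z < 0} ∪
          {z | orient (0, 1) (0, 0) z < 0}) := by
      ext z
      simp only [Set.mem_compl_iff, mem_triangle_iff hpos, Set.mem_union, Set.mem_ofPred_eq,
        not_and_or, not_le]
    rw [heq]
    refine IsPreconnected.union (4, -2) ?_ ?_ (convex_orient_neg _ _).isPreconnected
      (IsPreconnected.union (-2, 4) ?_ ?_ (convex_orient_neg _ _).isPreconnected
        (convex_orient_neg _ _).isPreconnected)
    · norm_num [orient]
    · left; norm_num [orient]
    · norm_num [orient]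
    · norm_num [orient]
  · rw [hreg]
    rintro z ⟨hz, hzB⟩
    have h := (mem_triangle_iff hpos).1 hz
    refine openTriangle_subset_interior hpos ⟨h.1.lt_of_ne' fun h0 => hzB (h₁ ?_),
      h.2.1.lt_of_ne' fun h0 => hzB (h₂ ?_), h.2.2.lt_of_ne' fun h0 => hzB (h₃ ?_)⟩
    · exact mem_segment_of_mem_triangle hpos.ne' hz h0
    · exact mem_segment_of_mem_triangle (c := (0, 0)) (by norm_num [orient])
        (by rwa [triangle_rotate]) h0
    · exact mem_segment_of_mem_triangle (c := (1, 0)) (by norm_num [orient])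
        (by rwa [← triangle_rotate (0, 1) (0, 0) (1, 0)]) h0
  · intro t ht t' ht' v hv w hw _
    obtain rfl := Finset.mem_singleton.1 ht
    obtain rfl := Finset.mem_singleton.1 ht'
    exact ⟨_, ht, hv, hw⟩

/-! ## Trees -/

namespace SimpleGraph.IsTree

variable {V : Type*} {G : SimpleGraph V}

/-- Shortest paths from `r` to `u` and `u'` avoid the more distant `v`. Prolonged to `v` they become
two paths with the same ends, which coincide in a tree. -/
theorem eq_of_adj_of_dist_lt (hG : G.IsTree) {r u u' v : V} (hu : G.Adj u v) (hu' : G.Adj u' v)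
    (h : G.dist r u < G.dist r v) (h' : G.dist r u' < G.dist r v) : u = u' := by
  classical
  have key : ∀ w, G.dist r w < G.dist r v → ∃ p : G.Walk r w, p.IsPath ∧ v ∉ p.support := by
    intro w hw
    obtain ⟨p, hp, hlen⟩ := (hG.connected r w).exists_path_of_dist
    refine ⟨p, hp, fun hv => ?_⟩
    have h1 := SimpleGraph.dist_le (p.takeUntil v hv)
    have h2 := p.length_takeUntil_le_length hv
    omega
  obtain ⟨p, hp, hv⟩ := key u h
  obtain ⟨p', hp', hv'⟩ := key u' h'
  have h1 := (hG.isAcyclic.subsingleton_path r v).elim ⟨_, hp.concat hv hu⟩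
    ⟨_, hp'.concat hv' hu'⟩
  have h2 := congrArg (fun q : G.Path r v => (q : G.Walk r v).penultimate) h1
  simpa using h2

/-- The neighbour of a node on its path to the root. -/
noncomputable def parent (_hG : G.IsTree) (r v : V) : V :=
  open Classical in if h : ∃ u, G.Adj u v ∧ G.dist r u < G.dist r v then h.choose else v

theorem parent_spec (hG : G.IsTree) {r v : V} (hv : v ≠ r) :
    G.Adj (hG.parent r v) v ∧ G.dist r (hG.parent r v) < G.dist r v := by
  have h : ∃ u, G.Adj u v ∧ G.dist r u < G.dist r v := by
    obtain ⟨p, hp, hlen⟩ := (hG.connected v r).exists_path_of_dist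
    cases p with
    | nil => exact absurd rfl hv
    | @cons _ w _ hw q =>
      refine ⟨w, hw.symm, ?_⟩
      have h1 := SimpleGraph.dist_le q
      simp only [Walk.length_cons] at hlen
      rw [SimpleGraph.dist_comm, SimpleGraph.dist_comm (u := r)]
      omega
  rw [parent, dif_pos h]
  exact h.choose_spec

theorem eq_parent_or (hG : G.IsTree) (r : V) {u v : V} (h : G.Adj u v) :
    (u = hG.parent r v ∧ v ≠ r ∧ G.dist r u < G.dist r v) ∨
      (v = hG.parent r u ∧ u ≠ r ∧ G.dist r v < G.dist r u) := by
  have key : ∀ u v : V, G.Adj u v → G.dist r u < G.dist r v →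
      (u = hG.parent r v ∧ v ≠ r ∧ G.dist r u < G.dist r v) := by
    intro u v h hlt
    have hv : v ≠ r := by rintro rfl; simp at hlt
    exact ⟨hG.eq_of_adj_of_dist_lt h (hG.parent_spec hv).1 hlt (hG.parent_spec hv).2, hv, hlt⟩
  rcases (hG.dist_ne_of_adj r h).lt_or_gt with hlt | hlt
  · exact Or.inl (key u v h hlt)
  · exact Or.inr (key v u h.symm hlt)

/-- A walk without backtracking in a tree visits no node twice. -/
theorem injOn_of_no_backtrack (hG : G.IsTree) {n : ℕ} {x : ℕ → V}
    (hadj : ∀ i, i + 1 ≤ n → G.Adj (x i) (x (i + 1)))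
    (hne : ∀ i, i + 2 ≤ n → x (i + 2) ≠ x i) : Set.InjOn x (Set.Iic n) := by
  -- The walk always moves away from `x i`: only one neighbour of the current node is nearer to `x
  -- i`, and it is the node just left.
  have key : ∀ i k, i + k + 1 ≤ n → G.dist (x i) (x (i + k)) < G.dist (x i) (x (i + k + 1)) := by
    intro i k
    induction k with
    | zero =>
      intro h
      simpa using (hG.connected (x i) (x (i + 1))).pos_dist_of_ne (hadj i h).ne
    | succ k ih =>
      intro h
      have h1 := ih (by omega)
      have ha := hadj (i + k + 1) h
      rcases (hG.dist_ne_of_adj (x i) ha).lt_or_gt with h2 | h2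
      · exact h2
      · exact absurd (hG.eq_of_adj_of_dist_lt (hadj (i + k) (by omega)) ha.symm h1 h2).symm
          (hne (i + k) h)
  have mono : ∀ i k, i + k + 1 ≤ n → 0 < G.dist (x i) (x (i + k + 1)) := fun i k h =>
    (Nat.zero_le _).trans_lt (key i k h)
  intro i hi j hj hij
  rcases lt_trichotomy i j with h | h | h
  · obtain ⟨k, rfl⟩ := Nat.exists_eq_add_of_lt h
    have := mono i k hj
    simp [← hij] at this
  · exact h
  · obtain ⟨k, rfl⟩ := Nat.exists_eq_add_of_lt h
    have := mono j k hi
    simp [hij] at this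

end SimpleGraph.IsTree

namespace PlaneTree

variable {V : Type*} {D : PlaneTree V}

theorem adj_rot {v y : V} (h : D.graph.Adj v y) : D.graph.Adj v (D.rot v y) :=
  (D.rot_isCycleOn v).apply_mem_iff.2 h

theorem rot_cube (hd : ∀ v, ¬ D.IsTerminal v → D.deg v = 3) {v y : V} (hv : ¬ D.IsTerminal v)
    (h : D.graph.Adj v y) :
    D.rot v (D.rot v (D.rot v y)) = y ∧ D.rot v y ≠ y ∧ D.rot v (D.rot v y) ≠ y ∧
      ∀ z, D.graph.Adj v z → z = y ∨ z = D.rot v y ∨ z = D.rot v (D.rot v y) := by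
  have h3 : (D.graph.neighborSet v).ncard = 3 := hd v hv
  have hfin : (D.graph.neighborSet v).Finite := Set.finite_of_ncard_pos (by omega)
  obtain ⟨s, hs⟩ := hfin.exists_finset_coe
  have hc := D.rot_isCycleOn v
  rw [← hs] at hc h3
  rw [Set.ncard_coe_finset] at h3
  have hy : y ∈ s := by rw [← Finset.mem_coe, hs]; exact h
  have hpow (n : ℕ) := hc.pow_apply_eq hy (n := n)
  rw [h3] at hpow
  refine ⟨?_, ?_, ?_, ?_⟩
  · simpa [pow_succ] using (hpow 3).2 dvd_rfl
  · simpa using (hpow 1).not.2 (by norm_num)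
  · simpa [pow_succ] using (hpow 2).not.2 (by norm_num)
  · intro z hz
    have hz' : z ∈ s := by rw [← Finset.mem_coe, hs]; exact hz
    obtain ⟨n, hn, rfl⟩ := hc.exists_pow_eq hy hz'
    rw [h3] at hn
    interval_cases n <;> simp [pow_succ]

end PlaneTree

/-! ## Partial realizations -/

namespace PlaneTree

variable {V : Type*} (D : PlaneTree V)

/-- A step of the walk along the outer face inside `S`; the pair `(u, v)` stands for the position at
`v`, having come from `u`. -/
def Turn (S : Finset V) (d e : V × V) : Prop := d.2 ∈ S ∧ e.2 ∈ S ∧ e = (d.2, D.rot d.2 d.1)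

variable {D}

theorem Turn.mono {S S' : Finset V} (h : S ⊆ S') {d e : V × V} (hd : D.Turn S d e) :
    D.Turn S' d e := ⟨h hd.1, h hd.2.1, hd.2.2⟩

/-- The corners of the triangle of the node `s`, where `κ s y` is the corner between the edges to
`y` and to the next neighbour of `s`. -/
noncomputable def corners [Finite V] (D : PlaneTree V) (κ : V → V → ℝ × ℝ) (s : V) :
    Finset (ℝ × ℝ) :=
  (Set.toFinite (κ s '' D.graph.neighborSet s)).toFinset

theorem mem_corners [Finite V] {κ : V → V → ℝ × ℝ} {s : V} {q : ℝ × ℝ} :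
    q ∈ D.corners κ s ↔ ∃ y, D.graph.Adj s y ∧ κ s y = q := by
  simp [corners]

variable (D) in
/-- The start of the polygon edge of the node `z`. -/
noncomputable def edgeStart (r : V) (κ : V → V → ℝ × ℝ) (z : V) : ℝ × ℝ :=
  κ (D.isTree.parent r z) (D.rot (D.isTree.parent r z) (D.rot (D.isTree.parent r z) z))

variable (D) in
/-- The end of the polygon edge of the node `z`. -/
noncomputable def edgeEnd (r : V) (κ : V → V → ℝ × ℝ) (z : V) : ℝ × ℝ :=
  κ (D.isTree.parent r z) z

end PlaneTree

namespace PartiallyDirectedPlaneTree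

variable {V : Type*}

/-- The hypotheses on the directed dual of a deflated polygon. -/
structure IsLegal (D : PartiallyDirectedPlaneTree V) : Prop where
  deg : ∀ v, ¬ D.IsTerminal v → D.deg v = 3
  dir : ∀ x y, D.graph.Adj x y → ((D.Dir x y ∨ D.Dir y x) ↔ (¬ D.IsTerminal x ∧ ¬ D.IsTerminal y))
  legal : ¬ ∃ (n : ℕ) (x : ℕ → V), D.IsIllegalPath n x

variable {D : PartiallyDirectedPlaneTree V}

theorem exists_iterate_of_transGen {S : Finset V} {d e : V × V}
    (h : TransGen (D.Turn S) d e) :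
    ∃ k, (fun d : V × V => (d.2, D.rot d.2 d.1))^[k + 1] d = e ∧
      ∀ j ≤ k + 1, ((fun d : V × V => (d.2, D.rot d.2 d.1))^[j] d).2 ∈ S := by
  induction h with
  | single h =>
    refine ⟨0, h.2.2.symm, fun j hj => ?_⟩
    interval_cases j
    · exact h.1
    · have := h.2.1
      rw [h.2.2] at this
      exact this
  | @tail f g _ h ih =>
    obtain ⟨k, hk, hS⟩ := ih
    have hk' : (fun d : V × V => (d.2, D.rot d.2 d.1))^[k + 1 + 1] d = g := by
      rw [Function.iterate_succ_apply', hk, ← h.2.2]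
    refine ⟨k + 1, hk', fun j hj => ?_⟩
    rcases Nat.le_succ_iff.1 hj with hj | rfl
    · exact hS j hj
    · rw [hk']; exact h.2.1

/-- A fan with two reflex pairs that do not overlap gives an illegal path. -/
theorem IsLegal.false_of_two_dir (hD : D.IsLegal) {S : Finset V} (hS : ∀ s ∈ S, ¬ D.IsTerminal s)
    {d e : V × V} (hd : D.Dir d.1 d.2) (h : TransGen (D.Turn S) d e)
    (he : D.Dir e.2 (D.rot e.2 e.1)) : False := by
  obtain ⟨k, hk, hkS⟩ := exists_iterate_of_transGen h
  set N : V × V → V × V := fun d => (d.2, D.rot d.2 d.1) with hN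
  have hsucc (j : ℕ) : N^[j + 1] d = N (N^[j] d) := Function.iterate_succ_apply' N j d
  have hadj (j : ℕ) : D.graph.Adj (N^[j] d).1 (N^[j] d).2 := by
    induction j with
    | zero => exact D.dir_adj _ _ hd
    | succ j ih => rw [hsucc]; exact PlaneTree.adj_rot ih.symm
  have hnext (j : ℕ) : (N^[j + 1] d).1 = (N^[j] d).2 := by rw [hsucc]
  have hnext' (j : ℕ) : (N^[j + 1] d).2 = D.rot (N^[j] d).2 (N^[j] d).1 := by rw [hsucc]
  have hinj : Set.InjOn (fun i => (N^[i] d).1) (Set.Iic (k + 3)) := by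
    refine D.isTree.injOn_of_no_backtrack (fun i _ => ?_) (fun i hi => ?_)
    · simp only [hnext]; exact hadj i
    · simp only [hnext, hnext']
      exact (PlaneTree.rot_cube hD.deg (hS _ (hkS i (by omega))) (hadj i).symm).2.1
  -- There are `k + 1` turns from `d` to `e`. With the two nodes of `d` and the final node `rot e.2
  -- e.1` this makes `k + 4` nodes, and `TransGen` provides the one turn needed for length four.
  refine hD.legal ⟨k + 4, fun i => (N^[i - 1] d).1, by omega, ⟨?_, ?_, ?_⟩, ?_, ?_⟩
  · intro i hi j hj hij
    have := hinj (show i - 1 ≤ k + 3 by have := hi.2; omega)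
      (show j - 1 ≤ k + 3 by have := hj.2; omega) hij
    have := hi.1; have := hj.1; omega
  · intro i hi _
    obtain ⟨i, rfl⟩ := Nat.exists_eq_add_of_le' hi
    simp only [Nat.add_sub_cancel, hnext]
    exact hadj i
  · intro i hi _
    obtain ⟨i, rfl⟩ := Nat.exists_eq_add_of_le' hi
    simp only [Nat.add_sub_cancel, show i + 1 + 2 - 1 = i + 1 + 1 from rfl, hnext, hnext']
  · simpa using hd
  · change D.Dir (N^[k + 1 + 1] d).1 (N^[k + 1 + 1 + 1] d).1
    rw [hnext (k + 1 + 1), hnext' (k + 1), hnext (k + 1), hk]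
    exact he

variable [Finite V]

/-- A realization of the part of `D` spanned by the nodes in `S` and their neighbours by a
deflated polygon: `Z` is the cycle of the nodes of polygon edges. -/
structure Realization (D : PartiallyDirectedPlaneTree V) (r : V) (S : Finset V)
    (κ : V → V → ℝ × ℝ) (Z : Cycle V) : Prop where
  root_mem : r ∈ S
  nonterminal : ∀ s ∈ S, ¬ D.IsTerminal s
  parent_mem : ∀ s ∈ S, s ≠ r → D.isTree.parent r s ∈ S
  mem_cycle : ∀ z, z ∈ Z ↔ z ∉ S ∧ D.isTree.parent r z ∈ S
  nodup : Z.Nodup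
  length : 3 ≤ Z.length
  -- The edge of a triangle `s` towards `y` runs from the corner `κ s (rot s (rot s y))` to `κ s y`,
  -- with the triangle on its left. The cycle therefore runs counter-clockwise.
  chain : Z.Chain fun z z' => D.edgeEnd r κ z = D.edgeStart r κ z'
  start_inj : ∀ z ∈ Z, ∀ z' ∈ Z, D.edgeStart r κ z = D.edgeStart r κ z' → z = z'
  exists_start : ∀ s ∈ S, ∀ q ∈ D.corners κ s, ∃ z ∈ Z, D.edgeStart r κ z = q
  pos : ∀ s ∈ S, ∀ y, D.graph.Adj s y →
    0 < orient (κ s y) (κ s (D.rot s y)) (κ s (D.rot s (D.rot s y)))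
  compat : ∀ s ∈ S, ∀ s' ∈ S, D.graph.Adj s s' → κ s' s = κ s (D.rot s (D.rot s s'))
  -- The triangles at one vertex lie on a single stretch of the outer walk, which goes clockwise
  -- around the vertex.
  fan : ∀ s ∈ S, ∀ s' ∈ S, ∀ y y', D.graph.Adj s y → D.graph.Adj s' y' → κ s y = κ s' y' →
    ReflTransGen (D.Turn S) (y, s) (y', s') ∨ ReflTransGen (D.Turn S) (y', s') (y, s)
  -- A stretch of a fan without forward steps spans an angle less than π, measured from the right
  -- leg of its last triangle to the left leg of its first.
  convex : ∀ d e : V × V, d.2 ∈ S → D.graph.Adj d.2 d.1 →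
    ReflTransGen (fun d e => D.Turn S d e ∧ ¬ D.Dir d.2 e.2) d e →
    0 < orient (κ d.2 d.1) (κ e.2 (D.rot e.2 e.1)) (κ d.2 (D.rot d.2 (D.rot d.2 d.1)))
  reflex : ∀ s ∈ S, ∀ s' ∈ S, D.Dir s s' →
    orient (κ s (D.rot s (D.rot s s'))) (κ s' (D.rot s' s)) (κ s (D.rot s s')) < 0
  adj_of_share : ∀ s ∈ S, ∀ s' ∈ S, s ≠ s' → ∀ q q', q ≠ q' → q ∈ D.corners κ s →
    q ∈ D.corners κ s' → q' ∈ D.corners κ s → q' ∈ D.corners κ s' → D.graph.Adj s s'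
  eq_parent_of_share : ∀ z ∈ Z, ∀ s ∈ S, D.edgeStart r κ z ∈ D.corners κ s →
    D.edgeEnd r κ z ∈ D.corners κ s → s = D.isTree.parent r z
  corners_inj : ∀ s ∈ S, ∀ s' ∈ S, D.corners κ s = D.corners κ s' → s = s'
  complex : IsDeflatedComplex (S.image (D.corners κ))
    (⋃ z ∈ {z | z ∈ Z}, segment ℝ (D.edgeStart r κ z) (D.edgeEnd r κ z))

end PartiallyDirectedPlaneTree

namespace PlaneTree

variable {V : Type*} [Finite V] {D : PlaneTree V}

theorem corners_eq (hd : ∀ v, ¬ D.IsTerminal v → D.deg v = 3) {s y : V} (hs : ¬ D.IsTerminal s)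
    (hy : D.graph.Adj s y) (κ : V → V → ℝ × ℝ) :
    D.corners κ s = {κ s y, κ s (D.rot s y), κ s (D.rot s (D.rot s y))} := by
  ext q
  simp only [mem_corners, Finset.mem_insert, Finset.mem_singleton]
  constructor
  · rintro ⟨z, hz, rfl⟩
    rcases (rot_cube hd hs hy).2.2.2 z hz with rfl | rfl | rfl <;> simp
  · rintro (rfl | rfl | rfl)
    · exact ⟨_, hy, rfl⟩
    · exact ⟨_, adj_rot hy, rfl⟩
    · exact ⟨_, adj_rot (adj_rot hy), rfl⟩

end PlaneTree

/-! ### Fans of triangles and the room left by legality. -/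

namespace PartiallyDirectedPlaneTree.Realization

variable {V : Type*} [Finite V] {D : PartiallyDirectedPlaneTree V} {r : V} {S : Finset V}
  {κ : V → V → ℝ × ℝ} {Z : Cycle V}

theorem rot_cube (R : D.Realization r S κ Z) (hD : D.IsLegal) {s y : V} (hs : s ∈ S)
    (hy : D.graph.Adj s y) : D.rot s (D.rot s (D.rot s y)) = y :=
  (PlaneTree.rot_cube hD.deg (R.nonterminal s hs) hy).1

theorem corners_eq (R : D.Realization r S κ Z) (hD : D.IsLegal) {s y : V} (hs : s ∈ S)
    (hy : D.graph.Adj s y) :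
    D.corners κ s = {κ s y, κ s (D.rot s y), κ s (D.rot s (D.rot s y))} :=
  PlaneTree.corners_eq hD.deg (R.nonterminal s hs) hy κ

theorem corner_inj (R : D.Realization r S κ Z) (hD : D.IsLegal) {s y y' : V} (hs : s ∈ S)
    (hy : D.graph.Adj s y) (hy' : D.graph.Adj s y') (h : κ s y = κ s y') : y = y' := by
  have hpos := R.pos s hs y hy
  rcases (PlaneTree.rot_cube hD.deg (R.nonterminal s hs) hy).2.2.2 y' hy' with h1 | h1 | h1
  · exact h1.symm
  · rw [h1] at h
    simp [h, orient_self_left] at hpos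
  · rw [h1] at h
    simp [h, orient_self_outer] at hpos

/-- A turn keeps the vertex on its right and crosses the right leg of one triangle, which is the
left leg of the next. -/
theorem turn_corner (R : D.Realization r S κ Z) (hD : D.IsLegal) {d e : V × V}
    (hd : D.graph.Adj d.2 d.1) (h : D.Turn S d e) :
    D.graph.Adj e.2 e.1 ∧ κ e.2 e.1 = κ d.2 d.1 ∧
      κ e.2 (D.rot e.2 (D.rot e.2 e.1)) = κ d.2 (D.rot d.2 d.1) := by
  obtain ⟨h1, h2, rfl⟩ := h
  have ha := PlaneTree.adj_rot hd
  refine ⟨ha.symm, ?_, ?_⟩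
  · rw [R.compat _ h1 _ h2 ha, R.rot_cube hD h1 hd]
  · exact (R.compat _ h2 _ h1 ha.symm).symm

theorem reach_corner (R : D.Realization r S κ Z) (hD : D.IsLegal) {d e : V × V}
    (hd : D.graph.Adj d.2 d.1) (h : ReflTransGen (D.Turn S) d e) :
    D.graph.Adj e.2 e.1 ∧ κ e.2 e.1 = κ d.2 d.1 := by
  induction h with
  | refl => exact ⟨hd, rfl⟩
  | tail _ h ih =>
    have := R.turn_corner hD ih.1 h
    exact ⟨this.1, this.2.1.trans ih.2⟩

/-- There is room for a new triangle with a reflex angle at the end of the fan at the start of the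
edge of `x`. -/
theorem orient_of_mem_start (R : D.Realization r S κ Z) (hD : D.IsLegal) {p x s : V} (hp : p ∈ S)
    (hx : x ∉ S) (hpx : D.Dir p x) (hs : s ∈ S) (hsp : s ≠ p)
    (h : κ p (D.rot p (D.rot p x)) ∈ D.corners κ s) {q : ℝ × ℝ} (hq : q ∈ D.corners κ s)
    (hqa : q ≠ κ p (D.rot p (D.rot p x))) :
    q = κ p (D.rot p x) ∨ 0 < orient (κ p (D.rot p (D.rot p x))) (κ p (D.rot p x)) q := by
  have hadj := D.dir_adj _ _ hpx
  obtain ⟨y, hy, hya⟩ := PlaneTree.mem_corners.1 h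
  have hcube := R.rot_cube hD hp hadj
  have hadj2 := PlaneTree.adj_rot (PlaneTree.adj_rot hadj)
  -- The walk around this vertex would go on from `p` to `x`, which is not in `S`. So `p` is the
  -- last triangle of the fan and `s` comes earlier.
  have hreach : ReflTransGen (D.Turn S) (y, s) (D.rot p (D.rot p x), p) := by
    rcases R.fan s hs p hp y _ hy hadj2 hya with h1 | h1
    · exact h1
    · rcases ReflTransGen.cases_head h1 with h2 | ⟨g, ⟨-, h2, rfl⟩, -⟩
      · exact absurd (congrArg Prod.snd h2).symm hsp
      · simp only [hcube] at h2
        exact absurd h2 hx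
  obtain h1 | ⟨f, hf, hturn⟩ := ReflTransGen.cases_tail hreach
  · exact absurd (congrArg Prod.snd h1).symm hsp
  -- A forward step before `f`, followed by the walk through `f` and `p` to `x`, would be an illegal
  -- path. The turn from `f` into `p` keeps the two directed pairs disjoint, so only this turn may
  -- be forward.
  have hlift : ∀ d, ReflTransGen (D.Turn S) d f →
      ReflTransGen (fun d e => D.Turn S d e ∧ ¬ D.Dir d.2 e.2) d f := by
    intro d hd
    induction hd using ReflTransGen.head_induction_on with
    | refl => exact .refl
    | @head d g hdg hgf ih =>
      refine .head ⟨hdg, fun hdir => ?_⟩ ih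
      refine hD.false_of_two_dir (d := g) R.nonterminal ?_ (TransGen.tail' hgf hturn) ?_
      · have : g.1 = d.2 := by rw [hdg.2.2]
        rwa [this]
      · simpa only [hcube] using hpx
  -- The right leg of the triangle before `p` is the left leg of `p`, from which the angle of the
  -- remaining fan is measured.
  have hend : κ f.2 (D.rot f.2 f.1) = κ p (D.rot p x) := by
    have h1 : D.rot f.2 f.1 = p := (congrArg Prod.snd hturn.2.2).symm
    have h2 : D.rot p (D.rot p x) = f.2 := congrArg Prod.fst hturn.2.2
    rw [h1, R.compat p hp f.2 hturn.1 (by rw [← h2]; exact hadj2), ← h2, hcube]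
  have hstart : ∀ d, d.2 ∈ S → D.graph.Adj d.2 d.1 → ReflTransGen (D.Turn S) d f →
      0 < orient (κ d.2 d.1) (κ p (D.rot p x)) (κ d.2 (D.rot d.2 (D.rot d.2 d.1))) := by
    intro d hd hda hdf
    rw [← hend]
    exact R.convex d f hd hda (hlift d hdf)
  rw [R.corners_eq hD hs hy, hya] at hq
  simp only [Finset.mem_insert, Finset.mem_singleton, hqa, false_or] at hq
  rcases hq with rfl | rfl
  · rcases ReflTransGen.cases_head hf with rfl | ⟨g, hg, hgf⟩
    · exact Or.inl hend
    · have h1 := R.turn_corner hD (d := (y, s)) hy hg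
      have h2 := hstart g hg.2.1 h1.1 hgf
      rw [h1.2.1, h1.2.2, hya] at h2
      exact Or.inr h2
  · have h2 := hstart (y, s) hs hy hf
    rw [hya] at h2
    exact Or.inr h2

/-- There is room for a new triangle with a reflex angle at the start of the fan at the end of the
edge of `x`. -/
theorem orient_of_mem_end (R : D.Realization r S κ Z) (hD : D.IsLegal) {p x s : V} (hp : p ∈ S)
    (hx : x ∉ S) (hxp : D.Dir x p) (hs : s ∈ S) (hsp : s ≠ p)
    (h : κ p x ∈ D.corners κ s) {q : ℝ × ℝ} (hq : q ∈ D.corners κ s) (hqb : q ≠ κ p x) :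
    q = κ p (D.rot p x) ∨ orient (κ p x) (κ p (D.rot p x)) q < 0 := by
  have hadj := (D.dir_adj _ _ hxp).symm
  obtain ⟨y, hy, hyb⟩ := PlaneTree.mem_corners.1 h
  -- Here the walk around the vertex starts at `p`, having come from `x`, and legality forbids
  -- forward steps after `g`.
  have hreach : ReflTransGen (D.Turn S) (x, p) (y, s) := by
    rcases R.fan s hs p hp y _ hy hadj hyb with h1 | h1
    · rcases ReflTransGen.cases_tail h1 with h2 | ⟨g, -, h2, -, h3⟩
      · exact absurd (congrArg Prod.snd h2).symm hsp
      · have h4 : x = g.2 := congrArg Prod.fst h3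
        exact absurd (h4 ▸ h2) hx
    · exact h1
  obtain h1 | ⟨g, hturn, hg⟩ := ReflTransGen.cases_head hreach
  · exact absurd (congrArg Prod.snd h1).symm hsp
  have hlift : ∀ e, ReflTransGen (D.Turn S) g e →
      ReflTransGen (fun d e => D.Turn S d e ∧ ¬ D.Dir d.2 e.2) g e := by
    intro e he
    induction he with
    | refl => exact .refl
    | @tail f e hgf hfe ih =>
      refine .tail ih ⟨hfe, fun hdir => ?_⟩
      refine hD.false_of_two_dir (d := (x, p)) R.nonterminal hxp (TransGen.head' hturn hgf) ?_
      rw [hfe.2.2] at hdir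
      exact hdir
  have hg1 := R.turn_corner hD (d := (x, p)) hadj hturn
  have hend : ∀ e, ReflTransGen (D.Turn S) g e →
      orient (κ p x) (κ p (D.rot p x)) (κ e.2 (D.rot e.2 e.1)) < 0 := by
    intro e he
    have := R.convex g e hturn.2.1 hg1.1 (hlift e he)
    rw [hg1.2.1, hg1.2.2] at this
    rw [orient_swap]
    simpa using this
  rw [R.corners_eq hD hs hy, hyb] at hq
  simp only [Finset.mem_insert, Finset.mem_singleton, hqb, false_or] at hq
  rcases hq with rfl | rfl
  · exact Or.inr (hend _ hg)
  · rcases ReflTransGen.cases_tail hg with h1 | ⟨f, hf, hfe⟩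
    · left
      rw [← h1] at hg1
      exact hg1.2.2
    · have h1 := R.turn_corner hD (R.reach_corner hD hg1.1 hf).1 hfe
      rw [h1.2.2]
      exact Or.inr (hend _ hf)

/-- The geometric part of the extension of a realization by the node `x`. -/
theorem exists_apex (R : D.Realization r S κ Z) (hD : D.IsLegal) {p x : V} (hp : p ∈ S)
    (hx : x ∉ S) (hpx : D.graph.Adj p x) (hxt : ¬ D.IsTerminal x) :
    ∃ c : ℝ × ℝ, orient (κ p (D.rot p (D.rot p x))) (κ p x) c < 0 ∧
      (∀ s ∈ S, c ∉ D.corners κ s) ∧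
      (D.Dir p x → orient (κ p (D.rot p (D.rot p x))) c (κ p (D.rot p x)) < 0 ∧
        ∀ s ∈ S, ∀ q ∈ D.corners κ s, orient (κ p x) (κ p (D.rot p (D.rot p x))) q < 0 →
          orient (κ p x) c q < 0) ∧
      (D.Dir x p → orient (κ p x) (κ p (D.rot p x)) c < 0 ∧
        ∀ s ∈ S, ∀ q ∈ D.corners κ s, 0 < orient (κ p (D.rot p (D.rot p x))) (κ p x) q →
          0 < orient (κ p (D.rot p (D.rot p x))) c q) ∧
      ∀ B' : Set (ℝ × ℝ), segment ℝ (κ p (D.rot p (D.rot p x))) c ⊆ B' → segment ℝ c (κ p x) ⊆ B' →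
        (⋃ z ∈ {z | z ∈ Z}, segment ℝ (D.edgeStart r κ z) (D.edgeEnd r κ z)) ⊆
          B' ∪ segment ℝ (κ p (D.rot p (D.rot p x))) (κ p x) →
        IsDeflatedComplex (insert {κ p (D.rot p (D.rot p x)), κ p x, c}
          (S.image (D.corners κ))) B' := by
  -- Walking from `p` to `x` across `ab` one has `a` on the right. So `p → x` asks for a reflex
  -- angle at `a`, and `x → p` for one at `b`.
  set a := κ p (D.rot p (D.rot p x)) with ha
  set b := κ p x with hb
  set d := κ p (D.rot p x) with hd
  have hcorners : D.corners κ p = {a, b, d} := by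
    rw [R.corners_eq hD hp hpx]; ext; simp [ha, hb, hd]; tauto
  have hpos : 0 < orient a b d := by
    have := R.pos p hp x hpx
    rwa [orient_rotate] at this
  have hmem : {a, b, d} ∈ S.image (D.corners κ) := Finset.mem_image.2 ⟨p, hp, hcorners⟩
  have hor := (hD.dir p x hpx).2 ⟨R.nonterminal p hp, hxt⟩
  by_cases hdir : D.Dir p x
  · obtain ⟨c, h1, h2, h3, h4, h5⟩ := R.complex.exists_insert_triangle hmem hpos.ne' (by
      intro t ht htp hat q hq hqa
      obtain ⟨s, hs, rfl⟩ := Finset.mem_image.1 ht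
      exact (R.orient_of_mem_start hD hp hx hdir hs (by rintro rfl; exact htp hcorners) hat hq
        hqa).imp id fun h => mul_pos hpos h)
    refine ⟨c, by nlinarith, fun s hs => h3 _ (Finset.mem_image_of_mem _ hs), fun _ => ⟨by nlinarith,
      fun s hs q hq => (h4 _ (Finset.mem_image_of_mem _ hs) q hq).2⟩,
      fun h => absurd h (D.dir_asymm _ _ hdir), fun B' k1 k2 k3 => h5 B' k1 ?_ k3⟩
    rwa [segment_symm]
  · have hdir' := hor.resolve_left hdir
    -- The same construction with `a` and `b` exchanged.
    have hneg : orient b a d < 0 := by rw [orient_swap_left]; linarith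
    have hmem' : {b, a, d} ∈ S.image (D.corners κ) := by
      convert hmem using 1; ext; simp; tauto
    obtain ⟨c, h1, h2, h3, h4, h5⟩ := R.complex.exists_insert_triangle hmem' hneg.ne (by
      intro t ht htp hbt q hq hqb
      obtain ⟨s, hs, rfl⟩ := Finset.mem_image.1 ht
      refine (R.orient_of_mem_end hD hp hx hdir' hs ?_ hbt hq hqb).imp id
        fun h => mul_pos_of_neg_of_neg hneg h
      rintro rfl
      exact htp (hcorners.trans (by ext; simp; tauto)))
    have e1 : 0 < orient b a c := by nlinarith
    have e2 : 0 < orient b c d := by nlinarith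
    refine ⟨c, by rw [orient_swap_left]; linarith, fun s hs => h3 _ (Finset.mem_image_of_mem _ hs),
      fun h => absurd h hdir, fun _ => ⟨by rw [orient_swap]; linarith,
      fun s hs q hq => (h4 _ (Finset.mem_image_of_mem _ hs) q hq).1⟩, fun B' k1 k2 k3 => ?_⟩
    have := h5 B' (by rwa [segment_symm]) k1 (by rwa [segment_symm])
    convert this using 2
    ext; simp; tauto

end PartiallyDirectedPlaneTree.Realization

/-! ### Extending a realization by one node. -/

namespace PartiallyDirectedPlaneTree.Realization

variable {V : Type*} [Finite V] {D : PartiallyDirectedPlaneTree V} {r : V} {S : Finset V}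
  {κ : V → V → ℝ × ℝ} {Z : Cycle V}

theorem edgeStart_mem_corners (R : D.Realization r S κ Z) {z : V} (hz : z ∈ Z) :
    D.edgeStart r κ z ∈ D.corners κ (D.isTree.parent r z) := by
  have h := (R.mem_cycle z).1 hz
  have hzr : z ≠ r := by rintro rfl; exact h.1 R.root_mem
  exact PlaneTree.mem_corners.2 ⟨_, PlaneTree.adj_rot (PlaneTree.adj_rot
    (D.isTree.parent_spec hzr).1), rfl⟩

theorem edgeEnd_mem_corners (R : D.Realization r S κ Z) {z : V} (hz : z ∈ Z) :
    D.edgeEnd r κ z ∈ D.corners κ (D.isTree.parent r z) := by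
  have h := (R.mem_cycle z).1 hz
  have hzr : z ≠ r := by rintro rfl; exact h.1 R.root_mem
  exact PlaneTree.mem_corners.2 ⟨_, (D.isTree.parent_spec hzr).1, rfl⟩

theorem edgeStart_ne_edgeEnd (R : D.Realization r S κ Z) (hD : D.IsLegal) {z : V} (hz : z ∈ Z) :
    D.edgeStart r κ z ≠ D.edgeEnd r κ z := by
  have h := (R.mem_cycle z).1 hz
  have hzr : z ≠ r := by rintro rfl; exact h.1 R.root_mem
  have ha := (D.isTree.parent_spec hzr).1
  intro h1
  exact (PlaneTree.rot_cube hD.deg (R.nonterminal _ h.2) ha).2.2.1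
    (R.corner_inj hD h.2 (PlaneTree.adj_rot (PlaneTree.adj_rot ha)) ha h1)

/-- The corners after a new triangle `abc` for the node `x` has been attached. -/
def extendCorners [DecidableEq V] (κ : V → V → ℝ × ℝ) (x p y : V) (a b c : ℝ × ℝ) :
    V → V → ℝ × ℝ :=
  fun s => if s = x then fun z => if z = p then a else if z = y then c else b else κ s

set_option maxHeartbeats 1000000 in
/-- A realization can be extended by a non-terminal node next to it. -/
theorem exists_extend [DecidableEq V] (R : D.Realization r S κ Z) (hD : D.IsLegal) {x : V}
    (hxZ : x ∈ Z) (hxt : ¬ D.IsTerminal x) : ∃ κ' Z', D.Realization r (insert x S) κ' Z' := by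
  obtain ⟨hxS, hpS⟩ := (R.mem_cycle x).1 hxZ
  have hxr : x ≠ r := by rintro rfl; exact hxS R.root_mem
  have hpx := (D.isTree.parent_spec hxr).1
  obtain ⟨p, hp⟩ : ∃ p, p = D.isTree.parent r x := ⟨_, rfl⟩
  have hspec {z : V} (hz : z ≠ r) := (D.isTree.parent_spec hz).1
  rw [← hp] at hpS hpx
  -- The neighbours of `x` are `p`, `y₁`, `y₂` in counter-clockwise order; they belong to the sides
  -- `ba`, `ac`, `cb` of the new triangle.
  obtain ⟨y₁, hy₁⟩ : ∃ y, y = D.rot x p := ⟨_, rfl⟩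
  obtain ⟨y₂, hy₂⟩ : ∃ y, y = D.rot x y₁ := ⟨_, rfl⟩
  obtain ⟨hrot, hne₁, hne₂, hnb⟩ := PlaneTree.rot_cube hD.deg hxt hpx.symm
  have hne₃ := (PlaneTree.rot_cube hD.deg hxt (PlaneTree.adj_rot hpx.symm)).2.1
  simp only [← hy₁, ← hy₂] at hrot hne₁ hne₂ hnb hne₃
  have hxy₁ : D.graph.Adj x y₁ := hy₁ ▸ PlaneTree.adj_rot hpx.symm
  have hxy₂ : D.graph.Adj x y₂ := hy₂ ▸ PlaneTree.adj_rot hxy₁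
  have hpx' : p ≠ x := hpx.ne
  have hnew : ∀ y, D.graph.Adj x y → y ≠ p → D.isTree.parent r y = x ∧ y ∉ S ∧ y ≠ x ∧ y ∉ Z ∧
      y ≠ r := by
    intro y hxy hyp
    rcases D.isTree.eq_parent_or r hxy with ⟨h1, h2, -⟩ | ⟨h1, -⟩
    · have hyS : y ∉ S := fun h => hxS (h1 ▸ R.parent_mem y h h2)
      exact ⟨h1.symm, hyS, hxy.ne', fun h => hxS (h1 ▸ ((R.mem_cycle y).1 h).2), h2⟩
    · exact absurd (h1.trans hp.symm) hyp
  obtain ⟨hpar₁, hyS₁, hyx₁, hyZ₁, hyr₁⟩ := hnew y₁ hxy₁ hne₁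
  obtain ⟨hpar₂, hyS₂, hyx₂, hyZ₂, hyr₂⟩ := hnew y₂ hxy₂ hne₂
  have hold : ∀ u ∈ S, D.graph.Adj u x → u = p := by
    intro u hu hux
    by_contra hup
    exact (hnew u hux.symm hup).2.1 hu
  obtain ⟨c, hc, hcS, hcdir, hcdir', hcomplex⟩ := R.exists_apex hD hpS hxS hpx hxt
  obtain ⟨a, ha⟩ : ∃ a, a = κ p (D.rot p (D.rot p x)) := ⟨_, rfl⟩
  obtain ⟨b, hb⟩ : ∃ b, b = κ p x := ⟨_, rfl⟩
  obtain ⟨d, hd⟩ : ∃ d, d = κ p (D.rot p x) := ⟨_, rfl⟩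
  simp only [← ha, ← hb, ← hd] at hc hcdir hcdir' hcomplex
  have hsx : D.edgeStart r κ x = a := by rw [ha, PlaneTree.edgeStart, ← hp]
  have hex : D.edgeEnd r κ x = b := by rw [hb, PlaneTree.edgeEnd, ← hp]
  have hrotp := R.rot_cube hD hpS hpx
  have hapx := PlaneTree.adj_rot hpx
  have hapx' := PlaneTree.adj_rot hapx
  have hap : a ∈ D.corners κ p := PlaneTree.mem_corners.2 ⟨_, hapx', ha.symm⟩
  have hbp : b ∈ D.corners κ p := PlaneTree.mem_corners.2 ⟨_, hpx, hb.symm⟩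
  have hca : c ≠ a := by rintro rfl; exact hcS p hpS hap
  have hcb : c ≠ b := by rintro rfl; exact hcS p hpS hbp
  have hab : a ≠ b := by rw [← hsx, ← hex]; exact R.edgeStart_ne_edgeEnd hD hxZ
  -- the new corners
  obtain ⟨κ', hκ'⟩ : ∃ κ', κ' = extendCorners κ x p y₁ a b c := ⟨_, rfl⟩
  have kold {s : V} (hs : s ≠ x) : κ' s = κ s := by simp [hκ', extendCorners, hs]
  have kS {s : V} (hs : s ∈ S) : κ' s = κ s := kold (by rintro rfl; exact hxS hs)
  have k0 : κ' x p = a := by simp [hκ', extendCorners]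
  have k1 : κ' x y₁ = c := by simp [hκ', extendCorners, hne₁]
  have k2 : κ' x y₂ = b := by simp [hκ', extendCorners, hne₂, hne₃]
  have cS {s : V} (hs : s ∈ S) : D.corners κ' s = D.corners κ s := by
    simp only [PlaneTree.corners, kS hs]
  have cx : D.corners κ' x = {a, b, c} := by
    rw [PlaneTree.corners_eq hD.deg hxt hpx.symm, ← hy₁, ← hy₂, k0, k1, k2]
    ext; simp; tauto
  have sold {z : V} (hz : D.isTree.parent r z ∈ S) : D.edgeStart r κ' z = D.edgeStart r κ z := by
    simp only [PlaneTree.edgeStart, kS hz]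
  have eold {z : V} (hz : D.isTree.parent r z ∈ S) : D.edgeEnd r κ' z = D.edgeEnd r κ z := by
    simp only [PlaneTree.edgeEnd, kS hz]
  have s1 : D.edgeStart r κ' y₁ = a := by rw [PlaneTree.edgeStart, hpar₁, ← hy₂, hrot, k0]
  have s2 : D.edgeStart r κ' y₂ = c := by rw [PlaneTree.edgeStart, hpar₂, hrot, ← hy₁, k1]
  have e1 : D.edgeEnd r κ' y₁ = c := by rw [PlaneTree.edgeEnd, hpar₁, k1]
  have e2 : D.edgeEnd r κ' y₂ = b := by rw [PlaneTree.edgeEnd, hpar₂, k2]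
  -- the new cycle
  obtain ⟨l, rfl⟩ : ∃ l : List V, Z = ((x :: l : List V) : Cycle V) := by
    induction Z using Quotient.inductionOn with
    | h L =>
      obtain ⟨l₁, l₂, rfl⟩ := List.append_of_mem (show x ∈ L from hxZ)
      exact ⟨l₂ ++ l₁, Quotient.sound ⟨l₁.length, by simp⟩⟩
  have hnd : x ∉ l ∧ l.Nodup := by
    have := R.nodup
    rwa [Cycle.nodup_coe_iff, List.nodup_cons] at this
  have hlZ {z : V} (hz : z ∈ l) : z ∈ ((x :: l : List V) : Cycle V) := by simp [hz]
  have hlS {z : V} (hz : z ∈ l) : z ∉ S ∧ D.isTree.parent r z ∈ S := (R.mem_cycle z).1 (hlZ hz)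
  have hlx {z : V} (hz : z ∈ l) : z ≠ x := by rintro rfl; exact hnd.1 hz
  have hsl {z : V} (hz : z ∈ l) : D.edgeStart r κ' z = D.edgeStart r κ z := sold (hlS hz).2
  have hel {z : V} (hz : z ∈ l) : D.edgeEnd r κ' z = D.edgeEnd r κ z := eold (hlS hz).2
  have hsla {z : V} (hz : z ∈ l) : D.edgeStart r κ z ≠ a := by
    rw [← hsx]
    exact fun h => hlx hz (R.start_inj z (hlZ hz) x (by simp) h)
  have hslc {z : V} (hz : z ∈ l) : D.edgeStart r κ z ≠ c := by
    rintro h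
    exact hcS _ (hlS hz).2 (h ▸ R.edgeStart_mem_corners (hlZ hz))
  have helc {z : V} (hz : z ∈ l) : D.edgeEnd r κ z ≠ c := by
    rintro h
    exact hcS _ (hlS hz).2 (h ▸ R.edgeEnd_mem_corners (hlZ hz))
  have hmem (z : V) : z ∈ ((y₁ :: y₂ :: l : List V) : Cycle V) ↔ z = y₁ ∨ z = y₂ ∨ z ∈ l := by
    simp
  have compat' : ∀ s ∈ insert x S, ∀ s' ∈ insert x S, D.graph.Adj s s' →
      κ' s' s = κ' s (D.rot s (D.rot s s')) := by
    intro s hs s' hs' hadj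
    rw [Finset.mem_insert] at hs
    rcases hs with rfl | hs
    · rw [Finset.mem_insert] at hs'
      rcases hs' with rfl | hs'
      · exact absurd hadj (D.graph.loopless.irrefl _)
      · obtain rfl := hold s' hs' hadj.symm
        rw [← hy₁, ← hy₂, k2, kS hs', hb]
    · rw [Finset.mem_insert] at hs'
      rcases hs' with rfl | hs'
      · obtain rfl := hold s hs hadj
        rw [k0, kS hs, ha]
      · rw [kS hs, kS hs']
        exact R.compat s hs s' hs' hadj
  have pos' : ∀ s ∈ insert x S, ∀ y, D.graph.Adj s y →
      0 < orient (κ' s y) (κ' s (D.rot s y)) (κ' s (D.rot s (D.rot s y))) := by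
    intro s hs y hy
    rw [Finset.mem_insert] at hs
    rcases hs with rfl | hs
    · have h1 : 0 < orient a c b := by rw [orient_swap]; linarith
      rcases hnb y hy with rfl | rfl | rfl
      · rwa [← hy₁, ← hy₂, k0, k1, k2]
      · rw [← hy₂, hrot, k0, k1, k2]
        rwa [orient_rotate]
      · rw [hrot, ← hy₁, k0, k1, k2]
        rwa [← orient_rotate]
    · rw [kS hs]; exact R.pos s hs y hy
  -- walks in the extended set
  have hstep : ∀ f e : V × V, D.graph.Adj f.2 f.1 → f.2 ∈ S → D.Turn (insert x S) f e →
      D.Turn S f e ∨ (f = (D.rot p (D.rot p x), p) ∧ e = (p, x)) := by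
    rintro f e hf hfS ⟨-, h2, h3⟩
    rcases Finset.mem_insert.1 h2 with h2 | h2
    · right
      have h4 : D.rot f.2 f.1 = x := by rw [← h2, h3]
      have h5 : f.2 = p := hold f.2 hfS (h4 ▸ PlaneTree.adj_rot hf)
      refine ⟨?_, by rw [h3, h4, h5]⟩
      have h6 := R.rot_cube hD hfS hf
      rw [h4, h5] at h6
      exact Prod.ext h6.symm h5
    · exact Or.inl ⟨hfS, h2, h3⟩
  -- The fan at `a` ends with `x`, since the next node would be `y₁`.
  have hnoturn : ∀ e, ¬ D.Turn (insert x S) (p, x) e := by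
    rintro e ⟨-, h2, h3⟩
    have : e.2 = y₁ := by rw [h3, hy₁]
    rw [this] at h2
    exact (Finset.mem_insert.1 h2).elim hyx₁ hyS₁
  have hwalk : ∀ d e : V × V, D.graph.Adj d.2 d.1 → d.2 ∈ S →
      ReflTransGen (fun d e => D.Turn (insert x S) d e ∧ ¬ D.Dir d.2 e.2) d e →
      (e.2 ∈ S ∧ D.graph.Adj e.2 e.1 ∧ ReflTransGen (fun d e => D.Turn S d e ∧ ¬ D.Dir d.2 e.2) d e)
        ∨ (e = (p, x) ∧ ¬ D.Dir p x ∧ ReflTransGen (fun d e => D.Turn S d e ∧ ¬ D.Dir d.2 e.2) d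
          (D.rot p (D.rot p x), p)) := by
    intro d e hda hdS h
    induction h with
    | refl => exact Or.inl ⟨hdS, hda, .refl⟩
    | @tail f e _ hfe ih =>
      rcases ih with ⟨h1, h2, h3⟩ | ⟨rfl, -, -⟩
      · rcases hstep f e h2 h1 hfe.1 with h4 | ⟨rfl, rfl⟩
        · exact Or.inl ⟨h4.2.1, (R.turn_corner hD h2 h4).1, h3.tail ⟨h4, hfe.2⟩⟩
        · exact Or.inr ⟨rfl, hfe.2, h3⟩
      · exact absurd hfe.1 (hnoturn e)
  have hmono {d e : V × V} (h : ReflTransGen (D.Turn S) d e) :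
      ReflTransGen (D.Turn (insert x S)) d e :=
    ReflTransGen.mono (fun _ _ => PlaneTree.Turn.mono (Finset.subset_insert _ _)) _ _ h
  have fan' : ∀ s ∈ S, ∀ y y', D.graph.Adj x y → D.graph.Adj s y' → κ' x y = κ s y' →
      ReflTransGen (D.Turn (insert x S)) (y, x) (y', s) ∨
        ReflTransGen (D.Turn (insert x S)) (y', s) (y, x) := by
    intro s hs y y' hy hy' h
    -- The new triangle is appended to the fan at `a`, is alone at `c`, and is prepended to the fan
    -- at `b`.
    rcases hnb y hy with rfl | rfl | rfl
    · right
      rw [k0, ha] at h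
      refine ReflTransGen.tail (b := (D.rot y (D.rot y x), y)) ?_ ⟨Finset.mem_insert_of_mem hpS,
        Finset.mem_insert_self _ _, by rw [hrotp]⟩
      rcases R.fan s hs y hpS y' _ hy' hapx' h.symm with h1 | h1
      · exact hmono h1
      · rcases ReflTransGen.cases_head h1 with h2 | ⟨g, ⟨-, h2, rfl⟩, -⟩
        · rw [h2]
        · simp only [hrotp] at h2
          exact absurd h2 hxS
    · rw [k1] at h
      exact absurd (PlaneTree.mem_corners.2 ⟨y', hy', h.symm⟩) (hcS s hs)
    · left
      rw [k2, hb] at h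
      refine ReflTransGen.head (b := (x, p)) ⟨Finset.mem_insert_self _ _,
        Finset.mem_insert_of_mem hpS, by rw [hrot]⟩ ?_
      rcases R.fan s hs p hpS y' _ hy' hpx h.symm with h1 | h1
      · rcases ReflTransGen.cases_tail h1 with h2 | ⟨g, -, h2, -, h3⟩
        · rw [h2]
        · have h4 : x = g.2 := congrArg Prod.fst h3
          exact absurd (h4 ▸ h2) hxS
      · exact hmono h1
  have hinjx : ∀ y y', D.graph.Adj x y → D.graph.Adj x y' → κ' x y = κ' x y' → y = y' := by
    intro y y' hy hy' h
    rcases hnb y hy with rfl | rfl | rfl <;> rcases hnb y' hy' with rfl | rfl | rfl <;>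
      simp only [k0, k1, k2] at h
    exacts [rfl, absurd h.symm hca, absurd h hab, absurd h hca, rfl, absurd h hcb,
      absurd h.symm hab, absurd h.symm hcb, rfl]
  -- The polygon edge `ab` is replaced by `ac` and `cb`.
  refine ⟨κ', ((y₁ :: y₂ :: l : List V) : Cycle V), ?_⟩
  constructor
  case root_mem => exact Finset.mem_insert_of_mem R.root_mem
  case nonterminal =>
    intro s hs
    rw [Finset.mem_insert] at hs
    rcases hs with rfl | hs
    exacts [hxt, R.nonterminal s hs]
  case parent_mem =>
    intro s hs hsr
    rw [Finset.mem_insert] at hs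
    rcases hs with rfl | hs
    · rw [← hp]; exact Finset.mem_insert_of_mem hpS
    · exact Finset.mem_insert_of_mem (R.parent_mem s hs hsr)
  case mem_cycle =>
    intro z
    rw [hmem]
    constructor
    · rintro (rfl | rfl | hz)
      · simp [hyS₁, hyx₁, hpar₁]
      · simp [hyS₂, hyx₂, hpar₂]
      · simp [hlS hz, hlx hz]
    · rintro ⟨hz, hpz⟩
      simp only [Finset.mem_insert, not_or] at hz
      have hzr : z ≠ r := by rintro rfl; exact hz.2 R.root_mem
      rcases Finset.mem_insert.1 hpz with h1 | h1
      · have h2 := hspec hzr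
        rw [h1] at h2
        rcases hnb z h2 with rfl | rfl | rfl
        · exact absurd hpS hz.2
        · simp
        · simp
      · have := (R.mem_cycle z).2 ⟨hz.2, h1⟩
        simp only [Cycle.mem_coe_iff, List.mem_cons, hz.1, false_or] at this
        exact Or.inr (Or.inr this)
  case nodup =>
    rw [Cycle.nodup_coe_iff, List.nodup_cons, List.nodup_cons]
    refine ⟨?_, fun h => hyZ₂ (hlZ h), hnd.2⟩
    simp only [List.mem_cons, not_or]
    exact ⟨hne₃.symm, fun h => hyZ₁ (hlZ h)⟩
  case length =>
    have := R.length
    simp only [Cycle.length_coe, List.length_cons] at this ⊢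
    omega
  case chain =>
    have hch := R.chain
    rw [Cycle.chain_coe_cons, List.isChain_cons, List.isChain_append] at hch
    rw [Cycle.chain_coe_cons, List.cons_append, List.isChain_cons_cons, e1, s2, List.isChain_cons,
      List.isChain_append]
    obtain ⟨h1, h2, -, h3⟩ := hch
    refine ⟨rfl, ?_, ?_, by simp, ?_⟩
    · intro w hw
      cases l with
      | nil =>
        obtain rfl : y₁ = w := by simpa using hw
        have := h1 x (by simp)
        rw [hex, hsx] at this
        rw [e2, s1, this]
      | cons u l =>
        obtain rfl : u = w := by simpa using hw
        rw [e2, hsl (by simp), ← hex]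
        exact h1 u (by simp)
    · refine h2.imp_of_mem_imp ?_
      intro u v hu hv huv
      rw [hel hu, hsl hv]; exact huv
    · intro u hu w hw
      obtain rfl : y₁ = w := by simpa using hw
      rw [hel (List.mem_of_mem_getLast? hu), s1, ← hsx]
      exact h3 u hu x (by simp)
  case start_inj =>
    intro z hz z' hz' h
    rw [hmem] at hz hz'
    rcases hz with rfl | rfl | hz <;> rcases hz' with rfl | rfl | hz'
    · rfl
    · rw [s1, s2] at h; exact absurd h.symm hca
    · rw [s1, hsl hz'] at h; exact absurd h.symm (hsla hz')
    · rw [s1, s2] at h; exact absurd h hca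
    · rfl
    · rw [s2, hsl hz'] at h; exact absurd h.symm (hslc hz')
    · rw [s1, hsl hz] at h; exact absurd h (hsla hz)
    · rw [s2, hsl hz] at h; exact absurd h (hslc hz)
    · rw [hsl hz, hsl hz'] at h; exact R.start_inj z (hlZ hz) z' (hlZ hz') h
  case exists_start =>
    have key : ∀ s ∈ S, ∀ q ∈ D.corners κ s, ∃ z ∈ ((y₁ :: y₂ :: l : List V) : Cycle V),
        D.edgeStart r κ' z = q := by
      intro s hs q hq
      obtain ⟨z, hz, rfl⟩ := R.exists_start s hs q hq
      have hz' : z = x ∨ z ∈ l := by simpa using hz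
      rcases hz' with rfl | hz'
      · exact ⟨y₁, by simp, s1.trans hsx.symm⟩
      · exact ⟨z, by simp [hz'], hsl hz'⟩
    intro s hs q hq
    rw [Finset.mem_insert] at hs
    rcases hs with rfl | hs
    · rw [cx] at hq
      simp only [Finset.mem_insert, Finset.mem_singleton] at hq
      rcases hq with rfl | rfl | rfl
      · exact key p hpS _ hap
      · exact key p hpS _ hbp
      · exact ⟨y₂, by simp, s2⟩
    · rw [cS hs] at hq
      exact key s hs q hq
  case pos => exact pos'
  case compat => exact compat'
  case fan =>
    intro s hs s' hs' y y' hy hy' h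
    rw [Finset.mem_insert] at hs hs'
    rcases hs with rfl | hs <;> rcases hs' with rfl | hs'
    · rw [hinjx y y' hy hy' h]; exact Or.inl .refl
    · rw [kS hs'] at h
      exact fan' s' hs' y y' hy hy' h
    · rw [kS hs] at h
      exact (fan' s hs y' y hy' hy h.symm).symm
    · rw [kS hs, kS hs'] at h
      exact (R.fan s hs s' hs' y y' hy hy' h).imp hmono hmono
  case convex =>
    intro f e hf hfa hfe
    have hself : 0 < orient (κ' f.2 f.1) (κ' f.2 (D.rot f.2 f.1))
        (κ' f.2 (D.rot f.2 (D.rot f.2 f.1))) := pos' f.2 hf f.1 hfa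
    rcases Finset.mem_insert.1 hf with hfx | hfS
    · rcases ReflTransGen.cases_head hfe with rfl | ⟨g, hg, hge⟩
      · exact hself
      obtain ⟨u, v⟩ := f
      obtain rfl : v = x := hfx
      dsimp only at hfa hself ⊢
      rcases hnb u hfa with rfl | rfl | rfl
      · exact absurd hg.1 (hnoturn g)
      · have : g.2 = y₂ := by rw [hg.1.2.2, hy₂]
        have h2 := hg.1.2.1
        rw [this] at h2
        exact absurd h2 (by simp [hyS₂, hyx₂])
      -- The fan at `b`, starting with the new triangle. The step into `p` is not forward, so the
      -- pair is reflex at `a`. The left leg `ba` of the old fan becomes `bc`, and `c` was chosen so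
      -- that this changes no sign.
      · have hgp : g = (v, p) := by rw [hg.1.2.2]; exact Prod.ext rfl hrot
        subst hgp
        have hdir : D.Dir p v := ((hD.dir p v hpx).2 ⟨R.nonterminal p hpS, hxt⟩).resolve_right hg.2
        rw [k2, hrot, ← hy₁, k1]
        rcases hwalk (v, p) e hpx hpS hge with ⟨h1, h2, h3⟩ | ⟨-, -, h3⟩
        · rw [kS h1]
          have h4 := R.convex (v, p) e hpS hpx h3
          simp only [← ha, ← hb] at h4
          have h5 := (hcdir hdir).2 e.2 h1 (κ e.2 (D.rot e.2 e.1))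
            (PlaneTree.mem_corners.2 ⟨_, PlaneTree.adj_rot h2, rfl⟩)
            (by rw [orient_swap]; linarith)
          rw [orient_swap]; linarith
        · have := (R.reach_corner hD (d := (v, p)) hpx (ReflTransGen.mono (fun _ _ h => h.1) _ _ h3)).2
          exact absurd (ha.trans (this.trans hb.symm)) hab
    · rw [kS hfS]
      rcases hwalk f e hfa hfS hfe with ⟨h1, h2, h3⟩ | ⟨rfl, hdir, h3⟩
      · rw [kS h1]
        exact R.convex f e hfS hfa h3
      -- The fan at `a`, ending with the new triangle. Now the pair is reflex at `b`, and replacing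
      -- the right leg `ab` by `ac` preserves the sign.
      · have hdir' : D.Dir x p := ((hD.dir p x hpx).2 ⟨R.nonterminal p hpS, hxt⟩).resolve_left hdir
        have h4 := R.convex f _ hfS hfa h3
        have h5 := (R.reach_corner hD hfa (ReflTransGen.mono (fun _ _ h => h.1) _ _ h3)).2
        simp only [← ha] at h5
        simp only [hrotp, ← hb, ← h5] at h4
        dsimp only
        rw [← hy₁, k1, ← h5]
        exact (hcdir' hdir').2 f.2 hfS _ (PlaneTree.mem_corners.2
          ⟨_, PlaneTree.adj_rot (PlaneTree.adj_rot hfa), rfl⟩) h4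
  case reflex =>
    intro s hs s' hs' hdir
    have hadj := D.dir_adj _ _ hdir
    rw [Finset.mem_insert] at hs hs'
    rcases hs with rfl | hs <;> rcases hs' with rfl | hs'
    · exact absurd hadj (D.graph.loopless.irrefl _)
    · obtain rfl := hold s' hs' hadj.symm
      rw [← hy₁, ← hy₂, k1, k2, kS hs', ← hd]
      exact (hcdir' hdir).1
    · obtain rfl := hold s hs hadj
      rw [← hy₁, k1, kS hs, ← hd, ← ha]
      exact (hcdir hdir).1
    · rw [kS hs, kS hs']
      exact R.reflex s hs s' hs' hdir
  case adj_of_share =>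
    have key : ∀ s ∈ S, ∀ q q', q ≠ q' → q ∈ D.corners κ' x → q ∈ D.corners κ s →
        q' ∈ D.corners κ' x → q' ∈ D.corners κ s → D.graph.Adj s x := by
      intro s hs q q' hqq hq hqs hq' hqs'
      rw [cx] at hq hq'
      have hqc : q ≠ c := by rintro rfl; exact hcS s hs hqs
      have hqc' : q' ≠ c := by rintro rfl; exact hcS s hs hqs'
      simp only [Finset.mem_insert, Finset.mem_singleton, hqc, hqc', or_false] at hq hq'
      have : a ∈ D.corners κ s ∧ b ∈ D.corners κ s := by
        rcases hq with hq | hq <;> rcases hq' with hq' | hq'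
        exacts [absurd (hq.trans hq'.symm) hqq, ⟨hq ▸ hqs, hq' ▸ hqs'⟩, ⟨hq' ▸ hqs', hq ▸ hqs⟩,
          absurd (hq.trans hq'.symm) hqq]
      have h1 := R.eq_parent_of_share x hxZ s hs (by rw [hsx]; exact this.1)
        (by rw [hex]; exact this.2)
      rwa [h1, ← hp]
    intro s hs s' hs' hss q q' hqq h1 h2 h3 h4
    rw [Finset.mem_insert] at hs hs'
    rcases hs with rfl | hs <;> rcases hs' with rfl | hs'
    · exact absurd rfl hss
    · rw [cS hs'] at h2 h4
      exact (key s' hs' q q' hqq h1 h2 h3 h4).symm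
    · rw [cS hs] at h1 h3
      exact key s hs q q' hqq h2 h1 h4 h3
    · rw [cS hs] at h1 h3
      rw [cS hs'] at h2 h4
      exact R.adj_of_share s hs s' hs' hss q q' hqq h1 h2 h3 h4
  case eq_parent_of_share =>
    have hc' : ∀ s ∈ insert x S, c ∈ D.corners κ' s → s = x := by
      intro s hs h
      rw [Finset.mem_insert] at hs
      rcases hs with rfl | hs
      · rfl
      · rw [cS hs] at h
        exact absurd h (hcS s hs)
    intro z hz s hs h1 h2
    rw [hmem] at hz
    rcases hz with rfl | rfl | hz
    · rw [hpar₁]; exact hc' s hs (e1 ▸ h2)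
    · rw [hpar₂]; exact hc' s hs (s2 ▸ h1)
    · rw [hsl hz] at h1
      rw [hel hz] at h2
      rw [Finset.mem_insert] at hs
      rcases hs with rfl | hs
      -- The only possibility left is an old edge from `b` to `a`. Its triangle has the edge `ab`,
      -- so it is that of `p`, where two different edges would have the same ends.
      · exfalso
        rw [cx] at h1 h2
        simp only [Finset.mem_insert, Finset.mem_singleton, hsla hz, hslc hz, helc hz, or_false,
          false_or] at h1 h2
        have h3 : D.edgeEnd r κ z = a := h2.resolve_right fun h =>
          R.edgeStart_ne_edgeEnd hD (hlZ hz) (h1.trans h.symm)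
        have h4 := R.eq_parent_of_share s hxZ _ (hlS hz).2
          (by rw [hsx, ← h3]; exact R.edgeEnd_mem_corners (hlZ hz))
          (by rw [hex, ← h1]; exact R.edgeStart_mem_corners (hlZ hz))
        rw [← hp] at h4
        have hzr : z ≠ r := by rintro rfl; exact (hlS hz).1 R.root_mem
        have h5 := hspec hzr
        rw [h4] at h5
        rw [PlaneTree.edgeEnd, h4, ha] at h3
        rw [PlaneTree.edgeStart, h4, hb] at h1
        have h6 := R.corner_inj hD hpS h5 hapx' h3
        have h7 := R.corner_inj hD hpS (PlaneTree.adj_rot (PlaneTree.adj_rot h5)) hpx h1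
        rw [h6, hrotp] at h7
        exact (PlaneTree.rot_cube hD.deg (R.nonterminal p hpS) hpx).2.1 h7
      · rw [cS hs] at h1 h2
        exact R.eq_parent_of_share z (hlZ hz) s hs h1 h2
  case corners_inj =>
    have key : ∀ s ∈ S, D.corners κ s ≠ D.corners κ' x := by
      intro s hs h
      exact hcS s hs (by rw [h, cx]; simp)
    intro s hs s' hs' h
    rw [Finset.mem_insert] at hs hs'
    rcases hs with rfl | hs <;> rcases hs' with rfl | hs'
    · rfl
    · rw [cS hs'] at h; exact absurd h.symm (key s' hs')
    · rw [cS hs] at h; exact absurd h (key s hs)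
    · rw [cS hs, cS hs'] at h
      exact R.corners_inj s hs s' hs' h
  case complex =>
    have himage : (insert x S).image (D.corners κ') = insert {a, b, c} (S.image (D.corners κ)) := by
      rw [Finset.image_insert, cx]
      congr 1
      exact Finset.image_congr fun s hs => cS hs
    rw [himage]
    have hsub (z : V) (hz : z = y₁ ∨ z = y₂ ∨ z ∈ l) :
        segment ℝ (D.edgeStart r κ' z) (D.edgeEnd r κ' z) ⊆
          ⋃ z ∈ {z | z ∈ ((y₁ :: y₂ :: l : List V) : Cycle V)},
            segment ℝ (D.edgeStart r κ' z) (D.edgeEnd r κ' z) :=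
      Set.subset_biUnion_of_mem (u := fun z => segment ℝ (D.edgeStart r κ' z) (D.edgeEnd r κ' z))
        ((hmem z).2 hz)
    refine hcomplex _ ?_ ?_ ?_
    · have := hsub y₁ (by simp)
      rwa [s1, e1] at this
    · have := hsub y₂ (by simp)
      rwa [s2, e2] at this
    · refine Set.iUnion₂_subset fun z hz => ?_
      have hz' : z = x ∨ z ∈ l := by simpa using hz
      rcases hz' with rfl | hz'
      · rw [hsx, hex]; exact Set.subset_union_right
      · have := hsub z (by simp [hz'])
        rw [hsl hz', hel hz'] at this
        exact this.trans Set.subset_union_left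

end PartiallyDirectedPlaneTree.Realization

/-! ### Realizing the whole tree. -/

namespace PartiallyDirectedPlaneTree

variable {V : Type*} [Finite V] {D : PartiallyDirectedPlaneTree V}

/-- The node `r` alone is realized by a triangle. -/
theorem IsLegal.exists_realization_singleton (hD : D.IsLegal) {r : V} (hr : ¬ D.IsTerminal r) :
    ∃ κ Z, D.Realization r {r} κ Z := by
  classical
  obtain ⟨y₀, h₀⟩ : (D.graph.neighborSet r).Nonempty := by
    refine Set.nonempty_of_ncard_ne_zero ?_
    rw [show (D.graph.neighborSet r).ncard = 3 from hD.deg r hr]; norm_num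
  replace h₀ : D.graph.Adj r y₀ := h₀
  obtain ⟨y₁, hy₁⟩ : ∃ y, y = D.rot r y₀ := ⟨_, rfl⟩
  obtain ⟨y₂, hy₂⟩ : ∃ y, y = D.rot r y₁ := ⟨_, rfl⟩
  obtain ⟨hrot, hne₁, hne₂, hnb⟩ := PlaneTree.rot_cube hD.deg hr h₀
  have hne₃ := (PlaneTree.rot_cube hD.deg hr (PlaneTree.adj_rot h₀)).2.1
  simp only [← hy₁, ← hy₂] at hrot hne₁ hne₂ hnb hne₃
  have h₁ : D.graph.Adj r y₁ := by rw [hy₁]; exact PlaneTree.adj_rot h₀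
  have h₂ : D.graph.Adj r y₂ := by rw [hy₂]; exact PlaneTree.adj_rot h₁
  obtain ⟨κ, hκ⟩ : ∃ κ : V → V → ℝ × ℝ, κ = fun _ z =>
    -- The default value is the corner for `y₂`.
    if z = y₀ then (0, 0) else if z = y₁ then (1, 0) else (0, 1) := ⟨_, rfl⟩
  have k0 : κ r y₀ = (0, 0) := by simp [hκ]
  have k1 : κ r y₁ = (1, 0) := by simp [hκ, hne₁]
  have k2 : κ r y₂ = (0, 1) := by simp [hκ, hne₂, hne₃]
  have hpar {z : V} (hz : D.graph.Adj r z) : D.isTree.parent r z = r := by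
    rcases D.isTree.eq_parent_or r hz with h | h
    · exact h.1.symm
    · exact absurd rfl h.2.1
  have s0 : D.edgeStart r κ y₀ = (0, 1) := by rw [PlaneTree.edgeStart, hpar h₀, ← hy₁, ← hy₂, k2]
  have s1 : D.edgeStart r κ y₁ = (0, 0) := by rw [PlaneTree.edgeStart, hpar h₁, ← hy₂, hrot, k0]
  have s2 : D.edgeStart r κ y₂ = (1, 0) := by rw [PlaneTree.edgeStart, hpar h₂, hrot, ← hy₁, k1]
  have e0 : D.edgeEnd r κ y₀ = (0, 0) := by rw [PlaneTree.edgeEnd, hpar h₀, k0]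
  have e1 : D.edgeEnd r κ y₁ = (1, 0) := by rw [PlaneTree.edgeEnd, hpar h₁, k1]
  have e2 : D.edgeEnd r κ y₂ = (0, 1) := by rw [PlaneTree.edgeEnd, hpar h₂, k2]
  have hc : D.corners κ r = {(0, 0), (1, 0), (0, 1)} := by
    rw [PlaneTree.corners_eq hD.deg hr h₀, ← hy₁, ← hy₂, k0, k1, k2]
  have hmem (z : V) : z ∈ (([y₀, y₁, y₂] : List V) : Cycle V) ↔ z = y₀ ∨ z = y₁ ∨ z = y₂ := by
    simp
  have hadj {z : V} (hz : z ∈ (([y₀, y₁, y₂] : List V) : Cycle V)) : D.graph.Adj r z := by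
    rcases (hmem z).1 hz with rfl | rfl | rfl <;> assumption
  have hpos : 0 < orient (0, 0) (1, 0) (0, 1) := by norm_num [orient]
  have pos : ∀ y, D.graph.Adj r y →
      0 < orient (κ r y) (κ r (D.rot r y)) (κ r (D.rot r (D.rot r y))) := by
    intro y hy
    rcases hnb y hy with rfl | rfl | rfl
    · rwa [← hy₁, ← hy₂, k0, k1, k2]
    · rw [← hy₂, hrot, k0, k1, k2, orient_rotate]; exact hpos
    · rw [hrot, ← hy₁, k0, k1, k2, ← orient_rotate]; exact hpos
  have hone {s : V} (hs : s ∈ ({r} : Finset V)) : s = r := Finset.mem_singleton.1 hs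
  refine ⟨κ, (([y₀, y₁, y₂] : List V) : Cycle V), ?_⟩
  constructor
  case root_mem => simp
  case nonterminal =>
    intro s hs
    rwa [hone hs]
  case parent_mem => exact fun s hs hsr => absurd (hone hs) hsr
  case mem_cycle =>
    intro z
    simp only [Finset.mem_singleton]
    refine ⟨fun hz => ⟨(hadj hz).ne', hpar (hadj hz)⟩, fun hz => ?_⟩
    have := (D.isTree.parent_spec hz.1).1
    rw [hz.2] at this
    exact (hmem z).2 (hnb z this)
  case nodup => simp [hne₁.symm, hne₂.symm, hne₃.symm]
  case length => simp
  case chain => simp [e0, e1, e2, s0, s1, s2]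
  case start_inj =>
    intro z hz z' hz' h
    rcases (hmem z).1 hz with rfl | rfl | rfl <;> rcases (hmem z').1 hz' with rfl | rfl | rfl <;>
      first | rfl | (simp [s0, s1, s2] at h)
  case exists_start =>
    intro s hs q hq
    rw [hone hs, hc] at hq
    simp only [Finset.mem_insert, Finset.mem_singleton] at hq
    rcases hq with rfl | rfl | rfl
    exacts [⟨y₁, by simp, s1⟩, ⟨y₂, by simp, s2⟩, ⟨y₀, by simp, s0⟩]
  case pos =>
    intro s hs
    rw [hone hs]
    exact pos
  case compat =>
    intro s hs s' hs' h
    rw [hone hs, hone hs'] at h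
    exact absurd h (D.graph.loopless.irrefl _)
  case fan =>
    intro s hs s' hs' y y' hy hy' h
    rw [hone hs] at *
    rw [hone hs'] at *
    left
    have : y = y' := by
      rcases hnb y hy with rfl | rfl | rfl <;> rcases hnb y' hy' with rfl | rfl | rfl <;>
        first | rfl | (simp [k0, k1, k2] at h)
    rw [this]
  case convex =>
    rintro ⟨u, v⟩ e hf hfa hfe
    obtain rfl := hone hf
    rcases ReflTransGen.cases_head hfe with rfl | ⟨g, ⟨⟨-, h2, h3⟩, -⟩, -⟩
    · exact pos u hfa
    · have h4 : D.rot v u = v := by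
        have := hone h2
        rwa [h3] at this
      have h5 := PlaneTree.adj_rot hfa
      simp only [h4] at h5
      exact absurd h5 (D.graph.loopless.irrefl _)
  case reflex =>
    intro s hs s' hs' h
    have := D.dir_adj _ _ h
    rw [hone hs, hone hs'] at this
    exact absurd this (D.graph.loopless.irrefl _)
  case adj_of_share => exact fun s hs s' hs' h => absurd ((hone hs).trans (hone hs').symm) h
  case eq_parent_of_share => exact fun z hz s hs _ _ => (hone hs).trans (hpar (hadj hz)).symm
  case corners_inj => exact fun s hs s' hs' _ => (hone hs).trans (hone hs').symm
  case complex =>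
    rw [Finset.image_singleton, hc]
    have hsub (z : V) (hz : z = y₀ ∨ z = y₁ ∨ z = y₂) :
        segment ℝ (D.edgeStart r κ z) (D.edgeEnd r κ z) ⊆
          ⋃ z ∈ {z | z ∈ (([y₀, y₁, y₂] : List V) : Cycle V)},
            segment ℝ (D.edgeStart r κ z) (D.edgeEnd r κ z) :=
      Set.subset_biUnion_of_mem (u := fun z => segment ℝ (D.edgeStart r κ z) (D.edgeEnd r κ z))
        ((hmem z).2 hz)
    refine isDeflatedComplex_singleton ?_ ?_ ?_
    · have := hsub y₁ (by simp)
      rwa [s1, e1] at this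
    · have := hsub y₂ (by simp)
      rwa [s2, e2] at this
    · have := hsub y₀ (by simp)
      rwa [s0, e0] at this

/-- Induction on the distance from the root. A node below a node of `Z` would give that terminal
node a second neighbour besides its parent. -/
theorem Realization.mem_or_mem {r : V} {S : Finset V} {κ : V → V → ℝ × ℝ} {Z : Cycle V}
    (R : D.Realization r S κ Z) (hZ : ∀ z ∈ Z, D.IsTerminal z) (v : V) : v ∈ S ∨ v ∈ Z := by
  induction h : D.graph.dist r v using Nat.strong_induction_on generalizing v with
  | _ n ih =>
    by_cases hv : v = r
    · rw [hv]; exact Or.inl R.root_mem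
    obtain ⟨hadj, hlt⟩ := D.isTree.parent_spec hv
    rcases ih _ (h ▸ hlt) (D.isTree.parent r v) rfl with h1 | h1
    · by_cases hvS : v ∈ S
      · exact Or.inl hvS
      · exact Or.inr ((R.mem_cycle v).2 ⟨hvS, h1⟩)
    · exfalso
      set u := D.isTree.parent r v
      have hur : u ≠ r := by
        intro h2
        exact ((R.mem_cycle u).1 h1).1 (h2 ▸ R.root_mem)
      obtain ⟨hadj', hlt'⟩ := D.isTree.parent_spec hur
      obtain ⟨w, hw⟩ := Set.ncard_eq_one.1 (show (D.graph.neighborSet u).ncard = 1 from hZ u h1)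
      have h2 : v ∈ D.graph.neighborSet u := hadj
      have h3 : D.isTree.parent r u ∈ D.graph.neighborSet u := hadj'.symm
      rw [hw, Set.mem_singleton_iff] at h2 h3
      rw [h3, ← h2] at hlt'
      omega

/-- The whole tree has a realization. -/
theorem IsLegal.exists_realization (hD : D.IsLegal) {r : V} (hr : ¬ D.IsTerminal r) :
    ∃ S κ Z, D.Realization r S κ Z ∧ ∀ z ∈ Z, D.IsTerminal z := by
  classical
  have := Fintype.ofFinite V
  have key : ∀ (n : ℕ) (S : Finset V) (κ : V → V → ℝ × ℝ) (Z : Cycle V), D.Realization r S κ Z →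
      Fintype.card V - S.card = n → ∃ S κ Z, D.Realization r S κ Z ∧ ∀ z ∈ Z, D.IsTerminal z := by
    intro n
    induction n using Nat.strong_induction_on with
    | _ n ih =>
      intro S κ Z R hn
      by_cases h : ∀ z ∈ Z, D.IsTerminal z
      · exact ⟨S, κ, Z, R, h⟩
      · push Not at h
        obtain ⟨x, hx, hxt⟩ := h
        obtain ⟨κ', Z', R'⟩ := R.exists_extend hD hx hxt
        have h1 := Finset.card_insert_of_notMem ((R.mem_cycle x).1 hx).1
        have h2 := Finset.card_le_univ (insert x S)
        exact ih _ (by omega) _ κ' Z' R' rfl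
  obtain ⟨κ, Z, R⟩ := hD.exists_realization_singleton hr
  exact key _ _ _ _ R rfl

end PartiallyDirectedPlaneTree

/-! ### Hulls without interior and cyclic indices. -/

theorem interior_segment_eq_empty {a b : ℝ × ℝ} (hab : a ≠ b) : interior (segment ℝ a b) = ∅ := by
  rw [Set.eq_empty_iff_forall_notMem]
  intro z hz
  -- A displacement perpendicular to `ab` leaves the line.
  have hcont : Continuous fun e : ℝ => ((z.1 - e * (b.2 - a.2), z.2 + e * (b.1 - a.1)) : ℝ × ℝ) := by
    fun_prop
  have h1 : ∀ᶠ e in nhdsWithin (0 : ℝ) (Set.Ioi 0),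
      ((z.1 - e * (b.2 - a.2), z.2 + e * (b.1 - a.1)) : ℝ × ℝ) ∈ interior (segment ℝ a b) :=
    nhdsWithin_le_nhds (hcont.continuousAt.preimage_mem_nhds
      (isOpen_interior.mem_nhds (by simpa using hz)))
  obtain ⟨e, he, he0⟩ := (h1.and self_mem_nhdsWithin).exists
  have h2 := orient_eq_zero_of_mem_segment (interior_subset he)
  have h3 := orient_eq_zero_of_mem_segment (interior_subset hz)
  have he0' : e ≠ 0 := ne_of_gt he0
  have h4 : e * ((b.1 - a.1) ^ 2 + (b.2 - a.2) ^ 2) = 0 := by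
    unfold orient at h2 h3
    linear_combination h2 - h3
  have h5 : (b.1 - a.1) ^ 2 + (b.2 - a.2) ^ 2 = 0 := by simpa [he0'] using h4
  have h6 : b.1 - a.1 = 0 := by nlinarith [sq_nonneg (b.1 - a.1), sq_nonneg (b.2 - a.2)]
  have h7 : b.2 - a.2 = 0 := by nlinarith [sq_nonneg (b.1 - a.1), sq_nonneg (b.2 - a.2)]
  exact hab (Prod.ext (by linarith) (by linarith))

/-- A triangle minus a vertex has no interior. -/
theorem interior_convexHull_eq_empty {a b c : ℝ × ℝ} (h : 0 < orient a b c) {s : Set (ℝ × ℝ)}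
    (hs : s ⊆ {a, b, c}) (hne : s ≠ {a, b, c}) : interior (convexHull ℝ s) = ∅ := by
  have hab : a ≠ b := by rintro rfl; simp [orient_self_left] at h
  have hbc : b ≠ c := by rintro rfl; simp [orient_self_right] at h
  have hac : a ≠ c := by rintro rfl; simp [orient_self_outer] at h
  have key : ∀ p q : ℝ × ℝ, p ≠ q → s ⊆ {p, q} → interior (convexHull ℝ s) = ∅ := by
    intro p q hpq hsub
    rw [← Set.subset_empty_iff, ← interior_segment_eq_empty hpq, ← convexHull_pair]
    exact interior_mono (convexHull_mono hsub)
  by_cases ha : a ∈ s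
  · by_cases hb : b ∈ s
    · by_cases hc : c ∈ s
      · refine absurd (hs.antisymm ?_) hne
        rintro x (rfl | rfl | rfl) <;> assumption
      · refine key a b hab fun x hx => ?_
        rcases hs hx with rfl | rfl | rfl
        exacts [by simp, by simp, absurd hx hc]
    · refine key a c hac fun x hx => ?_
      rcases hs hx with rfl | rfl | rfl
      exacts [by simp, absurd hx hb, by simp]
  · refine key b c hbc fun x hx => ?_
    rcases hs hx with rfl | rfl | rfl
    exacts [absurd hx ha, by simp, by simp]

/-- The enumeration of a cycle by an initial segment of the naturals, with addition modulo its
length as successor. -/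
theorem Cycle.exists_enum {α : Type*} {Z : Cycle α} (hn : Z.Nodup) (h3 : 3 ≤ Z.length)
    {r : α → α → Prop} (hc : Z.Chain r) :
    ∃ (m : ℕ) (z : Fin (m + 3) → α), Function.Injective z ∧ (∀ v, v ∈ Z ↔ ∃ i, z i = v) ∧
      ∀ i, r (z i) (z (i + 1)) := by
  induction Z using Quotient.inductionOn with
  | h L =>
    change 3 ≤ L.length at h3
    replace hn : L.Nodup := hn
    cases L with
    | nil => simp at h3
    | cons a l =>
      obtain ⟨m, hm⟩ := Nat.exists_eq_add_of_le' h3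
      replace hc : Cycle.Chain r ((a :: l : List α) : Cycle α) := hc
      rw [Cycle.chain_coe_cons, List.isChain_iff_getElem] at hc
      simp only [List.length_cons] at hm
      refine ⟨m, fun i => (a :: l)[i.1]'(by simp; omega), ?_, ?_, ?_⟩
      · intro i j hij
        exact Fin.ext ((hn.getElem_inj_iff).1 hij)
      · intro v
        change v ∈ a :: l ↔ _
        rw [List.mem_iff_getElem]
        constructor
        · rintro ⟨i, hi, rfl⟩
          exact ⟨⟨i, by simp at hi; omega⟩, rfl⟩
        · rintro ⟨i, rfl⟩
          exact ⟨i.1, by simp; omega, rfl⟩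
      · intro i
        have h1 := hc i.1 (by simp; omega)
        -- The chain condition concerns the list `a :: (l ++ [a])`, whose final `a` corresponds to
        -- the index `0` that follows the last one.
        by_cases hi : i.1 + 1 < m + 3
        · have h2 : (i + 1).1 = i.1 + 1 := Fin.val_add_one_of_lt' hi
          simp only [h2]
          convert h1 using 1
          · rcases i with ⟨_ | i, h⟩
            · simp
            · simp only [List.getElem_cons_succ]
              rw [List.getElem_append_left]
          · simp only [List.getElem_cons_succ]
            rw [List.getElem_append_left]
        · have h2 : i = Fin.last _ := Fin.ext (by simp; omega)
          subst h2
          simp only [Fin.last_add_one, Fin.val_last, Fin.val_zero, List.getElem_cons_zero] at h1 ⊢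
          convert h1 using 1
          · simp only [List.getElem_cons_succ]
            rw [List.getElem_append_left]
          · simp only [List.getElem_cons_succ]
            rw [List.getElem_append_right (by omega)]
            simp

theorem Fin.add_one_add_one_ne {m : ℕ} (i : Fin (m + 3)) : i + 1 + 1 ≠ i := by
  intro h
  have h1 : i + (1 + 1) = i := by rw [← add_assoc]; exact h
  have h2 := add_eq_left.1 h1
  have h3 := congrArg Fin.val h2
  rw [Fin.val_add] at h3
  have : (1 : Fin (m + 3)).val = 1 := rfl
  rw [this] at h3
  simp only [Fin.val_zero] at h3
  rw [Nat.mod_eq_of_lt (by omega)] at h3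
  omega

/-! ### The simple polygon of a realization. -/

namespace PartiallyDirectedPlaneTree.Realization

variable {V : Type*} [Finite V] {D : PartiallyDirectedPlaneTree V} {r : V} {S : Finset V}
  {κ : V → V → ℝ × ℝ} {Z : Cycle V}

open Classical in
/-- The vertices of the triangle or polygon edge of a node. -/
noncomputable def points (D : PartiallyDirectedPlaneTree V) (r : V) (S : Finset V)
    (κ : V → V → ℝ × ℝ) (v : V) : Finset (ℝ × ℝ) :=
  if v ∈ S then D.corners κ v else {D.edgeStart r κ v, D.edgeEnd r κ v}

theorem points_of_mem {v : V} (hv : v ∈ S) : points D r S κ v = D.corners κ v := by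
  simp [points, hv]

theorem points_of_notMem {v : V} (hv : v ∉ S) :
    points D r S κ v = {D.edgeStart r κ v, D.edgeEnd r κ v} := by
  simp [points, hv]

theorem parent_eq_of_adj (R : D.Realization r S κ Z) {x y : V} (hx : x ∈ S) (hy : y ∉ S)
    (h : D.graph.Adj x y) : x = D.isTree.parent r y := by
  rcases D.isTree.eq_parent_or r h with h1 | h1
  · exact h1.1
  · exact absurd (h1.1 ▸ R.parent_mem x hx h1.2.1) hy

theorem corner_mem_points (R : D.Realization r S κ Z) {x y : V} (hx : x ∈ S)
    (h : D.graph.Adj x y) :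
    κ x y ∈ points D r S κ y ∧ κ x (D.rot x (D.rot x y)) ∈ points D r S κ y := by
  by_cases hy : y ∈ S
  · rw [points_of_mem hy, ← R.compat x hx y hy h, R.compat y hy x hx h.symm]
    exact ⟨PlaneTree.mem_corners.2 ⟨_, PlaneTree.adj_rot (PlaneTree.adj_rot h.symm), rfl⟩,
      PlaneTree.mem_corners.2 ⟨_, h.symm, rfl⟩⟩
  · rw [points_of_notMem hy, PlaneTree.edgeStart, PlaneTree.edgeEnd,
      ← R.parent_eq_of_adj hx hy h]
    simp

theorem corner_ne (R : D.Realization r S κ Z) (hD : D.IsLegal) {x y : V} (hx : x ∈ S)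
    (h : D.graph.Adj x y) : κ x y ≠ κ x (D.rot x y) ∧ κ x (D.rot x y) ≠ κ x (D.rot x (D.rot x y)) ∧
      κ x y ≠ κ x (D.rot x (D.rot x y)) := by
  have hc := PlaneTree.rot_cube hD.deg (R.nonterminal x hx) h
  have h1 := PlaneTree.adj_rot h
  have h2 := PlaneTree.adj_rot h1
  have hc' := PlaneTree.rot_cube hD.deg (R.nonterminal x hx) h1
  exact ⟨fun e => hc.2.1 (R.corner_inj hD hx h h1 e).symm,
    fun e => hc'.2.1 (R.corner_inj hD hx h1 h2 e).symm,
    fun e => hc.2.2.1 (R.corner_inj hD hx h h2 e).symm⟩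

theorem card_corners (R : D.Realization r S κ Z) (hD : D.IsLegal) {x y : V} (hx : x ∈ S)
    (h : D.graph.Adj x y) : (D.corners κ x).card = 3 := by
  have := R.corner_ne hD hx h
  rw [R.corners_eq hD hx h, Finset.card_eq_three]
  exact ⟨_, _, _, this.1, this.2.2, this.2.1, rfl⟩

/-- The triangle of `x` shares with its neighbour `y` only an edge. -/
theorem eq_or_eq_of_mem (R : D.Realization r S κ Z) (hD : D.IsLegal) {x y : V} (hx : x ∈ S)
    (h : D.graph.Adj x y) {q : ℝ × ℝ} (hq : q ∈ D.corners κ x) (hq' : q ∈ points D r S κ y) :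
    q = κ x y ∨ q = κ x (D.rot x (D.rot x y)) := by
  by_cases hy : y ∈ S
  · rw [points_of_mem hy] at hq'
    by_contra! hne
    have hq2 := hq
    rw [R.corners_eq hD hx h] at hq2
    simp only [Finset.mem_insert, Finset.mem_singleton, hne, false_or, or_false] at hq2
    have hm := R.corner_mem_points hx h
    rw [points_of_mem hy] at hm
    have hsub : D.corners κ x ⊆ D.corners κ y := by
      rw [R.corners_eq hD hx h]
      intro w hw
      simp only [Finset.mem_insert, Finset.mem_singleton] at hw
      rcases hw with rfl | rfl | rfl
      exacts [hm.1, hq2 ▸ hq', hm.2]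
    have heq := Finset.eq_of_subset_of_card_le hsub
      (by rw [R.card_corners hD hx h, R.card_corners hD hy h.symm])
    exact h.ne (R.corners_inj x hx y hy heq)
  · rw [points_of_notMem hy, PlaneTree.edgeStart, PlaneTree.edgeEnd,
      ← R.parent_eq_of_adj hx hy h] at hq'
    simp only [Finset.mem_insert, Finset.mem_singleton] at hq'
    exact hq'.symm

/-- The triangle of `x` shares just two vertices with `y`; the orientation decides in which order
they are listed. -/
theorem eq_of_listing (R : D.Realization r S κ Z) (hD : D.IsLegal) {x y : V} (hx : x ∈ S)
    (h : D.graph.Adj x y) {q₁ q₂ q₃ : ℝ × ℝ} (hq : D.corners κ x = {q₁, q₂, q₃})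
    (hpos : 0 < orient q₁ q₂ q₃) (h₁ : q₁ ∈ points D r S κ y) (h₂ : q₂ ∈ points D r S κ y) :
    q₁ = κ x (D.rot x (D.rot x y)) ∧ q₂ = κ x y ∧ q₃ = κ x (D.rot x y) := by
  have h12 : q₁ ≠ q₂ := by rintro rfl; simp [orient_self_left] at hpos
  have h23 : q₂ ≠ q₃ := by rintro rfl; simp [orient_self_right] at hpos
  have h13 : q₁ ≠ q₃ := by rintro rfl; simp [orient_self_outer] at hpos
  have e1 := R.eq_or_eq_of_mem hD hx h (by simp [hq]) h₁
  have e2 := R.eq_or_eq_of_mem hD hx h (by simp [hq]) h₂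
  have hq3 : q₃ ∈ D.corners κ x := by simp [hq]
  rw [R.corners_eq hD hx h] at hq3
  simp only [Finset.mem_insert, Finset.mem_singleton] at hq3
  have hp := R.pos x hx y h
  rcases e1 with rfl | rfl <;> rcases e2 with rfl | rfl
  · exact absurd rfl h12
  · have e3 : q₃ = κ x (D.rot x y) := by
      rcases hq3 with h3 | h3 | h3
      exacts [absurd h3.symm h13, h3, absurd h3.symm h23]
    rw [e3, orient_swap] at hpos
    linarith
  · exact ⟨rfl, rfl, by
      rcases hq3 with h3 | h3 | h3
      exacts [absurd h3.symm h23, h3, absurd h3.symm h13]⟩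
  · exact absurd rfl h12

section Polygon

variable {m : ℕ} {z : Fin (m + 3) → V}

/-- The polygon of a realization. -/
noncomputable def polygon (R : D.Realization r S κ Z)
    (hz : Function.Injective z) (hmem : ∀ v, v ∈ Z ↔ ∃ i, z i = v)
    (hnext : ∀ i, D.edgeEnd r κ (z i) = D.edgeStart r κ (z (i + 1))) : SimplePolygon m where
  vert i := D.edgeStart r κ (z i)
  vert_injective i j h := hz (R.start_inj _ ((hmem _).2 ⟨i, rfl⟩) _ ((hmem _).2 ⟨j, rfl⟩) h)
  simple := by
    have hinj : Function.Injective fun i => D.edgeStart r κ (z i) := fun i j h =>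
      hz (R.start_inj _ ((hmem _).2 ⟨i, rfl⟩) _ ((hmem _).2 ⟨j, rfl⟩) h)
    have hZ (i : Fin (m + 3)) : z i ∈ Z := (hmem _).2 ⟨i, rfl⟩
    intro i j hij w hw
    have hT (i : Fin (m + 3)) :
        D.corners κ (D.isTree.parent r (z i)) ∈ S.image (D.corners κ) :=
      Finset.mem_image_of_mem _ ((R.mem_cycle _).1 (hZ i)).2
    have hsub (i : Fin (m + 3)) : ({D.edgeStart r κ (z i), D.edgeStart r κ (z (i + 1))} :
        Finset (ℝ × ℝ)) ⊆ D.corners κ (D.isTree.parent r (z i)) := by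
      rw [← hnext]
      intro q hq
      simp only [Finset.mem_insert, Finset.mem_singleton] at hq
      rcases hq with rfl | rfl
      exacts [R.edgeStart_mem_corners (hZ i), R.edgeEnd_mem_corners (hZ i)]
    -- Polygon edges are faces of triangles, so two of them meet only in the hull of their common
    -- ends.
    have h1 := R.complex.inter_faces (hT i) (hT j) (hsub i) (hsub j)
      (a := w) (by simpa [convexHull_pair] using hw)
    have hv (q : ℝ × ℝ) (hq : q ∈ (({D.edgeStart r κ (z i), D.edgeStart r κ (z (i + 1))} :
        Finset (ℝ × ℝ)) : Set (ℝ × ℝ)) ∩ ({D.edgeStart r κ (z j), D.edgeStart r κ (z (j + 1))} :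
        Finset (ℝ × ℝ))) : (j = i + 1 ∧ q = D.edgeStart r κ (z j)) ∨
          (i = j + 1 ∧ q = D.edgeStart r κ (z i)) := by
      obtain ⟨hq1, hq2⟩ := hq
      simp only [Finset.coe_insert, Finset.coe_singleton, Set.mem_insert_iff,
        Set.mem_singleton_iff] at hq1 hq2
      rcases hq1 with rfl | rfl <;> rcases hq2 with h2 | h2 <;> have h3 := hinj h2
      · exact absurd h3 hij
      · exact Or.inr ⟨h3, rfl⟩
      · exact Or.inl ⟨h3.symm, h2⟩
      · exact absurd (add_right_cancel h3) hij
    by_cases hj : j = i + 1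
    · refine Or.inl ⟨hj, ?_⟩
      have : convexHull ℝ ((({D.edgeStart r κ (z i), D.edgeStart r κ (z (i + 1))} :
        Finset (ℝ × ℝ)) : Set (ℝ × ℝ)) ∩ ({D.edgeStart r κ (z j), D.edgeStart r κ (z (j + 1))} :
        Finset (ℝ × ℝ))) ⊆ convexHull ℝ {D.edgeStart r κ (z j)} := by
        refine convexHull_mono fun q hq => ?_
        rcases hv q hq with h | h
        · exact h.2
        · exact absurd h.1 (by rw [hj]; exact (Fin.add_one_add_one_ne i).symm)
      simpa using this h1
    · by_cases hi : i = j + 1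
      · refine Or.inr ⟨hi, ?_⟩
        have : convexHull ℝ ((({D.edgeStart r κ (z i), D.edgeStart r κ (z (i + 1))} :
          Finset (ℝ × ℝ)) : Set (ℝ × ℝ)) ∩ ({D.edgeStart r κ (z j), D.edgeStart r κ (z (j + 1))} :
          Finset (ℝ × ℝ))) ⊆ convexHull ℝ {D.edgeStart r κ (z i)} := by
          refine convexHull_mono fun q hq => ?_
          rcases hv q hq with h | h
          · exact absurd h.1 hj
          · exact h.2
        simpa using this h1
      · have : (({D.edgeStart r κ (z i), D.edgeStart r κ (z (i + 1))} :
          Finset (ℝ × ℝ)) : Set (ℝ × ℝ)) ∩ ({D.edgeStart r κ (z j), D.edgeStart r κ (z (j + 1))} :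
          Finset (ℝ × ℝ)) = ∅ := by
          rw [Set.eq_empty_iff_forall_notMem]
          intro q hq
          rcases hv q hq with h | h
          exacts [hj h.1, hi h.1]
        rw [this] at h1
        simp at h1

variable (R : D.Realization r S κ Z) (hz : Function.Injective z)
  (hmem : ∀ v, v ∈ Z ↔ ∃ i, z i = v)
  (hnext : ∀ i, D.edgeEnd r κ (z i) = D.edgeStart r κ (z (i + 1)))

theorem closedRegion_polygon :
    (R.polygon hz hmem hnext).closedRegion = region (S.image (D.corners κ)) := by
  have hb : (R.polygon hz hmem hnext).boundary =
      ⋃ z ∈ {z | z ∈ Z}, segment ℝ (D.edgeStart r κ z) (D.edgeEnd r κ z) := by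
    ext w
    simp only [SimplePolygon.boundary, polygon, Set.mem_iUnion, Set.mem_ofPred_eq, exists_prop,
      hmem, ← hnext]
    constructor
    · rintro ⟨i, hi⟩
      exact ⟨_, ⟨i, rfl⟩, hi⟩
    · rintro ⟨_, ⟨i, rfl⟩, hi⟩
      exact ⟨i, hi⟩
  refine SimplePolygon.closedRegion_eq_region (hb ▸ R.complex) ?_
  rw [hb]
  refine Set.iUnion₂_subset fun w hw => ?_
  exact R.complex.segment_subset (Finset.mem_image_of_mem _ ((R.mem_cycle w).1 hw).2)
    (R.edgeStart_mem_corners hw) (R.edgeEnd_mem_corners hw)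

/-- By `defl` visible pairs are edges of triangles. Two different ones meet in the hull of their
common ends, which is at most a single vertex, and no open segment contains its own end. -/
theorem isDeflated_polygon : (R.polygon hz hmem hnext).IsDeflated := by
  intro i j k l hij hkl hvis hvis' hne
  set P := R.polygon hz hmem hnext with hP
  have hcorner (i : Fin (m + 3)) : P.vert i ∈ D.corners κ (D.isTree.parent r (z i)) :=
    R.edgeStart_mem_corners ((hmem _).2 ⟨i, rfl⟩)
  have hT (i : Fin (m + 3)) :
      D.corners κ (D.isTree.parent r (z i)) ∈ S.image (D.corners κ) :=
    Finset.mem_image_of_mem _ ((R.mem_cycle _).1 ((hmem _).2 ⟨i, rfl⟩)).2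
  rw [SimplePolygon.Visible, R.closedRegion_polygon hz hmem hnext] at hvis hvis'
  obtain ⟨t, ht, hit, hjt⟩ := R.complex.defl _ (hT i) _ (hT j) _ (hcorner i) _ (hcorner j) hvis
  obtain ⟨t', ht', hkt, hlt⟩ := R.complex.defl _ (hT k) _ (hT l) _ (hcorner k) _ (hcorner l) hvis'
  rw [Set.disjoint_left]
  intro w hw hw'
  have h1 := R.complex.inter_faces ht ht' (F := {P.vert i, P.vert j}) (G := {P.vert k, P.vert l})
    (by intro q hq; simp only [Finset.mem_insert, Finset.mem_singleton] at hq
        rcases hq with rfl | rfl <;> assumption)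
    (by intro q hq; simp only [Finset.mem_insert, Finset.mem_singleton] at hq
        rcases hq with rfl | rfl <;> assumption)
    (a := w) (by
      simp only [Finset.coe_insert, Finset.coe_singleton, convexHull_pair]
      exact ⟨openSegment_subset_segment _ _ _ hw, openSegment_subset_segment _ _ _ hw'⟩)
  have hvij : P.vert i ≠ P.vert j := fun h => hij (P.vert_injective h)
  have hends : ¬ (P.vert i ∈ ({P.vert k, P.vert l} : Finset (ℝ × ℝ)) ∧
      P.vert j ∈ ({P.vert k, P.vert l} : Finset (ℝ × ℝ))) := by
    rintro ⟨h2, h3⟩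
    simp only [Finset.mem_insert, Finset.mem_singleton, P.vert_injective.eq_iff] at h2 h3
    refine hne (Sym2.eq_iff.2 ?_)
    rcases h2 with rfl | rfl <;> rcases h3 with rfl | rfl
    exacts [absurd rfl hij, Or.inl ⟨rfl, rfl⟩, Or.inr ⟨rfl, rfl⟩, absurd rfl hij]
  have key : ∀ p q : ℝ × ℝ, q ∉ ({P.vert k, P.vert l} : Finset (ℝ × ℝ)) →
      ({P.vert i, P.vert j} : Finset (ℝ × ℝ)) ⊆ {p, q} → w = p := by
    intro p q hq hsub
    have : convexHull ℝ ((({P.vert i, P.vert j} : Finset (ℝ × ℝ)) : Set (ℝ × ℝ)) ∩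
        ({P.vert k, P.vert l} : Finset (ℝ × ℝ))) ⊆ convexHull ℝ {p} := by
      refine convexHull_mono fun y hy => ?_
      have h4 := hsub hy.1
      simp only [Finset.mem_insert, Finset.mem_singleton] at h4
      rcases h4 with rfl | rfl
      · rfl
      · exact absurd hy.2 hq
    simpa using this h1
  by_cases h2 : P.vert i ∈ ({P.vert k, P.vert l} : Finset (ℝ × ℝ))
  · have h3 := key (P.vert i) (P.vert j) (fun h => hends ⟨h2, h⟩) subset_rfl
    rw [h3, left_mem_openSegment_iff] at hw
    exact hvij hw
  · have h3 := key (P.vert j) (P.vert i) h2 (by intro; simp; tauto)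
    rw [h3, right_mem_openSegment_iff] at hw
    exact hvij hw

end Polygon

end PartiallyDirectedPlaneTree.Realization

/-! ### The triangulation of the polygon and its directed dual. -/

namespace PartiallyDirectedPlaneTree.Realization

variable {V : Type*} [Finite V] {D : PartiallyDirectedPlaneTree V} {r : V} {S : Finset V}
  {κ : V → V → ℝ × ℝ} {Z : Cycle V} {m : ℕ} {z : Fin (m + 3) → V}

open Classical in
/-- The indices of the vertices of the triangle of `s`. -/
noncomputable def indices (D : PartiallyDirectedPlaneTree V) (r : V) (κ : V → V → ℝ × ℝ)
    (z : Fin (m + 3) → V) (s : V) : Finset (Fin (m + 3)) :=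
  Finset.univ.filter fun i => D.edgeStart r κ (z i) ∈ D.corners κ s

theorem mem_indices {s : V} {i : Fin (m + 3)} :
    i ∈ indices D r κ z s ↔ D.edgeStart r κ (z i) ∈ D.corners κ s := by
  simp [indices]

variable (R : D.Realization r S κ Z) (hz : Function.Injective z)
  (hmem : ∀ v, v ∈ Z ↔ ∃ i, z i = v)
  (hnext : ∀ i, D.edgeEnd r κ (z i) = D.edgeStart r κ (z (i + 1)))

theorem exists_index (R : D.Realization r S κ Z) (hmem : ∀ v, v ∈ Z ↔ ∃ i, z i = v) {s : V}
    (hs : s ∈ S) {q : ℝ × ℝ} (hq : q ∈ D.corners κ s) :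
    ∃ i, D.edgeStart r κ (z i) = q ∧ i ∈ indices D r κ z s := by
  obtain ⟨v, hv, rfl⟩ := R.exists_start s hs q hq
  obtain ⟨i, rfl⟩ := (hmem v).1 hv
  exact ⟨i, rfl, mem_indices.2 hq⟩

theorem image_indices (R : D.Realization r S κ Z) (hmem : ∀ v, v ∈ Z ↔ ∃ i, z i = v) {s : V}
    (hs : s ∈ S) : (fun i => D.edgeStart r κ (z i)) '' (indices D r κ z s : Set (Fin (m + 3))) =
      D.corners κ s := by
  ext q
  constructor
  · rintro ⟨i, hi, rfl⟩
    exact mem_indices.1 hi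
  · intro hq
    obtain ⟨i, rfl, hi⟩ := R.exists_index hmem hs hq
    exact ⟨i, hi, rfl⟩

theorem indices_inj (R : D.Realization r S κ Z) (hmem : ∀ v, v ∈ Z ↔ ∃ i, z i = v) {s s' : V}
    (hs : s ∈ S) (hs' : s' ∈ S) (h : indices D r κ z s = indices D r κ z s') : s = s' := by
  refine R.corners_inj s hs s' hs' ?_
  rw [← Finset.coe_inj, ← R.image_indices hmem hs, ← R.image_indices hmem hs', h]

theorem hull_indices {s : V} (hs : s ∈ S) :
    (R.polygon hz hmem hnext).hull (indices D r κ z s) =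
      convexHull ℝ (D.corners κ s : Set (ℝ × ℝ)) := by
  rw [← R.image_indices hmem hs]; rfl

theorem isCCWListing_iff {s : V} (hs : s ∈ S) {a b c : Fin (m + 3)} :
    (R.polygon hz hmem hnext).IsCCWListing (indices D r κ z s) a b c ↔
      D.corners κ s = {D.edgeStart r κ (z a), D.edgeStart r κ (z b), D.edgeStart r κ (z c)} ∧
        0 < orient (D.edgeStart r κ (z a)) (D.edgeStart r κ (z b)) (D.edgeStart r κ (z c)) := by
  have hinj := (R.polygon hz hmem hnext).vert_injective
  refine and_congr ?_ Iff.rfl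
  constructor
  · intro h
    rw [← Finset.coe_inj, ← R.image_indices hmem hs, h]
    simp [Set.image_insert_eq]
  · intro h
    ext i
    have hi (j : Fin (m + 3)) : D.edgeStart r κ (z i) = D.edgeStart r κ (z j) ↔ i = j :=
      hinj.eq_iff (a := i) (b := j)
    rw [mem_indices, h]
    simp [hi]

theorem isTriangulation_polygon (T : Finset (Finset (Fin (m + 3))))
    (hT : ∀ t, t ∈ T ↔ ∃ s ∈ S, indices D r κ z s = t) :
    (R.polygon hz hmem hnext).IsTriangulation T := by
  constructor
  · intro t ht
    obtain ⟨s, hs, rfl⟩ := (hT t).1 ht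
    obtain ⟨p, q, w, hpqw, hpos⟩ := R.complex.nondeg _ (Finset.mem_image_of_mem _ hs)
    obtain ⟨a, rfl, -⟩ := R.exists_index hmem hs (q := p) (by simp [hpqw])
    obtain ⟨b, rfl, -⟩ := R.exists_index hmem hs (q := q) (by simp [hpqw])
    obtain ⟨c, rfl, -⟩ := R.exists_index hmem hs (q := w) (by simp [hpqw])
    exact ⟨a, b, c, (R.isCCWListing_iff hz hmem hnext hs).2 ⟨hpqw, hpos⟩⟩
  · rw [R.closedRegion_polygon hz hmem hnext]
    ext w
    simp only [Set.mem_iUnion, exists_prop, mem_region, Finset.mem_image]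
    constructor
    · rintro ⟨t, ht, hw⟩
      obtain ⟨s, hs, rfl⟩ := (hT t).1 ht
      rw [R.hull_indices hz hmem hnext hs] at hw
      exact ⟨_, ⟨s, hs, rfl⟩, hw⟩
    · rintro ⟨_, ⟨s, hs, rfl⟩, hw⟩
      refine ⟨_, (hT _).2 ⟨s, hs, rfl⟩, ?_⟩
      rwa [R.hull_indices hz hmem hnext hs]
  · intro t ht t' ht' hne
    obtain ⟨s, hs, rfl⟩ := (hT t).1 ht
    obtain ⟨s', hs', rfl⟩ := (hT t').1 ht'
    rw [R.hull_indices hz hmem hnext hs, R.hull_indices hz hmem hnext hs',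
      Set.disjoint_iff_inter_eq_empty, ← interior_inter, ← Set.subset_empty_iff]
    obtain ⟨a, b, c, habc, hpos⟩ := R.complex.nondeg _ (Finset.mem_image_of_mem _ hs)
    obtain ⟨a', b', c', habc', hpos'⟩ := R.complex.nondeg _ (Finset.mem_image_of_mem _ hs')
    have hcard : ∀ a b c : ℝ × ℝ, 0 < orient a b c → ({a, b, c} : Finset (ℝ × ℝ)).card = 3 := by
      intro a b c h
      refine Finset.card_eq_three.2 ⟨a, b, c, ?_, ?_, ?_, rfl⟩ <;> rintro rfl <;>
        simp [orient_self_left, orient_self_right, orient_self_outer] at h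
    have h1 := R.complex.inter _ (Finset.mem_image_of_mem _ hs) _ (Finset.mem_image_of_mem _ hs')
    -- Different triangles have different vertex sets, so their intersection lies in the hull of at
    -- most two vertices.
    refine (interior_mono h1).trans (interior_convexHull_eq_empty hpos ?_ ?_).subset
    · rw [← coe_triple, ← habc]; exact Set.inter_subset_left
    · rw [← coe_triple, ← habc]
      intro h2
      have hsub : D.corners κ s ⊆ D.corners κ s' := by
        rw [← Finset.coe_subset, ← h2]; exact Set.inter_subset_right
      have h3 := Finset.eq_of_subset_of_card_le hsub
        (by rw [habc, habc', hcard _ _ _ hpos, hcard _ _ _ hpos'])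
      exact hne (by rw [R.corners_inj s hs s' hs' h3])

theorem adj_iff_share (hS : ∀ v, v ∈ S ∨ v ∈ Z) (hz : Function.Injective z)
    (hmem : ∀ v, v ∈ Z ↔ ∃ i, z i = v)
    (hnext : ∀ i, D.edgeEnd r κ (z i) = D.edgeStart r κ (z (i + 1))) (hD : D.IsLegal)
    (R : D.Realization r S κ Z) (x y : V) :
    D.graph.Adj x y ↔ x ≠ y ∧ ∃ q q', q ≠ q' ∧ q ∈ points D r S κ x ∧ q' ∈ points D r S κ x ∧
      q ∈ points D r S κ y ∧ q' ∈ points D r S κ y := by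
  have hZS {v : V} (hv : v ∉ S) : v ∈ Z := (hS v).resolve_left hv
  constructor
  · intro h
    refine ⟨h.ne, ?_⟩
    have key : ∀ x y, x ∈ S → D.graph.Adj x y → ∃ q q', q ≠ q' ∧ q ∈ points D r S κ x ∧
        q' ∈ points D r S κ x ∧ q ∈ points D r S κ y ∧ q' ∈ points D r S κ y := by
      intro x y hx h
      have h1 := R.corner_mem_points hx h
      refine ⟨_, _, (R.corner_ne hD hx h).2.2, ?_, ?_, h1.1, h1.2⟩ <;> rw [points_of_mem hx]
      · exact PlaneTree.mem_corners.2 ⟨_, h, rfl⟩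
      · exact PlaneTree.mem_corners.2 ⟨_, PlaneTree.adj_rot (PlaneTree.adj_rot h), rfl⟩
    by_cases hx : x ∈ S
    · exact key x y hx h
    · by_cases hy : y ∈ S
      · obtain ⟨q, q', h0, h1, h2, h3, h4⟩ := key y x hy h.symm
        exact ⟨q, q', h0, h3, h4, h1, h2⟩
      · rcases D.isTree.eq_parent_or r h with h1 | h1
        · exact absurd (h1.1 ▸ ((R.mem_cycle y).1 (hZS hy)).2) hx
        · exact absurd (h1.1 ▸ ((R.mem_cycle x).1 (hZS hx)).2) hy
  · rintro ⟨hxy, q, q', hqq, h1, h2, h3, h4⟩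
    have key : ∀ x y, x ∈ S → y ∉ S → q ∈ points D r S κ x → q' ∈ points D r S κ x →
        q ∈ points D r S κ y → q' ∈ points D r S κ y → D.graph.Adj x y := by
      intro x y hx hy h1 h2 h3 h4
      rw [points_of_mem hx] at h1 h2
      rw [points_of_notMem hy] at h3 h4
      simp only [Finset.mem_insert, Finset.mem_singleton] at h3 h4
      have h5 : D.edgeStart r κ y ∈ D.corners κ x ∧ D.edgeEnd r κ y ∈ D.corners κ x := by
        rcases h3 with rfl | rfl <;> rcases h4 with h4 | h4
        · exact absurd h4.symm hqq
        · exact ⟨h1, h4 ▸ h2⟩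
        · exact ⟨h4 ▸ h2, h1⟩
        · exact absurd h4.symm hqq
      have h6 := R.eq_parent_of_share y (hZS hy) x hx h5.1 h5.2
      have hyr : y ≠ r := by rintro rfl; exact hy R.root_mem
      rw [h6]
      exact (D.isTree.parent_spec hyr).1
    by_cases hx : x ∈ S <;> by_cases hy : y ∈ S
    · rw [points_of_mem hx] at h1 h2
      rw [points_of_mem hy] at h3 h4
      exact R.adj_of_share x hx y hy hxy q q' hqq h1 h3 h2 h4
    · exact key x y hx hy h1 h2 h3 h4
    · exact (key y x hy hx h3 h4 h1 h2).symm
    -- Two polygon edges with two common vertices coincide, since `i + 1 + 1 ≠ i` in a cycle of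
    -- length at least three.
    · exfalso
      obtain ⟨i, rfl⟩ := (hmem x).1 (hZS hx)
      obtain ⟨j, rfl⟩ := (hmem y).1 (hZS hy)
      have hinj : ∀ i j, D.edgeStart r κ (z i) = D.edgeStart r κ (z j) ↔ i = j := fun i j =>
        (R.polygon hz hmem hnext).vert_injective.eq_iff (a := i) (b := j)
      have hij : i ≠ j := by rintro rfl; exact hxy rfl
      rw [points_of_notMem hx, hnext] at h1 h2
      rw [points_of_notMem hy, hnext] at h3 h4
      simp only [Finset.mem_insert, Finset.mem_singleton] at h1 h2 h3 h4
      rcases h1 with rfl | rfl <;> rcases h2 with rfl | rfl <;> simp only [hinj] at h3 h4 <;>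
        simp only [ne_eq, not_true_eq_false] at hqq
      · rcases h3 with h3 | h3
        · exact hij h3
        · rcases h4 with h4 | h4
          · rw [h3] at h4
            exact Fin.add_one_add_one_ne j h4
          · exact hij (add_right_cancel h4)
      · rcases h4 with h4 | h4
        · exact hij h4
        · rcases h3 with h3 | h3
          · rw [h4] at h3
            exact Fin.add_one_add_one_ne j h3
          · exact hij (add_right_cancel h3)

theorem isDirectedDual (hS : ∀ v, v ∈ S ∨ v ∈ Z) (hr : ∀ v ∈ S, ¬ D.IsTerminal v)
    (ht : ∀ v ∈ Z, D.IsTerminal v) (hD : D.IsLegal) (R : D.Realization r S κ Z) :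
    IsDirectedDualOfDeflatedPolygon D := by
  classical
  obtain ⟨m, z, hz, hmem, hnext⟩ := Cycle.exists_enum R.nodup R.length R.chain
  have hZS {v : V} (hv : v ∉ S) : v ∈ Z := (hS v).resolve_left hv
  obtain ⟨T, hT⟩ : ∃ T : Finset (Finset (Fin (m + 3))), T = S.image (indices D r κ z) := ⟨_, rfl⟩
  have hT' : ∀ t, t ∈ T ↔ ∃ s ∈ S, indices D r κ z s = t := by simp [hT]
  have hzS (i : Fin (m + 3)) : z i ∉ S := ((R.mem_cycle _).1 ((hmem _).2 ⟨i, rfl⟩)).1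
  have hidx (v : V) (hv : v ∉ S) : ∃ i, z i = v := (hmem v).1 (hZS hv)
  let g : V → DualNode T := fun v => if hv : v ∈ S then Sum.inl ⟨_, (hT' _).2 ⟨v, hv, rfl⟩⟩
    else Sum.inr (hidx v hv).choose
  have gS {v : V} (hv : v ∈ S) : g v = Sum.inl ⟨_, (hT' _).2 ⟨v, hv, rfl⟩⟩ := by simp [g, hv]
  have gz (i : Fin (m + 3)) : g (z i) = Sum.inr i := by
    simp only [g, hzS i, dif_neg, not_false_eq_true]
    exact congrArg Sum.inr (hz (hidx (z i) (hzS i)).choose_spec)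
  have hg : Function.Bijective g := by
    constructor
    · intro v w hvw
      by_cases hv : v ∈ S <;> by_cases hw : w ∈ S
      · rw [gS hv, gS hw] at hvw
        exact R.indices_inj hmem hv hw (Subtype.ext_iff.1 (Sum.inl.inj hvw))
      · obtain ⟨i, rfl⟩ := hidx w hw
        rw [gS hv, gz] at hvw
        simp at hvw
      · obtain ⟨i, rfl⟩ := hidx v hv
        rw [gS hw, gz] at hvw
        simp at hvw
      · obtain ⟨i, rfl⟩ := hidx v hv
        obtain ⟨j, rfl⟩ := hidx w hw
        rw [gz, gz] at hvw
        rw [Sum.inr.inj hvw]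
    · rintro (⟨t, ht⟩ | i)
      · obtain ⟨s, hs, rfl⟩ := (hT' t).1 ht
        exact ⟨s, gS hs⟩
      · exact ⟨z i, gz i⟩
  have hinl {v : V} {t : {t // t ∈ T}} (h : g v = Sum.inl t) :
      v ∈ S ∧ t.1 = indices D r κ z v := by
    by_cases hv : v ∈ S
    · rw [gS hv] at h
      exact ⟨hv, (Subtype.ext_iff.1 (Sum.inl.inj h)).symm⟩
    · obtain ⟨i, rfl⟩ := hidx v hv
      rw [gz] at h
      simp at h
  have hinj : ∀ i j, D.edgeStart r κ (z i) = D.edgeStart r κ (z j) ↔ i = j := fun i j =>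
    (R.polygon hz hmem hnext).vert_injective.eq_iff (a := i) (b := j)
  have hverts (v : V) (i : Fin (m + 3)) :
      i ∈ (g v).verts ↔ D.edgeStart r κ (z i) ∈ points D r S κ v := by
    by_cases hv : v ∈ S
    · rw [gS hv, points_of_mem hv]
      exact mem_indices
    · obtain ⟨j, rfl⟩ := hidx v hv
      rw [gz, points_of_notMem hv, hnext]
      simp [DualNode.verts, hinj]
  have hpt (v : V) (q : ℝ × ℝ) (hq : q ∈ points D r S κ v) :
      ∃ i, D.edgeStart r κ (z i) = q := by
    by_cases hv : v ∈ S
    · rw [points_of_mem hv] at hq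
      obtain ⟨i, hi, -⟩ := R.exists_index hmem hv hq
      exact ⟨i, hi⟩
    · obtain ⟨j, rfl⟩ := hidx v hv
      rw [points_of_notMem hv, hnext] at hq
      simp only [Finset.mem_insert, Finset.mem_singleton] at hq
      rcases hq with rfl | rfl
      exacts [⟨_, rfl⟩, ⟨_, rfl⟩]
  have hshare (x y : V) (a b : Fin (m + 3)) : (g x).ShareEdge (g y) a b ↔
      D.edgeStart r κ (z a) ≠ D.edgeStart r κ (z b) ∧
      D.edgeStart r κ (z a) ∈ points D r S κ x ∧ D.edgeStart r κ (z b) ∈ points D r S κ x ∧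
      D.edgeStart r κ (z a) ∈ points D r S κ y ∧ D.edgeStart r κ (z b) ∈ points D r S κ y := by
    simp only [DualNode.ShareEdge, hverts, ne_eq, hinj]
  have hadj := adj_iff_share hS hz hmem hnext hD R
  refine ⟨m, R.polygon hz hmem hnext, T, Equiv.ofBijective g hg,
    R.isDeflated_polygon hz hmem hnext, R.isTriangulation_polygon hz hmem hnext T hT', ?_⟩
  constructor
  · intro x y
    simp only [Equiv.ofBijective_apply]
    rw [hadj x y]
    refine and_congr_right fun _ => ?_
    constructor
    · rintro ⟨q, q', h0, h1, h2, h3, h4⟩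
      obtain ⟨a, rfl⟩ := hpt _ _ h1
      obtain ⟨b, rfl⟩ := hpt _ _ h2
      exact ⟨a, b, (hshare x y a b).2 ⟨h0, h1, h2, h3, h4⟩⟩
    · rintro ⟨a, b, h⟩
      exact ⟨_, _, (hshare x y a b).1 h⟩
  · intro x y w t a b c hx hl hxy hab hxw hbc
    simp only [Equiv.ofBijective_apply] at hx hab hbc
    obtain ⟨hxS, hxt⟩ := hinl hx
    rw [hxt, R.isCCWListing_iff hz hmem hnext hxS] at hl
    have h1 := (hshare x y a b).1 hab
    have h2 := (hshare x w b c).1 hbc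
    have h3 := R.eq_of_listing hD hxS hxy hl.1 hl.2 h1.2.2.2.1 h1.2.2.2.2
    have h4 := R.eq_of_listing hD hxS hxw (q₁ := D.edgeStart r κ (z b))
      (q₂ := D.edgeStart r κ (z c)) (q₃ := D.edgeStart r κ (z a))
      (by rw [hl.1]; ext; simp; tauto) (by rw [orient_rotate]; exact hl.2) h2.2.2.2.1 h2.2.2.2.2
    -- The vertex `b` is the end of the edge towards `y` and the start of the edge towards `w`.
    have h5 := R.corner_inj hD hxS hxy (PlaneTree.adj_rot (PlaneTree.adj_rot hxw))
      (h3.2.1.symm.trans h4.1)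
    rw [h5, R.rot_cube hD hxS hxw]
  · intro x y
    simp only [Equiv.ofBijective_apply]
    have hnt {v : V} : ¬ D.IsTerminal v ↔ v ∈ S :=
      ⟨fun h => by by_contra hv; exact h (ht v (hZS hv)), hr v⟩
    constructor
    · intro hxy
      have ha := D.dir_adj _ _ hxy
      have hxyS := (hD.dir x y ha).1 (Or.inl hxy)
      rw [hnt, hnt] at hxyS
      obtain ⟨hx, hy⟩ := hxyS
      refine ⟨_, _, gS hx, gS hy, ?_⟩
      have hcx := R.corners_eq hD hx ha
      have hcy := R.corners_eq hD hy ha.symm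
      obtain ⟨u, hu, -⟩ := R.exists_index hmem hx (q := κ x (D.rot x y)) (by simp [hcx])
      obtain ⟨v, hv, -⟩ := R.exists_index hmem hx (q := κ x (D.rot x (D.rot x y))) (by simp [hcx])
      obtain ⟨w, hw, -⟩ := R.exists_index hmem hx (q := κ x y) (by simp [hcx])
      obtain ⟨u', hu', -⟩ := R.exists_index hmem hy (q := κ y (D.rot y x)) (by simp [hcy])
      have hv' : κ y x = κ x (D.rot x (D.rot x y)) := R.compat x hx y hy ha
      have hw' : κ x y = κ y (D.rot y (D.rot y x)) := R.compat y hy x hx ha.symm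
      refine ⟨u, v, w, u', (R.isCCWListing_iff hz hmem hnext hx).2 ?_,
        (R.isCCWListing_iff hz hmem hnext hy).2 ?_, ?_⟩
      · rw [hu, hv, hw]
        exact ⟨hcx.trans (by ext; simp; tauto), by rw [orient_rotate]; exact R.pos x hx y ha⟩
      · rw [hv, hu', hw, ← hv', hw']
        exact ⟨hcy, R.pos y hy x ha.symm⟩
      · change orient (D.edgeStart r κ (z u)) (D.edgeStart r κ (z v)) (D.edgeStart r κ (z u')) < 0
        rw [hu, hv, hu', ← orient_rotate]
        exact R.reflex x hx y hy hxy
    · rintro ⟨t, t', hx, hy, u, v, w, u', hl, hl', hneg⟩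
      obtain ⟨hxS, hxt⟩ := hinl hx
      obtain ⟨hyS, hyt⟩ := hinl hy
      rw [hxt, R.isCCWListing_iff hz hmem hnext hxS] at hl
      rw [hyt, R.isCCWListing_iff hz hmem hnext hyS] at hl'
      change orient (D.edgeStart r κ (z u)) (D.edgeStart r κ (z v)) (D.edgeStart r κ (z u')) < 0
        at hneg
      have hvw : D.edgeStart r κ (z v) ≠ D.edgeStart r κ (z w) := by
        intro h; rw [h, orient_self_right] at hl; exact lt_irrefl _ hl.2
      have hxy : x ≠ y := by
        rintro rfl
        have h1 : D.edgeStart r κ (z u) ∈ D.corners κ x := by simp [hl.1]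
        rw [hl'.1] at h1
        simp only [Finset.mem_insert, Finset.mem_singleton] at h1
        rcases h1 with h1 | h1 | h1
        · rw [h1, orient_self_left] at hl; exact lt_irrefl _ hl.2
        · have h2 := hl.2
          rw [h1, orient_swap_left] at h2
          linarith [hl'.2]
        · rw [h1, orient_self_outer] at hl; exact lt_irrefl _ hl.2
      have hvx : D.edgeStart r κ (z v) ∈ points D r S κ x := by
        rw [points_of_mem hxS]; simp [hl.1]
      have hwx : D.edgeStart r κ (z w) ∈ points D r S κ x := by
        rw [points_of_mem hxS]; simp [hl.1]
      have hvy : D.edgeStart r κ (z v) ∈ points D r S κ y := by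
        rw [points_of_mem hyS]; simp [hl'.1]
      have hwy : D.edgeStart r κ (z w) ∈ points D r S κ y := by
        rw [points_of_mem hyS]; simp [hl'.1]
      have ha : D.graph.Adj x y := (hadj x y).2 ⟨hxy, _, _, hvw, hvx, hwx, hvy, hwy⟩
      have h1 := R.eq_of_listing hD hxS ha (q₁ := D.edgeStart r κ (z v))
        (q₂ := D.edgeStart r κ (z w)) (q₃ := D.edgeStart r κ (z u))
        (by rw [hl.1]; ext; simp; tauto) (by rw [orient_rotate]; exact hl.2) hvy hwy
      have h2 := R.eq_of_listing hD hyS ha.symm (q₁ := D.edgeStart r κ (z w))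
        (q₂ := D.edgeStart r κ (z v)) (q₃ := D.edgeStart r κ (z u'))
        (by rw [hl'.1]; ext; simp; tauto) (by rw [← orient_rotate]; exact hl'.2) hwx hvx
      -- If the step from `x` to `y` is not forward, then `convex` applies to the fan of these two
      -- triangles at the vertex `v` and contradicts the reflex angle.
      by_contra hdir
      have hcube := R.rot_cube hD hxS ha
      have h3 := R.convex (D.rot x (D.rot x y), x) (x, y) hxS
        (PlaneTree.adj_rot (PlaneTree.adj_rot ha))
        (ReflTransGen.single ⟨⟨hxS, hyS, by rw [hcube]⟩, hdir⟩)
      simp only [hcube] at h3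
      rw [← h1.1, ← h1.2.2, ← h2.2.2, orient_rotate] at h3
      linarith

end PartiallyDirectedPlaneTree.Realization

/-! ## Overlapping triangles with a common vertex -/

/-- If an inner direction of the second angle at `v` is an inner direction of the first, then the
triangles overlap. -/
theorem not_disjoint_interior_of_direction {v p q r s : ℝ × ℝ} (hpq : 0 < orient v p q)
    (hrs : 0 < orient v r s) {l m : ℝ} (hl : 0 < l) (hm : 0 < m)
    (hp : 0 < l * orient v p r + m * orient v p s)
    (hq : 0 < l * orient v r q + m * orient v s q) :
    ¬ Disjoint (interior (convexHull ℝ {v, p, q})) (interior (convexHull ℝ {v, r, s})) := by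
  -- The common interior point is `v + d(l(r - v) + m(s - v))` with `d` small.
  have hev : ∀ᶠ d in 𝓝[>] (0 : ℝ), 0 < d ∧ 0 < 1 - d * l - d * m ∧
      0 < (1 - d * l - d * m) * orient p q v + (d * l) * orient p q r +
        (d * m) * orient p q s := by
    refine self_mem_nhdsWithin |> Filter.Eventually.and <| nhdsWithin_le_nhds ?_
    refine (ContinuousAt.eventually_lt (f := fun _ => 0) (x₀ := (0 : ℝ)) (by fun_prop)
      (by fun_prop) (by simp)).and (ContinuousAt.eventually_lt (f := fun _ => 0)
      (by fun_prop) (by fun_prop) ?_)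
    simpa [orient_rotate] using hpq
  obtain ⟨d, hd, h1, h2⟩ := hev.exists
  have hsum : (1 - d * l - d * m) + d * l + d * m = 1 := by ring
  refine Set.not_disjoint_iff.2 ⟨(1 - d * l - d * m) • v + (d * l) • r + (d * m) • s,
    openTriangle_subset_interior hpq ⟨?_, ?_, ?_⟩,
    openTriangle_subset_interior hrs ⟨?_, ?_, ?_⟩⟩
  · rw [orient_combo _ _ _ _ _ hsum, orient_self_outer]
    nlinarith
  · rwa [orient_combo _ _ _ _ _ hsum]
  · rw [orient_combo _ _ _ _ _ hsum, orient_self_right, ← orient_rotate q v r, ← orient_rotate q v s]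
    nlinarith
  · rw [orient_combo _ _ _ _ _ hsum, orient_self_outer, orient_self_right]
    have := mul_pos (mul_pos hd hm) hrs
    linarith
  · rw [orient_combo _ _ _ _ _ hsum, orient_self_outer, orient_self_right, orient_rotate]
    have := mul_pos h1 hrs
    linarith
  · rw [orient_combo _ _ _ _ _ hsum, orient_self_outer, orient_self_right, ← orient_rotate s v r]
    have := mul_pos (mul_pos hd hl) hrs
    linarith

/-- The orientations at `v` are the 2×2 minors of four vectors. This relation replaces the
comparison of angles below. -/
theorem plucker (v a b c d : ℝ × ℝ) :
    orient v a b * orient v c d - orient v a c * orient v b d + orient v a d * orient v b c = 0 := by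
  unfold orient; ring

/-- The right leg of an angle does not point into another one if the triangles do not overlap. -/
theorem not_right_leg_mem {v p q r s : ℝ × ℝ} (hpq : 0 < orient v p q) (hrs : 0 < orient v r s)
    (hd : Disjoint (interior (convexHull ℝ {v, p, q})) (interior (convexHull ℝ {v, r, s}))) :
    ¬ (0 ≤ orient v p r ∧ 0 < orient v r q) := by
  rintro ⟨h1, h2⟩
  -- The leg is tilted slightly into its own angle. If `r` lies on the line `vp`, the Plücker
  -- relation shows that the tilt goes to the correct side.
  have hp : ∀ᶠ e in 𝓝[>] (0 : ℝ), 0 < 1 * orient v p r + e * orient v p s := by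
    rcases h1.eq_or_lt with h0 | h0
    · have h3 : 0 < orient v p s := by
        have := plucker v p r q s
        rw [← h0, zero_mul] at this
        have := mul_pos hpq hrs
        exact pos_of_mul_pos_left (by linarith) h2.le
      filter_upwards [self_mem_nhdsWithin] with e he
      rw [← h0, mul_zero, zero_add]
      exact mul_pos he h3
    · refine nhdsWithin_le_nhds (ContinuousAt.eventually_lt (f := fun _ => 0) (by fun_prop)
        (by fun_prop) ?_)
      simpa
  have hq : ∀ᶠ e in 𝓝[>] (0 : ℝ), 0 < 1 * orient v r q + e * orient v s q :=
    nhdsWithin_le_nhds (ContinuousAt.eventually_lt (f := fun _ => 0) (by fun_prop)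
        (by fun_prop) (by simpa))
  obtain ⟨e, ⟨h3, he⟩, h4⟩ := ((Eventually.and hp self_mem_nhdsWithin).and hq).exists
  exact not_disjoint_interior_of_direction hpq hrs one_pos he h3 h4 hd

/-- The left leg of an angle does not point into another one if the triangles do not overlap. -/
theorem not_left_leg_mem {v p q r s : ℝ × ℝ} (hpq : 0 < orient v p q) (hrs : 0 < orient v r s)
    (hd : Disjoint (interior (convexHull ℝ {v, p, q})) (interior (convexHull ℝ {v, r, s}))) :
    ¬ (0 < orient v p s ∧ 0 ≤ orient v s q) := by
  rintro ⟨h1, h2⟩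
  have hq : ∀ᶠ e in 𝓝[>] (0 : ℝ), 0 < e * orient v r q + 1 * orient v s q := by
    rcases h2.eq_or_lt with h0 | h0
    · have h3 : 0 < orient v r q := by
        have := plucker v p r s q
        rw [← h0, mul_zero] at this
        have := mul_pos hpq hrs
        exact pos_of_mul_pos_right (by linarith) h1.le
      filter_upwards [self_mem_nhdsWithin] with e he
      rw [← h0, mul_zero, add_zero]
      exact mul_pos he h3
    · refine nhdsWithin_le_nhds (ContinuousAt.eventually_lt (f := fun _ => 0) (by fun_prop)
        (by fun_prop) ?_)
      simpa
  have hp : ∀ᶠ e in 𝓝[>] (0 : ℝ), 0 < e * orient v p r + 1 * orient v p s :=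
    nhdsWithin_le_nhds (ContinuousAt.eventually_lt (f := fun _ => 0) (by fun_prop)
        (by fun_prop) (by simpa))
  obtain ⟨e, ⟨h3, he⟩, h4⟩ := ((Eventually.and hp self_mem_nhdsWithin).and hq).exists
  exact not_disjoint_interior_of_direction hpq hrs he one_pos h3 h4 hd

/-- Two pairs of adjacent triangles that both have a reflex angle at `v` overlap. -/
theorem false_of_two_reflex {v p₀ p₁ p₂ q₀ q₁ q₂ : ℝ × ℝ} (hp₁ : 0 < orient v p₁ p₀)
    (hp₂ : 0 < orient v p₂ p₁) (hp : 0 < orient v p₀ p₂) (hq₁ : 0 < orient v q₁ q₀)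
    (hq₂ : 0 < orient v q₂ q₁) (hq : 0 < orient v q₀ q₂)
    (h₁₁ : Disjoint (interior (convexHull ℝ {v, p₁, p₀})) (interior (convexHull ℝ {v, q₁, q₀})))
    (h₁₂ : Disjoint (interior (convexHull ℝ {v, p₁, p₀})) (interior (convexHull ℝ {v, q₂, q₁})))
    (h₂₁ : Disjoint (interior (convexHull ℝ {v, p₂, p₁})) (interior (convexHull ℝ {v, q₁, q₀})))
    (h₂₂ : Disjoint (interior (convexHull ℝ {v, p₂, p₁})) (interior (convexHull ℝ {v, q₂, q₁}))) :
    False := by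
  -- The first pair fills more than a half-turn, from `p₂` over `p₁` to `p₀`. The middle ray `q₁` of
  -- the second pair has to lie strictly in the remaining gap.
  have key : 0 < orient v p₀ q₁ ∧ 0 < orient v q₁ p₂ := by
    have a1 := not_right_leg_mem hp₁ hq₁ h₁₁
    have a2 := not_right_leg_mem hp₂ hq₁ h₂₁
    have a3 := not_left_leg_mem hp₁ hq₂ h₁₂
    have a4 := not_left_leg_mem hp₂ hq₂ h₂₂
    have e := plucker v p₀ p₁ p₂ q₁
    have e' := plucker v p₀ p₁ q₁ q₀
    rw [orient_swap v p₀ q₁] at a1 a3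
    rw [orient_swap v p₁ q₁] at a2 a4
    rw [orient_swap v p₁ p₀, orient_swap v p₂ p₁] at e
    rw [orient_swap v p₁ p₀] at e'
    rw [orient_swap v q₁ p₂] at e a2 a4
    generalize orient v p₀ q₁ = x at *
    generalize orient v p₁ q₁ = y at *
    generalize orient v q₁ p₂ = z at *
    rcases lt_trichotomy y 0 with hy | rfl | hy
    · have hz : 0 < z := by
        by_contra hz; exact a2 ⟨by linarith, by linarith⟩
      refine ⟨by_contra fun hx => ?_, by linarith⟩
      have := mul_pos hp₁ hz
      have := mul_pos_of_neg_of_neg hy (neg_neg_of_pos hp)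
      nlinarith
    · have hx : 0 ≤ x := by
        by_contra hx; exact a1 ⟨le_rfl, by linarith⟩
      have hx' : 0 < x := hx.lt_of_ne fun h0 => by
        rw [← h0] at e'
        have := mul_pos hp₁ hq₁
        linarith
      refine ⟨hx', by_contra fun hz => ?_⟩
      have := mul_pos hp₂ hx'
      nlinarith
    · have hx : 0 < x := by
        by_contra hx; exact a3 ⟨hy, by linarith⟩
      refine ⟨hx, by_contra fun hz => ?_⟩
      have := mul_pos hp₂ hx
      have := mul_pos hy hp
      nlinarith
  obtain ⟨k1, k2⟩ := key
  -- The outer legs `q₀` and `q₂` cannot cross the ends of the gap either. The gap is narrower than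
  -- π, while the second pair is wider.
  have b1 : orient v p₂ q₀ ≤ 0 := by
    by_contra h; exact not_right_leg_mem hq₁ hp₂ h₂₁.symm ⟨k2.le, by linarith⟩
  have b2 : orient v q₂ p₀ ≤ 0 := by
    by_contra h; exact not_left_leg_mem hq₂ hp₁ h₁₂.symm ⟨by linarith, k1.le⟩
  rw [orient_swap] at b1 b2
  have c1 : 0 < orient v p₀ q₀ := by
    have := plucker v p₀ q₁ q₀ p₂
    have := mul_nonneg k1.le (neg_nonpos.1 b1)
    have := mul_pos hp hq₁
    exact pos_of_mul_pos_left (by linarith) k2.le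
  have := plucker v p₀ q₂ q₁ q₀
  rw [orient_swap v q₀ q₂] at this
  have := mul_nonneg (neg_nonpos.1 b2) hq₁.le
  have := mul_pos c1 hq₂
  have := mul_pos k1 hq
  linarith

/-! ## Directed duals have no illegal paths -/

namespace SimpleGraph.IsTree

/-- Adjacent nodes of a tree have different distances from `x`, but `y` and `z` are both at distance
one. -/
theorem not_adj_of_adj_of_adj {V : Type*} {G : SimpleGraph V} (hG : G.IsTree) {x y z : V}
    (hy : G.Adj x y) (hz : G.Adj x z) : ¬ G.Adj y z := fun h =>
  hG.dist_ne_of_adj x h (by rw [dist_eq_one_iff_adj.2 hy, dist_eq_one_iff_adj.2 hz])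

end SimpleGraph.IsTree

namespace SimplePolygon

variable {m : ℕ} {P : SimplePolygon m} {t t' : Finset (Fin (m + 3))} {a b c d : Fin (m + 3)}

namespace IsCCWListing

theorem rotate (h : P.IsCCWListing t a b c) : P.IsCCWListing t b c a :=
  ⟨by rw [h.1]; ext; simp; tauto, by rw [orient_rotate]; exact h.2⟩

theorem hull_eq (h : P.IsCCWListing t a b c) :
    P.hull t = convexHull ℝ {P.vert a, P.vert b, P.vert c} := by
  rw [hull, h.1]; simp [Set.image_insert_eq]

theorem ne (h : P.IsCCWListing t a b c) : a ≠ b := by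
  rintro rfl; exact h.2.ne' (orient_self_left _ _)

theorem eq_or_of_edge (h : P.IsCCWListing t a b c) {p q : Fin (m + 3)} (hpq : p ≠ q)
    (hp : p ∈ t) (hq : q ∈ t) :
    ∃ r, P.IsCCWListing t p q r ∨ P.IsCCWListing t q p r := by
  have h1 := h.rotate
  have h2 := h1.rotate
  simp only [h.1, Finset.mem_insert, Finset.mem_singleton] at hp hq
  rcases hp with rfl | rfl | rfl <;> rcases hq with rfl | rfl | rfl <;>
    first
      | exact absurd rfl hpq
      | exact ⟨_, Or.inl h⟩
      | exact ⟨_, Or.inl h1⟩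
      | exact ⟨_, Or.inl h2⟩
      | exact ⟨_, Or.inr h⟩
      | exact ⟨_, Or.inr h1⟩
      | exact ⟨_, Or.inr h2⟩

end IsCCWListing

/-- Two triangles of a triangulation lie on different sides of a common edge. -/
theorem IsTriangulation.eq_of_listing {T : Finset (Finset (Fin (m + 3)))} (hT : P.IsTriangulation T)
    (ht : t ∈ T) (ht' : t' ∈ T) (h : P.IsCCWListing t a b c) (h' : P.IsCCWListing t' a b d) :
    t = t' := by
  by_contra hne
  have hd := hT.disjoint t ht t' ht' hne
  rw [h.hull_eq, h'.hull_eq] at hd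
  exact not_right_leg_mem h.2 h'.2 hd ⟨(orient_self_right _ _).ge, h.2⟩

end SimplePolygon

namespace IsDirectedDualVia

variable {V : Type*} {D : PartiallyDirectedPlaneTree V} {m : ℕ} {P : SimplePolygon m}
  {T : Finset (Finset (Fin (m + 3)))} {φ : V ≃ DualNode T}

/-- A polygon edge has only one pair of vertices to share. Two neighbours would share it with each
other and close a 3-cycle. -/
theorem exists_triangle (hφ : IsDirectedDualVia D P T φ) {x y z : V} (hy : D.graph.Adj x y)
    (hz : D.graph.Adj x z) (hyz : y ≠ z) : ∃ t, φ x = Sum.inl t := by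
  rcases hx : φ x with t | i
  · exact ⟨t, rfl⟩
  · obtain ⟨-, a, b, hab, h1, h2, h3, h4⟩ := (hφ.adj_iff x y).1 hy
    obtain ⟨-, c, d, hcd, h5, h6, h7, h8⟩ := (hφ.adj_iff x z).1 hz
    refine absurd ((hφ.adj_iff y z).2 ⟨hyz, a, b, hab, h3, h4, ?_⟩)
      (D.isTree.not_adj_of_adj_of_adj hy hz)
    simp only [hx, DualNode.verts, Finset.mem_insert, Finset.mem_singleton] at h1 h2 h5 h6
    rcases h1 with rfl | rfl <;> rcases h2 with rfl | rfl <;> rcases h5 with rfl | rfl <;>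
      rcases h6 with rfl | rfl <;>
      first
        | exact ⟨h7, h8⟩
        | exact ⟨h8, h7⟩
        | exact absurd rfl hab
        | exact absurd rfl hcd

/-- The walk along the outer face that enters the triangle `vu'w` through `vw` leaves it
through `vu'`. -/
theorem mem_verts_of_rot (hφ : IsDirectedDualVia D P T φ)
    (hdeg : ∀ v, ¬ D.IsTerminal v → D.deg v = 3) {x y z : V} {t : {t // t ∈ T}}
    {v u w : Fin (m + 3)} (hx : φ x = Sum.inl t) (ht : P.IsCCWListing t.1 v u w)
    (hy : D.graph.Adj x y) (hv : v ∈ (φ y).verts) (hw : w ∈ (φ y).verts)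
    (hz : D.rot x y = z) (hyz : y ≠ z) : v ∈ (φ z).verts ∧ u ∈ (φ z).verts := by
  have hxz : D.graph.Adj x z := hz ▸ PlaneTree.adj_rot hy
  have hterm : ¬ D.IsTerminal x := fun h => by
    obtain ⟨a, ha⟩ := Set.ncard_eq_one.1 h
    have h1 : y ∈ D.graph.neighborSet x := hy
    have h2 : z ∈ D.graph.neighborSet x := hxz
    rw [ha] at h1 h2
    exact hyz (h1.trans h2.symm)
  obtain ⟨-, a, b, hab, h1, h2, h3, h4⟩ := (hφ.adj_iff x z).1 hxz
  -- If `z` shared `vw`, it would be adjacent to `y`. If it shared `uw`, the rotation would lead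
  -- from `z` back to `y`. Only `vu` is left.
  have hvw : ¬ (v ∈ (φ z).verts ∧ w ∈ (φ z).verts) := fun h =>
    D.isTree.not_adj_of_adj_of_adj hy hxz
      ((hφ.adj_iff y z).2 ⟨hyz, v, w, ht.rotate.rotate.ne.symm, hv, hw, h.1, h.2⟩)
  have huw : ¬ (u ∈ (φ z).verts ∧ w ∈ (φ z).verts) := fun h => by
    have h5 := hφ.rot_eq x z y t u w v hx ht.rotate hxz
      ⟨ht.rotate.ne, by simp [hx, DualNode.verts, ht.1], by simp [hx, DualNode.verts, ht.1],
        h.1, h.2⟩ hy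
      ⟨ht.rotate.rotate.ne, by simp [hx, DualNode.verts, ht.1],
        by simp [hx, DualNode.verts, ht.1], hw, hv⟩
    rw [← hz] at h5
    exact (PlaneTree.rot_cube hdeg hterm hy).2.2.1 h5
  simp only [hx, DualNode.verts, ht.1, Finset.mem_insert, Finset.mem_singleton] at h1 h2
  rcases h1 with rfl | rfl | rfl <;> rcases h2 with rfl | rfl | rfl <;> tauto

theorem not_isIllegalPath (hφ : IsDirectedDualVia D P T φ) (hT : P.IsTriangulation T)
    (hdeg : ∀ v, ¬ D.IsTerminal v → D.deg v = 3) {n : ℕ} {x : ℕ → V} :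
    ¬ D.IsIllegalPath n x := by
  rintro ⟨hn, hx, h1, h2⟩
  obtain ⟨t₁, t₂, e₁, e₂, u₁, v, w₁, u₂, l₁, l₂, hr⟩ := (hφ.dir_iff _ _).1 h1
  obtain ⟨s₁, s₂, f₁, f₂, p₁, v', q₁, p₂, k₁, k₂, hr'⟩ := (hφ.dir_iff _ _).1 h2
  have hne {i j : ℕ} (hi : i ∈ Set.Icc 1 n) (hj : j ∈ Set.Icc 1 n) (hij : i ≠ j) :
      x i ≠ x j := fun h => hij (hx.injOn hi hj h)
  -- The vertex `v` at which the first pair is reflex remains on the right of the whole path.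
  have pivot : ∀ i, 1 ≤ i → i + 1 ≤ n → ∃ (t t' : {t // t ∈ T}) (u w u' : Fin (m + 3)),
      φ (x i) = Sum.inl t ∧ φ (x (i + 1)) = Sum.inl t' ∧ P.IsCCWListing t.1 u v w ∧
        P.IsCCWListing t'.1 v u' w := by
    intro i hi
    induction i, hi using Nat.le_induction with
    | base => exact fun _ => ⟨t₁, t₂, u₁, w₁, u₂, e₁, e₂, l₁, l₂⟩
    | succ i hi ih =>
      intro hin
      obtain ⟨t, t', u, w, u', ht, ht', l, l'⟩ := ih (by omega)
      have hxy := (hx.adj i hi (by omega)).symm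
      have hxz := hx.adj (i + 1) (by omega) hin
      have hyz : x i ≠ x (i + 2) := hne ⟨hi, by omega⟩ ⟨by omega, hin⟩ (by omega)
      have hm := hφ.mem_verts_of_rot hdeg ht' l' hxy (by simp [ht, DualNode.verts, l.1])
        (by simp [ht, DualNode.verts, l.1]) (hx.turn i hi hin) hyz
      -- The last node is a triangle because its edge is directed, an inner node because it has two
      -- neighbours on the path.
      obtain ⟨s, hs⟩ : ∃ s, φ (x (i + 2)) = Sum.inl s := by
        rcases hin.eq_or_lt with h | h
        · exact ⟨s₂, by rw [← f₂, ← h]⟩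
        · exact hφ.exists_triangle hxz.symm (hx.adj (i + 2) (by omega) h)
            (hne ⟨by omega, by omega⟩ ⟨by omega, h⟩ (by omega))
      rw [hs] at hm
      obtain ⟨a, b, c, hs'⟩ := hT.triangle s.1 s.2
      obtain ⟨r, hr | hr⟩ := hs'.eq_or_of_edge l'.ne hm.1 hm.2
      · refine absurd (φ.injective (ht'.trans ?_)) hxz.ne
        rw [show x (i + 1 + 1) = x (i + 2) from rfl, hs]
        exact congrArg Sum.inl (Subtype.ext (hT.eq_of_listing t'.2 s.2 l' hr))
      · exact ⟨t', s, w, u', r, ht', hs, l'.rotate.rotate, hr.rotate⟩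
  obtain ⟨t, t', u, w, u', ht, ht', l, l'⟩ := pivot (n - 1) (by omega) (by omega)
  rw [Nat.sub_add_cancel (by omega)] at ht'
  obtain rfl : s₁ = t := Sum.inl_injective (f₁.symm.trans ht)
  obtain rfl : s₂ = t' := Sum.inl_injective (f₂.symm.trans ht')
  have hss : s₁.1 ≠ s₂.1 := fun h =>
    hne (i := n - 1) (j := n) ⟨by omega, by omega⟩ ⟨by omega, le_rfl⟩ (by omega)
      (φ.injective (by rw [f₁, f₂, Subtype.ext h]))
  have huu : u ∉ s₂.1 := fun h => by
    have := l.ne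
    have := l.rotate.rotate.ne
    refine hss ?_
    rw [l'.1] at h ⊢
    rw [l.1]
    simp only [Finset.mem_insert, Finset.mem_singleton] at h
    obtain rfl : u = u' := by tauto
    ext; simp; tauto
  -- Both listings put the vertex on the right of the crossing second; confusing it with the left
  -- one would reverse the orientation of the triangle.
  have hv' : v' = v := by
    have a1 : v' ∈ s₁.1 := by simp [k₁.1]
    have a2 : v' ∈ s₂.1 := by simp [k₂.1]
    have a3 : q₁ ∈ s₁.1 := by simp [k₁.1]
    have a4 : q₁ ∈ s₂.1 := by simp [k₂.1]
    have a5 : p₁ ∈ s₁.1 := by simp [k₁.1]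
    rw [l.1] at a1 a3 a5
    simp only [Finset.mem_insert, Finset.mem_singleton] at a1 a3 a5
    have b1 := k₁.ne
    have b2 := k₁.rotate.ne
    have b3 := k₁.rotate.rotate.ne
    by_contra hv
    obtain rfl : v' = w := by
      rcases a1 with rfl | rfl | rfl
      · exact absurd a2 huu
      · exact absurd rfl hv
      · rfl
    obtain rfl : q₁ = v := by
      rcases a3 with rfl | rfl | rfl
      · exact absurd a4 huu
      · rfl
      · exact absurd rfl b2
    obtain rfl : p₁ = u := by tauto
    have := k₁.2
    rw [orient_swap] at this
    have := l.2
    linarith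
  subst hv'
  have disj {i j : ℕ} (hi : i ∈ Set.Icc 1 n) (hj : j ∈ Set.Icc 1 n) (hij : i ≠ j)
      {t t' : {t // t ∈ T}} (ht : φ (x i) = Sum.inl t) (ht' : φ (x j) = Sum.inl t')
      {a b c d e f : Fin (m + 3)} (l : P.IsCCWListing t.1 a b c)
      (l' : P.IsCCWListing t'.1 d e f) :
      Disjoint (interior (convexHull ℝ {P.vert a, P.vert b, P.vert c}))
        (interior (convexHull ℝ {P.vert d, P.vert e, P.vert f})) := by
    rw [← l.hull_eq, ← l'.hull_eq]
    refine hT.disjoint _ t.2 _ t'.2 fun h => hne hi hj hij (φ.injective ?_)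
    rw [ht, ht', Subtype.ext h]
  rw [← neg_pos, ← orient_swap_left] at hr hr'
  refine false_of_two_reflex l₁.rotate.2 l₂.2 hr k₁.rotate.2 k₂.2 hr'
    (disj ⟨le_rfl, by omega⟩ ⟨by omega, by omega⟩ (by omega) e₁ f₁ l₁.rotate k₁.rotate)
    (disj ⟨le_rfl, by omega⟩ ⟨by omega, by omega⟩ (by omega) e₁ f₂ l₁.rotate k₂)
    (disj ⟨by omega, by omega⟩ ⟨by omega, by omega⟩ (by omega) e₂ f₁ l₂ k₁.rotate)
    (disj ⟨by omega, by omega⟩ ⟨by omega, by omega⟩ (by omega) e₂ f₂ l₂ k₂)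

end IsDirectedDualVia

theorem mainTheorem4 {V : Type*} [Finite V] (D : PartiallyDirectedPlaneTree V)
    (hne : ∃ v, ¬ D.IsTerminal v)
    (hdeg : ∀ v, ¬ D.IsTerminal v → D.deg v = 3)
    (hdir : ∀ x y, D.graph.Adj x y →
      ((D.Dir x y ∨ D.Dir y x) ↔ (¬ D.IsTerminal x ∧ ¬ D.IsTerminal y))) :
    IsDirectedDualOfDeflatedPolygon D ↔
      ¬ ∃ (n : ℕ) (x : ℕ → V), D.IsIllegalPath n x := by
  constructor
  · rintro ⟨m, P, T, φ, -, hT, hφ⟩ ⟨n, x, hx⟩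
    exact hφ.not_isIllegalPath hT hdeg hx
  · intro h
    have hD : D.IsLegal := ⟨hdeg, hdir, h⟩
    obtain ⟨v, hv⟩ := hne
    obtain ⟨S, κ, Z, R, hZ⟩ := hD.exists_realization hv
    exact R.isDirectedDual (R.mem_or_mem hZ) R.nonterminal hZ hD
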